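/- Let $k$ be a field, $S$ a (graded-)commutative differential ($\mathbb Z$-)graded $k$-algebra, and $R$ an augmented commutative dg $S$-algebra, i.e. a commutative dg $S$-algebra with a morphism of dg algebras $R\to S$ whose composition with the unit $S\to R$ is the identity. Let $\mathfrak n$ be the kernel of the augmentation $R\to S$, so that $R=S\oplus\mathfrak n$, and suppose that $\mathfrak n^2=0$. Let $A$ be a (not necessarily commutative) dg $S$-algebra which is free as a graded $S$-module. Modules are right modules. For a commutative dg algebra $B$ and a dg $B$-algebra $E$, the relative derived category $\mathcal D_B E$ is the localization of the category of dg $E$-modules at the morphisms whose restriction to $B$ is a homotopy equivalence of dg $B$-modules. The functors $L\mapsto L\otimes_R S$ and $M\mapsto M\otimes_S\mathfrak n[1]$ induce functors $\mathcal D_R(A\otimes_S R)\to\mathcal D_S A$ and $\mathcal D_S A\to\mathcal D_S A$. Let $M$ be a dg $A$-module which is free as a graded $S$-module. A deformation of $M$ is a pair $(L,u)$ consisting of a dg $A\otimes_S R$-module $L$, free as a graded $R$-module, and an isomorphism $u:L\otimes_R S\to M$ of $\mathcal D_S A$. A morphism $(L,u)\to(L',u')$ is a morphism $v:L\to L'$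 of $\mathcal D_R(A\otimes_S R)$ such that $u'\circ(v\otimes_R S)=u$. Let $\mathrm{Defo}(M,R\to S)$ be the set of isomorphism classes of the category of deformations of $M$. For a deformation $(L,u)$, the sequence of dg $A$-modules $0\to L\otimes_R\mathfrak n\xrightarrow{\,i\,}L\to L\otimes_R S\to 0$ is exact and splits as a sequence of graded $S$-modules; hence the induced morphism $q:\mathrm{Cone}(i)\to L\otimes_R S$ is invertible in $\mathcal D_S A$. Let $\varepsilon':L\otimes_R S\to (L\otimes_R\mathfrak n)[1]$ be the connecting morphism $\partial\circ q^{-1}$ of $\mathcal D_S A$, where $\partial:\mathrm{Cone}(i)\to(L\otimes_R\mathfrak n)[1]$ is $(x,y)\mapsto -x$. Since $\mathfrak n^2=0$, there is a canonical isomorphism $L\otimes_R\mathfrak n\cong(L\otimes_R S)\otimes_S\mathfrak n$, $l\otimes x\mapsto(l\otimes1)\otimes x$. The characteristic class of $(L,u)$ is the morphism of $\mathcal D_S A$ $$\varepsilon(L,u)=(u\otimes_S\mathfrak n[1])\circ\varepsilon'\circ u^{-1}:M\to M\otimes_S\mathfrak n[1],$$ where $(L\otimes_R\mathfrak n)[1]$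 is identified with $(L\otimes_R S)\otimes_S\mathfrak n[1]$. Proposition. The morphism $\varepsilon(L,u)$ is well defined and depends only on the isomorphism class of $(L,u)$, and the map $(L,u)\mapsto\varepsilon(L,u)$ induces a bijection $$\mathrm{Defo}(M,R\to S)\;\xrightarrow{\ \sim\ }\;\mathrm{Hom}_{\mathcal D_S A}(M,M\otimes_S\mathfrak n[1]).$$ -/

import Mathlib

open CategoryTheory TensorProduct MulOpposite

universe u

namespace DG

/-! Generalities on `ℤ`-graded vector spaces (internal gradings). -/

section Graded

variable {k : Type u} [Field k]

theorem sign_congr {i j : ℤ} (h : Even i ↔ Even j) : (-1 : k) ^ i = (-1 : k) ^ j := by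
  by_cases hi : Even i
  · rw [hi.neg_one_zpow, (h.1 hi).neg_one_zpow]
  · have hj : ¬ Even j := fun hj => hi (h.2 hj)
    rw [(Int.not_even_iff_odd.1 hi).neg_one_zpow, (Int.not_even_iff_odd.1 hj).neg_one_zpow]

theorem sign_mul (i j : ℤ) : (-1 : k) ^ i * (-1 : k) ^ j = (-1 : k) ^ (i + j) :=
  (zpow_add₀ (neg_ne_zero.2 one_ne_zero) i j).symm

variable {M P : Type u} [AddCommGroup M] [Module k M] [AddCommGroup P] [Module k P]
  {gr : ℤ → Submodule k M}

theorem bijective_coe (h : DirectSum.IsInternal gr) :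
    Function.Bijective (DirectSum.coeLinearMap gr) := h

/-- The linear map on a graded vector space with prescribed restrictions to the components. -/
noncomputable def gradedLift (h : DirectSum.IsInternal gr) (f : ∀ i, gr i →ₗ[k] P) : M →ₗ[k] P :=
  (DirectSum.toModule k ℤ P f) ∘ₗ
    (LinearEquiv.ofBijective (DirectSum.coeLinearMap gr) (bijective_coe h)).symm.toLinearMap

theorem gradedLift_of_mem (h : DirectSum.IsInternal gr) (f : ∀ i, gr i →ₗ[k] P) {i : ℤ} {m : M}
    (hm : m ∈ gr i) : gradedLift h f m = f i ⟨m, hm⟩ := by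
  have : (LinearEquiv.ofBijective (DirectSum.coeLinearMap gr) (bijective_coe h)).symm m
      = DirectSum.lof k ℤ (fun i => gr i) i ⟨m, hm⟩ := by
    rw [LinearEquiv.symm_apply_eq]
    simp
  simp [gradedLift, this]

theorem graded_induction (h : DirectSum.IsInternal gr) {p : M → Prop}
    (hom : ∀ i, ∀ m ∈ gr i, p m) (add : ∀ m m', p m → p m' → p (m + m')) (m : M) : p m := by
  have hm : m ∈ ⨆ i, gr i := by rw [h.submodule_iSup_eq_top]; trivial
  exact Submodule.iSup_induction gr (motive := p) hm hom (hom 0 0 (zero_mem _)) add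

theorem graded_ext (h : DirectSum.IsInternal gr) {f g : M →ₗ[k] P}
    (H : ∀ i, ∀ m ∈ gr i, f m = g m) : f = g := by
  ext m
  refine graded_induction h (p := fun m => f m = g m) H ?_ m
  intro a b ha hb
  rw [map_add, map_add, ha, hb]

/-- The operator which multiplies an element of degree `i` by `(-1) ^ (j * i)`. -/
noncomputable def tw (h : DirectSum.IsInternal gr) (j : ℤ) : M →ₗ[k] M :=
  gradedLift h fun i => ((-1 : k) ^ (j * i)) • (gr i).subtype

theorem tw_of_mem (h : DirectSum.IsInternal gr) (j : ℤ) {i : ℤ} {m : M} (hm : m ∈ gr i) :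
    tw h j m = (-1 : k) ^ (j * i) • m := by
  simp [tw, gradedLift_of_mem h _ hm]

/-- The projection onto the component of degree `n`. -/
noncomputable def proj (h : DirectSum.IsInternal gr) (n : ℤ) : M →ₗ[k] M :=
  gradedLift h fun i => if i = n then (gr i).subtype else 0

theorem proj_of_mem (h : DirectSum.IsInternal gr) {n : ℤ} {m : M} (hm : m ∈ gr n) :
    proj h n m = m := by
  simp [proj, gradedLift_of_mem h _ hm]

theorem proj_of_mem_ne (h : DirectSum.IsInternal gr) {n i : ℤ} (hi : i ≠ n) {m : M}
    (hm : m ∈ gr i) : proj h n m = 0 := by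
  simp [proj, gradedLift_of_mem h _ hm, hi]

theorem proj_mem (h : DirectSum.IsInternal gr) (n : ℤ) (m : M) : proj h n m ∈ gr n := by
  refine graded_induction h (p := fun m => proj h n m ∈ gr n) ?_ ?_ m
  · intro i m hm
    by_cases hi : i = n
    · subst hi; rwa [proj_of_mem h hm]
    · rw [proj_of_mem_ne h hi hm]; exact zero_mem _
  · intro a b ha hb
    rw [map_add]; exact add_mem ha hb

theorem mem_span_proj (h : DirectSum.IsInternal gr) (m : M) :
    m ∈ Submodule.span k (Set.range fun n => proj h n m) := by
  have key : ∃ s : Finset ℤ, ∀ t : Finset ℤ, s ⊆ t → ∑ n ∈ t, proj h n m = m := by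
    refine graded_induction h
      (p := fun m => ∃ s : Finset ℤ, ∀ t : Finset ℤ, s ⊆ t → ∑ n ∈ t, proj h n m = m) ?_ ?_ m
    · intro i m hm
      refine ⟨{i}, fun t ht => ?_⟩
      rw [Finset.sum_eq_single i, proj_of_mem h hm]
      · intro b _ hb
        exact proj_of_mem_ne h hb.symm hm
      · intro hi; exact absurd (ht (Finset.mem_singleton_self i)) hi
    · rintro a b ⟨s, hs⟩ ⟨s', hs'⟩
      refine ⟨s ∪ s', fun t ht => ?_⟩
      simp only [map_add, Finset.sum_add_distrib]
      rw [hs t (Finset.union_subset_left ht), hs' t (Finset.union_subset_right ht)]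
  obtain ⟨s, hs⟩ := key
  rw [← hs s subset_rfl]
  refine Submodule.sum_mem _ fun n _ => ?_
  rw [hs s subset_rfl]
  exact Submodule.subset_span ⟨n, rfl⟩

theorem isInternal_of_proj (gr : ℤ → Submodule k M) (π : ℤ → M →ₗ[k] M)
    (h1 : ∀ i, ∀ m ∈ gr i, π i m = m) (h0 : ∀ i j, j ≠ i → ∀ m ∈ gr j, π i m = 0)
    (ht : ∀ m, m ∈ ⨆ i, gr i) : DirectSum.IsInternal gr := by
  refine DirectSum.isInternal_submodule_of_iSupIndep_of_iSup_eq_top ?_ ?_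
  · rw [iSupIndep_def]
    intro i
    rw [Submodule.disjoint_def]
    intro x hx hx'
    have hle : (⨆ j, ⨆ (_ : j ≠ i), gr j) ≤ LinearMap.ker (π i) :=
      iSup_le fun j => iSup_le fun hj m hm => h0 i j hj m hm
    have := hle hx'
    rw [LinearMap.mem_ker, h1 i x hx] at this
    exact this
  · exact eq_top_iff.2 fun m _ => ht m

end Graded

/-! Differential graded algebras. -/

/-- A differential graded `k`-algebra (associative, unital, `ℤ`-graded, differential of
degree `+1`). -/
structure DGAlg (k : Type u) [Field k] where
  carrier : Type u
  [ring : Ring carrier]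
  [algebra : Algebra k carrier]
  gr : ℤ → Submodule k carrier
  isInternal : DirectSum.IsInternal gr
  one_mem : (1 : carrier) ∈ gr 0
  mul_mem : ∀ {i j : ℤ} {a b : carrier}, a ∈ gr i → b ∈ gr j → a * b ∈ gr (i + j)
  d : carrier →ₗ[k] carrier
  d_mem : ∀ {i : ℤ} {a : carrier}, a ∈ gr i → d a ∈ gr (i + 1)
  d_d : ∀ a, d (d a) = 0
  d_mul : ∀ {i : ℤ} {a : carrier}, a ∈ gr i → ∀ b, d (a * b) = d a * b + (-1 : k) ^ i • (a * d b)

attribute [instance] DGAlg.ring DGAlg.algebra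

instance {k : Type u} [Field k] : CoeSort (DGAlg k) (Type u) := ⟨DGAlg.carrier⟩

variable {k : Type u} [Field k]

/-- Morphisms of dg algebras. -/
structure DGAlg.Hom (B E : DGAlg k) where
  toAlgHom : B →ₐ[k] E
  map_mem : ∀ {i : ℤ} {b : B}, b ∈ B.gr i → toAlgHom b ∈ E.gr i
  map_d : ∀ b, toAlgHom (B.d b) = E.d (toAlgHom b)

instance (B E : DGAlg k) : CoeFun (DGAlg.Hom B E) (fun _ => B → E) := ⟨fun f => f.toAlgHom⟩

/-- A commutative (in the graded sense) dg `k`-algebra. -/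
structure CDGAlg (k : Type u) [Field k] extends DGAlg k where
  comm : ∀ {i j : ℤ} {a b : carrier}, a ∈ gr i → b ∈ gr j → a * b = (-1 : k) ^ (i * j) • (b * a)

/-- A (typically noncommutative) dg `S`-algebra over a commutative dg algebra `S`:
a dg algebra with a morphism from `S` whose image is central in the graded sense. -/
structure DGAlgebra (S : CDGAlg k) extends DGAlg k where
  unit : DGAlg.Hom S.toDGAlg toDGAlg
  central : ∀ {i j : ℤ} {s : S.toDGAlg} {a : toDGAlg}, s ∈ S.gr i → a ∈ gr j →
    unit s * a = (-1 : k) ^ (i * j) • (a * unit s)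

/-- An augmented commutative dg `S`-algebra. -/
structure AugCDGAlgebra (S : CDGAlg k) extends CDGAlg k where
  unit : DGAlg.Hom S.toDGAlg toDGAlg
  aug : DGAlg.Hom toDGAlg S.toDGAlg
  aug_unit : ∀ s, aug (unit s) = s

/-- The dg `S`-algebra underlying an augmented commutative dg `S`-algebra. -/
def AugCDGAlgebra.toDGAlgebra {S : CDGAlg k} (R : AugCDGAlgebra S) : DGAlgebra S where
  toDGAlg := R.toDGAlg
  unit := R.unit
  central := fun hs ha => R.comm (R.unit.map_mem hs) ha

/-! Differential graded modules. -/

/-- A dg right module over the dg algebra `E`. -/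
structure DGModule (E : DGAlg k) where
  carrier : Type u
  [addCommGroup : AddCommGroup carrier]
  [module : Module k carrier]
  [moduleOp : Module E.carrierᵐᵒᵖ carrier]
  [isScalarTower : IsScalarTower k E.carrierᵐᵒᵖ carrier]
  gr : ℤ → Submodule k carrier
  isInternal : DirectSum.IsInternal gr
  smul_mem : ∀ {i j : ℤ} {m : carrier} {a : E}, m ∈ gr i → a ∈ E.gr j → op a • m ∈ gr (i + j)
  d : carrier →ₗ[k] carrier
  d_mem : ∀ {i : ℤ} {m : carrier}, m ∈ gr i → d m ∈ gr (i + 1)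
  d_d : ∀ m, d (d m) = 0
  d_smul : ∀ {i : ℤ} {m : carrier}, m ∈ gr i → ∀ a : E,
    d (op a • m) = op a • d m + (-1 : k) ^ i • (op (E.d a) • m)

attribute [instance] DGModule.addCommGroup DGModule.module DGModule.moduleOp
  DGModule.isScalarTower

instance (E : DGAlg k) : CoeSort (DGModule E) (Type u) := ⟨DGModule.carrier⟩

namespace DGModule

variable {E : DGAlg k}

instance (M : DGModule E) : SMulCommClass k E.carrierᵐᵒᵖ M :=
  IsScalarTower.to_smulCommClass

instance (M : DGModule E) : SMulCommClass E.carrierᵐᵒᵖ k M :=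
  IsScalarTower.to_smulCommClass'

/-- Morphisms of dg modules: `E`-linear maps, homogeneous of degree `0`, commuting with the
differentials. -/
@[ext]
structure Hom (M N : DGModule E) where
  toLin : M →ₗ[E.carrierᵐᵒᵖ] N
  map_mem : ∀ {i : ℤ} {m : M}, m ∈ M.gr i → toLin m ∈ N.gr i
  map_d : ∀ m, toLin (M.d m) = N.d (toLin m)

instance : Category (DGModule E) where
  Hom M N := Hom M N
  id M := ⟨LinearMap.id, fun h => h, fun _ => rfl⟩
  comp f g := ⟨g.toLin ∘ₗ f.toLin, fun h => g.map_mem (f.map_mem h),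
    fun m => by simp [f.map_d, g.map_d]⟩

@[ext]
theorem hom_ext {M N : DGModule E} {f g : M ⟶ N} (h : ∀ m : M, f.toLin m = g.toLin m) : f = g :=
  Hom.ext (LinearMap.ext h)

@[simp] theorem id_toLin (M : DGModule E) : Hom.toLin (𝟙 M) = LinearMap.id := rfl

@[simp] theorem comp_toLin {M N P : DGModule E} (f : M ⟶ N) (g : N ⟶ P) :
    (f ≫ g).toLin = g.toLin ∘ₗ f.toLin := rfl

/-- Two morphisms of dg modules are homotopic if their difference is `d h + h d` for an
`E`-linear map `h`, homogeneous of degree `-1`. -/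
def Homotopic {M N : DGModule E} (f g : M ⟶ N) : Prop :=
  ∃ h : M →ₗ[E.carrierᵐᵒᵖ] N, (∀ (i : ℤ) (m : M), m ∈ M.gr i → h m ∈ N.gr (i - 1)) ∧
    ∀ m, f.toLin m - g.toLin m = N.d (h m) + h (M.d m)

/-- Homotopy equivalences of dg modules. -/
def IsHomotopyEquiv {M N : DGModule E} (f : M ⟶ N) : Prop :=
  ∃ g : N ⟶ M, Homotopic (f ≫ g) (𝟙 M) ∧ Homotopic (g ≫ f) (𝟙 N)

/-- A dg module is free as a graded module if it has a basis of homogeneous elements. -/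
def IsGradedFree (M : DGModule E) : Prop :=
  ∃ (ι : Type u) (b : Module.Basis ι E.carrierᵐᵒᵖ M), ∀ i, ∃ p : ℤ, b i ∈ M.gr p

/-- The right regular dg module. -/
def regular (E : DGAlg k) : DGModule E where
  carrier := E.carrier
  gr := E.gr
  isInternal := E.isInternal
  smul_mem := fun hm ha => E.mul_mem hm ha
  d := E.d
  d_mem := E.d_mem
  d_d := E.d_d
  d_smul := fun hm a => E.d_mul hm a

/-- Restriction of dg modules along a morphism of dg algebras. -/
def res {B : DGAlg k} (φ : DGAlg.Hom B E) : DGModule E ⥤ DGModule B where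
  obj M :=
    letI : Module B.carrierᵐᵒᵖ M.carrier :=
      Module.compHom M.carrier (φ.toAlgHom.toRingHom.op : B.carrierᵐᵒᵖ →+* E.carrierᵐᵒᵖ)
    { carrier := M.carrier
      isScalarTower := ⟨fun c b m => by
        induction b using MulOpposite.rec' with | _ b => ?_
        change op (φ.toAlgHom (c • b)) • m = c • (op (φ.toAlgHom b) • m)
        rw [map_smul, MulOpposite.op_smul, smul_assoc]⟩
      gr := M.gr
      isInternal := M.isInternal
      smul_mem := fun hm ha => M.smul_mem hm (φ.map_mem ha)
      d := M.d
      d_mem := M.d_mem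
      d_d := M.d_d
      d_smul := fun {i m} hm a => by
        change M.d (op (φ.toAlgHom a) • m) = op (φ.toAlgHom a) • M.d m
          + (-1 : k) ^ i • (op (φ.toAlgHom (B.d a)) • m)
        rw [φ.map_d, M.d_smul hm] }
  map {M N} f :=
    { toLin :=
        { toFun := fun m => f.toLin m
          map_add' := f.toLin.map_add
          map_smul' := fun b m => f.toLin.map_smul
            ((φ.toAlgHom.toRingHom.op : B.carrierᵐᵒᵖ →+* E.carrierᵐᵒᵖ) b) m }
      map_mem := f.map_mem
      map_d := f.map_d }
  map_id _ := rfl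
  map_comp _ _ := rfl

/-- The shift `M[1]`, with components `M[1]^p = M^{p+1}` and differential `-d`. -/
def shift : DGModule E ⥤ DGModule E where
  obj M :=
    { carrier := M.carrier
      gr := fun p => M.gr (p + 1)
      isInternal := by
        refine isInternal_of_proj _ (fun n => proj M.isInternal (n + 1)) ?_ ?_ ?_
        · intro i m hm; exact proj_of_mem M.isInternal hm
        · intro i j hj m hm
          exact proj_of_mem_ne M.isInternal (by omega) hm
        · intro m
          refine graded_induction M.isInternal (p := fun m => m ∈ ⨆ i, M.gr (i + 1)) ?_ ?_ m
          · intro i m hm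
            refine Submodule.mem_iSup_of_mem (i - 1) ?_
            rwa [sub_add_cancel]
          · intro a b ha hb; exact add_mem ha hb
      smul_mem := fun {i j m a} hm ha => by
        have := M.smul_mem hm ha
        rwa [show i + j + 1 = i + 1 + j by ring]
      d := -M.d
      d_mem := fun hm => by
        rw [LinearMap.neg_apply]; exact neg_mem (M.d_mem hm)
      d_d := fun m => by simp [M.d_d]
      d_smul := fun {i m} hm a => by
        rw [LinearMap.neg_apply, M.d_smul hm a, LinearMap.neg_apply,
          zpow_add₀ (neg_ne_zero.2 one_ne_zero)]
        simp only [zpow_one, mul_neg, mul_one, neg_smul, smul_neg]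
        abel }
  map f := ⟨f.toLin, fun hm => f.map_mem hm, fun m => by
    simp [f.map_d]⟩
  map_id _ := rfl
  map_comp _ _ := rfl

/-- The mapping cone of `f : X ⟶ Y`: the graded module with components `X^{p+1} ⊕ Y^p` and the
differential `(x, y) ↦ (-d x, f x + d y)`. -/
def cone {X Y : DGModule E} (f : X ⟶ Y) : DGModule E where
  carrier := X.carrier × Y.carrier
  isScalarTower := ⟨fun a b m => by ext <;> simp⟩
  gr := fun p => (X.gr (p + 1)).prod (Y.gr p)
  isInternal := by
    refine isInternal_of_proj _
      (fun n => (proj X.isInternal (n + 1)).prodMap (proj Y.isInternal n)) ?_ ?_ ?_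
    · rintro i ⟨x, y⟩ ⟨hx, hy⟩
      simp only [LinearMap.prodMap_apply]
      rw [proj_of_mem X.isInternal hx, proj_of_mem Y.isInternal hy]
    · rintro i j hj ⟨x, y⟩ ⟨hx, hy⟩
      simp only [LinearMap.prodMap_apply]
      rw [proj_of_mem_ne X.isInternal (by omega) hx, proj_of_mem_ne Y.isInternal hj hy]
      rfl
    · rintro ⟨x, y⟩
      have hx : ((x, 0) : X.carrier × Y.carrier) ∈ ⨆ p, (X.gr (p + 1)).prod (Y.gr p) := by
        refine graded_induction X.isInternal
          (p := fun x => ((x, 0) : X.carrier × Y.carrier) ∈ ⨆ p, (X.gr (p + 1)).prod (Y.gr p))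
          ?_ ?_ x
        · intro i x hx
          refine Submodule.mem_iSup_of_mem (i - 1) ⟨?_, zero_mem _⟩
          simpa using hx
        · intro a b ha hb
          have := add_mem ha hb
          simpa using this
      have hy : ((0, y) : X.carrier × Y.carrier) ∈ ⨆ p, (X.gr (p + 1)).prod (Y.gr p) := by
        refine graded_induction Y.isInternal
          (p := fun y => ((0, y) : X.carrier × Y.carrier) ∈ ⨆ p, (X.gr (p + 1)).prod (Y.gr p))
          ?_ ?_ y
        · intro i y hy
          exact Submodule.mem_iSup_of_mem i ⟨zero_mem _, hy⟩
        · intro a b ha hb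
          have := add_mem ha hb
          simpa using this
      have := add_mem hx hy
      simpa using this
  smul_mem := by
    rintro i j ⟨x, y⟩ a ⟨hx, hy⟩ ha
    refine ⟨?_, Y.smul_mem hy ha⟩
    have := X.smul_mem hx ha
    rw [show i + j + 1 = i + 1 + j by ring]
    exact this
  d := LinearMap.prod (-(X.d ∘ₗ LinearMap.fst k X.carrier Y.carrier))
    ((f.toLin.restrictScalars k) ∘ₗ LinearMap.fst k X.carrier Y.carrier
      + Y.d ∘ₗ LinearMap.snd k X.carrier Y.carrier)
  d_mem := by
    rintro i ⟨x, y⟩ ⟨hx, hy⟩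
    refine ⟨?_, ?_⟩
    · simpa using X.d_mem hx
    · exact add_mem (f.map_mem hx) (Y.d_mem hy)
  d_d := by
    rintro ⟨x, y⟩
    ext
    · simp [X.d_d]
    · simp [Y.d_d, f.map_d]
  d_smul := by
    rintro i ⟨x, y⟩ ⟨hx, hy⟩ a
    have h1 := X.d_smul hx a
    have h2 := Y.d_smul hy a
    rw [zpow_add₀ (neg_ne_zero.2 one_ne_zero)] at h1
    ext
    · simp [h1]
      abel
    · simp [h2, smul_add]
      abel

end DGModule

/-! Tensor products over a commutative dg algebra. -/

section Tensor

variable {S : CDGAlg k} (E : DGAlgebra S) (M : DGModule E.toDGAlg) (N : DGModule S.toDGAlg)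

/-- The relations `m s ⊗ n = m ⊗ s n`, where `s n = (-1)^{|s||n|} n s`. -/
def tensorRel : Submodule k (M ⊗[k] N) :=
  Submodule.span k {x | ∃ (i j : ℤ) (s : S.toDGAlg) (n : N) (m : M), s ∈ S.gr i ∧ n ∈ N.gr j ∧
    x = (op (E.unit s) • m) ⊗ₜ[k] n - (-1 : k) ^ (i * j) • (m ⊗ₜ[k] (op s • n))}

/-- The vector space underlying `M ⊗_S N`. -/
abbrev TensorCarrier : Type u := (M ⊗[k] N) ⧸ tensorRel E M N

/-- The class of `m ⊗ n` in `M ⊗_S N`. -/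
def tmk : M →ₗ[k] N →ₗ[k] TensorCarrier E M N :=
  (TensorProduct.mk k M N).compr₂ (tensorRel E M N).mkQ

theorem tmk_balanced {i j : ℤ} {s : S.toDGAlg} {n : N} (hs : s ∈ S.gr i) (hn : n ∈ N.gr j)
    (m : M) : tmk E M N (op (E.unit s) • m) n = (-1 : k) ^ (i * j) • tmk E M N m (op s • n) := by
  rw [← sub_eq_zero, ← map_smul]
  change (tensorRel E M N).mkQ _ - (tensorRel E M N).mkQ _ = 0
  rw [← map_sub]
  refine (Submodule.Quotient.mk_eq_zero _).2 (Submodule.subset_span ⟨i, j, s, n, m, hs, hn, ?_⟩)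
  simp

variable {E M N} in
/-- Balanced bilinear maps factor through `M ⊗_S N`. -/
def tlift {P : Type u} [AddCommGroup P] [Module k P] (f : M →ₗ[k] N →ₗ[k] P)
    (hf : ∀ (i j l : ℤ) (s : S.toDGAlg) (n : N) (m : M), s ∈ S.gr i → n ∈ N.gr j → m ∈ M.gr l →
      f (op (E.unit s) • m) n = (-1 : k) ^ (i * j) • f m (op s • n)) :
    TensorCarrier E M N →ₗ[k] P :=
  (tensorRel E M N).liftQ (TensorProduct.lift f) <| by
    refine Submodule.span_le.2 ?_
    rintro x ⟨i, j, s, n, m, hs, hn, rfl⟩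
    simp only [SetLike.mem_coe, LinearMap.mem_ker, map_sub, map_smul, TensorProduct.lift.tmul]
    rw [sub_eq_zero]
    refine graded_induction M.isInternal
      (p := fun m => f (op (E.unit s) • m) n = (-1 : k) ^ (i * j) • f m (op s • n)) ?_ ?_ m
    · intro l m hm; exact hf i j l s n m hs hn hm
    · intro a b ha hb
      rw [smul_add, map_add, LinearMap.add_apply, ha, hb, map_add, LinearMap.add_apply, smul_add]

variable {E M N} in
@[simp]
theorem tlift_tmk {P : Type u} [AddCommGroup P] [Module k P] (f : M →ₗ[k] N →ₗ[k] P) (hf) (m : M)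
    (n : N) : tlift (E := E) f hf (tmk E M N m n) = f m n := rfl

variable {E M N} in
theorem tensor_induction {p : TensorCarrier E M N → Prop}
    (hom : ∀ (i j : ℤ) (m : M) (n : N), m ∈ M.gr i → n ∈ N.gr j → p (tmk E M N m n))
    (add : ∀ x y, p x → p y → p (x + y)) (x : TensorCarrier E M N) : p x := by
  obtain ⟨x, rfl⟩ := Submodule.mkQ_surjective _ x
  induction x with
  | zero => simpa using hom 0 0 0 0 (zero_mem _) (zero_mem _)
  | add x y hx hy => rw [map_add]; exact add _ _ hx hy
  | tmul m n =>
    change p (tmk E M N m n)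
    refine graded_induction M.isInternal (p := fun m => p (tmk E M N m n)) ?_ ?_ m
    · intro i m hm
      refine graded_induction N.isInternal (p := fun n => p (tmk E M N m n)) ?_ ?_ n
      · intro j n hn; exact hom i j m n hm hn
      · intro a b ha hb; rw [map_add]; exact add _ _ ha hb
    · intro a b ha hb; rw [map_add, LinearMap.add_apply]; exact add _ _ ha hb

variable {E M N} in
theorem tensor_ext {P : Type u} [AddCommGroup P] [Module k P] {f g : TensorCarrier E M N →ₗ[k] P}
    (H : ∀ (i j : ℤ) (m : M) (n : N), m ∈ M.gr i → n ∈ N.gr j →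
      f (tmk E M N m n) = g (tmk E M N m n)) : f = g := by
  ext1
  ext m n
  change f (tmk E M N m n) = g (tmk E M N m n)
  exact tensor_induction (p := fun x => f x = g x) H
    (fun x y hx hy => by rw [map_add, map_add, hx, hy]) _

/-- The component of degree `n` of `M ⊗_S N` is spanned by the `x ⊗ y` with `|x| + |y| = n`. -/
def tensorGr (n : ℤ) : Submodule k (TensorCarrier E M N) :=
  Submodule.span k {x | ∃ (i j : ℤ) (m : M) (y : N), i + j = n ∧ m ∈ M.gr i ∧ y ∈ N.gr j ∧
    x = tmk E M N m y}

variable {E M N} in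
theorem tmk_mem {i j : ℤ} {m : M} {n : N} (hm : m ∈ M.gr i) (hn : n ∈ N.gr j) :
    tmk E M N m n ∈ tensorGr E M N (i + j) :=
  Submodule.subset_span ⟨i, j, m, n, rfl, hm, hn, rfl⟩

variable {E M N} in
theorem tensorGr_map {P : Type u} [AddCommGroup P] [Module k P]
    {f : TensorCarrier E M N →ₗ[k] P} {n : ℤ} {Q : Submodule k P}
    (H : ∀ (i j : ℤ) (m : M) (y : N), i + j = n → m ∈ M.gr i → y ∈ N.gr j →
      f (tmk E M N m y) ∈ Q) {x : TensorCarrier E M N} (hx : x ∈ tensorGr E M N n) : f x ∈ Q := by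
  have : tensorGr E M N n ≤ Q.comap f := by
    refine Submodule.span_le.2 ?_
    rintro _ ⟨i, j, m, y, h, hm, hy, rfl⟩
    exact H i j m y h hm hy
  exact this hx

/-- The projection of `M ⊗_S N` onto its component of degree `n`. -/
noncomputable def tensorProj (n : ℤ) : TensorCarrier E M N →ₗ[k] TensorCarrier E M N :=
  tlift (gradedLift M.isInternal fun i =>
      ((LinearMap.lcomp k (TensorCarrier E M N) (proj N.isInternal (n - i))) ∘ₗ (tmk E M N)) ∘ₗ
        (M.gr i).subtype) <| by
    intro i j l s y m hs hy hm
    have hm' := M.smul_mem hm (E.unit.map_mem hs)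
    rw [gradedLift_of_mem _ _ hm, gradedLift_of_mem _ _ hm']
    simp only [LinearMap.comp_apply, Submodule.subtype_apply, LinearMap.lcomp_apply]
    by_cases h : j = n - (l + i)
    · rw [proj_of_mem _ (by rwa [← h]), proj_of_mem N.isInternal (n := n - l),
        tmk_balanced E M N hs hy]
      rw [show n - l = j + i by omega]
      exact N.smul_mem hy hs
    · rw [proj_of_mem_ne _ h hy, proj_of_mem_ne N.isInternal (i := j + i) (by omega)
        (N.smul_mem hy hs)]
      simp

theorem tensorProj_tmk (n : ℤ) {i j : ℤ} {m : M} {y : N} (hm : m ∈ M.gr i) (hy : y ∈ N.gr j) :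
    tensorProj E M N n (tmk E M N m y) = if i + j = n then tmk E M N m y else 0 := by
  rw [tensorProj, tlift_tmk, gradedLift_of_mem _ _ hm]
  simp only [LinearMap.comp_apply, Submodule.subtype_apply, LinearMap.lcomp_apply]
  split_ifs with h
  · rw [proj_of_mem]
    rwa [show n - i = j by omega]
  · rw [proj_of_mem_ne _ (by omega) hy, map_zero]

theorem tensor_isInternal : DirectSum.IsInternal (tensorGr E M N) := by
  refine isInternal_of_proj _ (tensorProj E M N) ?_ ?_ ?_
  · intro n x hx
    have : tensorGr E M N n ≤ LinearMap.ker (tensorProj E M N n - LinearMap.id) := by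
      refine Submodule.span_le.2 ?_
      rintro _ ⟨i, j, m, y, h, hm, hy, rfl⟩
      simp [tensorProj_tmk E M N n hm hy, h]
    have := this hx
    rw [LinearMap.mem_ker, LinearMap.sub_apply, sub_eq_zero] at this
    exact this
  · intro n l hl x hx
    have : tensorGr E M N l ≤ LinearMap.ker (tensorProj E M N n) := by
      refine Submodule.span_le.2 ?_
      rintro _ ⟨i, j, m, y, h, hm, hy, rfl⟩
      simp [tensorProj_tmk E M N n hm hy, h, hl]
    exact this hx
  · intro x
    refine tensor_induction (p := fun x => x ∈ ⨆ i, tensorGr E M N i) ?_ ?_ x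
    · intro i j m n hm hn
      exact Submodule.mem_iSup_of_mem _ (tmk_mem hm hn)
    · intro a b ha hb; exact add_mem ha hb

/-- The action map `e ↦ (m ↦ m e)` of a dg module. -/
def DGModule.act {F : DGAlg k} (M : DGModule F) : F →ₗ[k] M →ₗ[k] M :=
  LinearMap.mk₂ k (fun e m => op e • m)
    (fun a b m => by rw [MulOpposite.op_add, add_smul])
    (fun c a m => by rw [MulOpposite.op_smul, smul_assoc])
    (fun a m m' => smul_add _ _ _)
    (fun c a m => smul_comm _ _ _)

@[simp]
theorem DGModule.act_apply {F : DGAlg k} (M : DGModule F) (e : F) (m : M) :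
    M.act e m = op e • m := rfl

/-- The map `m, n, e ↦ (-1)^{|n||e|} m e ⊗ n`, linear in `e`. -/
noncomputable def tensorActAux : E.toDGAlg →ₗ[k] M →ₗ[k] N →ₗ[k] TensorCarrier E M N :=
  gradedLift E.isInternal fun i =>
    { toFun := fun e => (tmk E M N).compl₁₂ (M.act e.1) (tw N.isInternal i)
      map_add' := fun a b => by
        refine LinearMap.ext₂ fun m n => ?_
        simp
      map_smul' := fun c a => by
        refine LinearMap.ext₂ fun m n => ?_
        simp }

theorem tensorActAux_apply {i j : ℤ} {e : E.toDGAlg} (he : e ∈ E.gr i) {n : N} (hn : n ∈ N.gr j)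
    (m : M) : tensorActAux E M N e m n = (-1 : k) ^ (i * j) • tmk E M N (op e • m) n := by
  rw [tensorActAux, gradedLift_of_mem _ _ he]
  simp [tw_of_mem N.isInternal i hn]

/-- The right action of `E` on `M ⊗_S N`, namely `(m ⊗ n) e = (-1)^{|n||e|} m e ⊗ n`. -/
noncomputable def tensorAct : TensorCarrier E M N →ₗ[k] E.toDGAlg →ₗ[k] TensorCarrier E M N :=
  tlift (LinearMap.mk₂ k (fun m n => ((tensorActAux E M N).flip m).flip n)
      (fun m m' n => by ext e; simp) (fun c m n => by ext e; simp)
      (fun m n n' => by ext e; simp) (fun c m n => by ext e; simp)) <| by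
    intro i j l s n m hs hn hm
    refine graded_ext E.isInternal fun q e he => ?_
    simp only [LinearMap.mk₂_apply, LinearMap.flip_apply, LinearMap.smul_apply]
    rw [tensorActAux_apply E M N he hn, tensorActAux_apply E M N he (N.smul_mem hn hs),
      smul_smul, smul_smul, ← op_mul, E.central hs he, MulOpposite.op_smul, smul_assoc, op_mul, mul_smul,
      map_smul, LinearMap.smul_apply, tmk_balanced E M N hs hn, smul_smul, smul_smul]
    congr 1
    simp only [sign_mul]
    apply sign_congr
    simp only [Int.even_add, Int.even_mul]
    tauto

theorem tensorAct_tmk {i j : ℤ} {e : E.toDGAlg} (he : e ∈ E.gr i) {n : N} (hn : n ∈ N.gr j)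
    (m : M) : tensorAct E M N (tmk E M N m n) e = (-1 : k) ^ (i * j) • tmk E M N (op e • m) n := by
  rw [tensorAct, tlift_tmk]
  exact tensorActAux_apply E M N he hn m

/-- The differential `m ⊗ n ↦ d m ⊗ n + (-1)^{|m|} m ⊗ d n` of `M ⊗_S N`. -/
noncomputable def tensorD : TensorCarrier E M N →ₗ[k] TensorCarrier E M N :=
  tlift ((tmk E M N) ∘ₗ M.d + (tmk E M N).compl₁₂ (tw M.isInternal 1) N.d) <| by
    intro i j l s n m hs hn hm
    simp only [LinearMap.add_apply, LinearMap.comp_apply, LinearMap.compl₁₂_apply]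
    rw [M.d_smul hm, N.d_smul hn, tw_of_mem M.isInternal 1 hm,
      tw_of_mem M.isInternal 1 (M.smul_mem hm (E.unit.map_mem hs)), ← E.unit.map_d]
    simp only [map_add, map_smul, LinearMap.add_apply, LinearMap.smul_apply, smul_add, smul_smul]
    rw [tmk_balanced E M N hs hn, tmk_balanced E M N hs (N.d_mem hn),
      tmk_balanced E M N (S.d_mem hs) hn, smul_smul, smul_smul]
    rw [add_assoc, add_comm (((-1 : k) ^ l * _) • _)]
    simp only [sign_mul]
    congr 2
    · congr 1
      apply sign_congr
      simp only [Int.even_add, Int.even_mul, Int.not_even_one]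
      tauto
    · congr 1
      apply sign_congr
      simp only [Int.even_add, Int.even_mul, Int.not_even_one]
      tauto

theorem tensorD_tmk {i : ℤ} {m : M} (hm : m ∈ M.gr i) (n : N) :
    tensorD E M N (tmk E M N m n) = tmk E M N (M.d m) n + (-1 : k) ^ i • tmk E M N m (N.d n) := by
  rw [tensorD, tlift_tmk]
  simp [tw_of_mem M.isInternal 1 hm]

theorem tensorD_mem {i : ℤ} {x : TensorCarrier E M N} (hx : x ∈ tensorGr E M N i) :
    tensorD E M N x ∈ tensorGr E M N (i + 1) := by
  refine tensorGr_map ?_ hx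
  rintro p q m n rfl hm hn
  rw [tensorD_tmk E M N hm]
  refine add_mem ?_ (Submodule.smul_mem _ _ ?_)
  · rw [show p + q + 1 = p + 1 + q by ring]
    exact tmk_mem (M.d_mem hm) hn
  · rw [add_assoc]
    exact tmk_mem hm (N.d_mem hn)

theorem tensorD_tensorD (x : TensorCarrier E M N) : tensorD E M N (tensorD E M N x) = 0 := by
  refine tensor_induction (p := fun x => tensorD E M N (tensorD E M N x) = 0) ?_ ?_ x
  · intro i j m n hm hn
    rw [tensorD_tmk E M N hm, map_add, map_smul, tensorD_tmk E M N hm,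
      tensorD_tmk E M N (M.d_mem hm), M.d_d, N.d_d, zpow_add₀ (neg_ne_zero.2 one_ne_zero)]
    simp
  · intro x y hx hy
    rw [map_add, map_add, hx, hy, add_zero]

/-- The dg `E`-module `M ⊗_S N`, for a dg `S`-algebra `E`, a dg `E`-module `M` and a dg `S`-module
`N`. -/
noncomputable def tensorObj : DGModule E.toDGAlg :=
  letI : Module E.toDGAlg.carrierᵐᵒᵖ (TensorCarrier E M N) :=
    { smul := fun e x => tensorAct E M N x e.unop
      one_smul := fun x => by
        change tensorAct E M N x 1 = x
        refine tensor_induction (p := fun x => tensorAct E M N x 1 = x) ?_ ?_ x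
        · intro i j m n hm hn
          rw [tensorAct_tmk E M N E.one_mem hn]
          simp
        · intro x y hx hy
          rw [map_add, LinearMap.add_apply, hx, hy]
      mul_smul := fun a b x => by
        induction a using MulOpposite.rec' with | _ a => ?_
        induction b using MulOpposite.rec' with | _ b => ?_
        change tensorAct E M N x (b * a) = tensorAct E M N (tensorAct E M N x b) a
        refine graded_induction E.isInternal (p := fun a =>
          tensorAct E M N x (b * a) = tensorAct E M N (tensorAct E M N x b) a) ?_ ?_ a
        · intro i a ha
          refine graded_induction E.isInternal (p := fun b =>
            tensorAct E M N x (b * a) = tensorAct E M N (tensorAct E M N x b) a) ?_ ?_ b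
          · intro j b hb
            refine tensor_induction (p := fun x =>
              tensorAct E M N x (b * a) = tensorAct E M N (tensorAct E M N x b) a) ?_ ?_ x
            · intro p q m n hm hn
              rw [tensorAct_tmk E M N hb hn, tensorAct_tmk E M N (E.mul_mem hb ha) hn, op_mul,
                LinearMap.map_smul (tensorAct E M N), LinearMap.smul_apply,
                tensorAct_tmk E M N ha hn, smul_smul, smul_smul, sign_mul]
              congr 2
              ring
            · intro x y hx hy
              simp only [map_add, LinearMap.add_apply, hx, hy]
          · intro b b' hb hb'
            simp only [add_mul, map_add, LinearMap.add_apply, hb, hb']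
        · intro a a' h h'
          simp only [mul_add, map_add, h, h']
      smul_zero := fun e => by
        change tensorAct E M N 0 e.unop = 0
        simp
      smul_add := fun e x y => by
        change tensorAct E M N (x + y) e.unop = tensorAct E M N x e.unop + tensorAct E M N y e.unop
        simp
      add_smul := fun e f x => by
        change tensorAct E M N x (e.unop + f.unop) = _
        rw [map_add]
        rfl
      zero_smul := fun x => by
        change tensorAct E M N x 0 = 0
        simp }
  { carrier := TensorCarrier E M N
    isScalarTower := ⟨fun c e x => by
      change tensorAct E M N x (c • e.unop) = c • tensorAct E M N x e.unop
      rw [map_smul]⟩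
    gr := tensorGr E M N
    isInternal := tensor_isInternal E M N
    smul_mem := fun {i j x a} hx ha => by
      change (tensorAct E M N).flip a x ∈ _
      refine tensorGr_map ?_ hx
      rintro p q m n rfl hm hn
      rw [LinearMap.flip_apply, tensorAct_tmk E M N ha hn]
      refine Submodule.smul_mem _ _ ?_
      rw [show p + q + j = p + j + q by ring]
      exact tmk_mem (M.smul_mem hm ha) hn
    d := tensorD E M N
    d_mem := fun hx => tensorD_mem E M N hx
    d_d := tensorD_tensorD E M N
    d_smul := fun {i x} hx a => by
      change tensorD E M N (tensorAct E M N x a) = tensorAct E M N (tensorD E M N x) a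
        + (-1 : k) ^ i • tensorAct E M N x (E.d a)
      refine graded_induction E.isInternal (p := fun a =>
        tensorD E M N (tensorAct E M N x a) = tensorAct E M N (tensorD E M N x) a
        + (-1 : k) ^ i • tensorAct E M N x (E.d a)) ?_ ?_ a
      · intro j a ha
        have key := tensorGr_map (E := E) (M := M) (N := N) (n := i) (Q := (⊥ : Submodule k _))
          (f := tensorD E M N ∘ₗ (tensorAct E M N).flip a
            - (tensorAct E M N).flip a ∘ₗ tensorD E M N
            - (-1 : k) ^ i • (tensorAct E M N).flip (E.d a)) ?_ hx
        · rw [Submodule.mem_bot] at key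
          simp only [LinearMap.sub_apply, LinearMap.comp_apply, LinearMap.flip_apply,
            LinearMap.smul_apply] at key
          rw [sub_sub, sub_eq_zero] at key
          exact key
        · rintro p q m n rfl hm hn
          rw [Submodule.mem_bot]
          simp only [LinearMap.sub_apply, LinearMap.comp_apply, LinearMap.flip_apply,
            LinearMap.smul_apply]
          rw [sub_sub, sub_eq_zero, tensorD_tmk E M N hm, tensorAct_tmk E M N ha hn, map_smul,
            tensorD_tmk E M N (M.smul_mem hm ha), M.d_smul hm,
            tensorAct_tmk E M N (E.d_mem ha) hn]
          simp only [map_add, map_smul, LinearMap.add_apply, LinearMap.smul_apply]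
          rw [tensorAct_tmk E M N ha hn, tensorAct_tmk E M N ha (N.d_mem hn)]
          simp only [smul_add, smul_smul, sign_mul]
          rw [add_assoc, add_assoc, add_comm ((-1 : k) ^ (j * q + p) • _)]
          congr 1
          congr 1
          · congr 1
            apply sign_congr
            simp only [Int.even_add, Int.even_mul, Int.not_even_one]
            tauto
          · congr 1
            apply sign_congr
            simp only [Int.even_add, Int.even_mul, Int.not_even_one]
            tauto
      · intro a b ha hb
        simp only [map_add, ha, hb, smul_add]
        abel }

theorem tensorObj_smul (e : E.toDGAlg) (x : TensorCarrier E M N) :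
    (op e • (show (tensorObj E M N).carrier from x)) = tensorAct E M N x e := rfl

end Tensor

/-! Functoriality of the tensor product and the relative derived category. -/

section TensorMap

variable {S : CDGAlg k} (E : DGAlgebra S) {M M' : DGModule E.toDGAlg} (N : DGModule S.toDGAlg)

/-- The map `h ⊗ N` for an `S`-linear map `h`. -/
def tensorMapAux (h : M →ₗ[k] M') (hS : ∀ (s : S.toDGAlg) (m : M),
    h (op (E.unit s) • m) = op (E.unit s) • h m) :
    TensorCarrier E M N →ₗ[k] TensorCarrier E M' N :=
  tlift ((tmk E M' N) ∘ₗ h) <| by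
    intro i j l s n m hs hn hm
    simp only [LinearMap.comp_apply]
    rw [hS, tmk_balanced E M' N hs hn]

@[simp]
theorem tensorMapAux_tmk (h : M →ₗ[k] M') (hS) (m : M) (n : N) :
    tensorMapAux E N h hS (tmk E M N m n) = tmk E M' N (h m) n := rfl

/-- `h ⊗ N` commutes with the action of every element of `E` which commutes with `h`. -/
theorem tensorMapAux_act (h : M →ₗ[k] M') (hS) {i : ℤ} {e : E.toDGAlg} (he : e ∈ E.gr i)
    (hh : ∀ m : M, h (op e • m) = op e • h m) (x : TensorCarrier E M N) :
    tensorMapAux E N h hS (tensorAct E M N x e) = tensorAct E M' N (tensorMapAux E N h hS x) e := by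
  refine tensor_induction (p := fun x => tensorMapAux E N h hS (tensorAct E M N x e)
    = tensorAct E M' N (tensorMapAux E N h hS x) e) ?_ ?_ x
  · intro p q m n hm hn
    rw [tensorAct_tmk E M N he hn, map_smul, tensorMapAux_tmk, tensorMapAux_tmk,
      tensorAct_tmk E M' N he hn, hh]
  · intro x y hx hy
    simp only [map_add, LinearMap.add_apply, hx, hy]

theorem tensorMapAux_mem (h : M →ₗ[k] M') (hS) {c : ℤ}
    (hc : ∀ (i : ℤ) (m : M), m ∈ M.gr i → h m ∈ M'.gr (i + c)) {i : ℤ} {x : TensorCarrier E M N}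
    (hx : x ∈ tensorGr E M N i) : tensorMapAux E N h hS x ∈ tensorGr E M' N (i + c) := by
  refine tensorGr_map ?_ hx
  rintro p q m n rfl hm hn
  rw [tensorMapAux_tmk, show p + q + c = p + c + q by ring]
  exact tmk_mem (hc p m hm) hn

/-- The `k`-linear map underlying a morphism of dg modules. -/
def DGModule.Hom.klin {F : DGAlg k} {M M' : DGModule F} (f : M ⟶ M') : M →ₗ[k] M' :=
  f.toLin.restrictScalars k

theorem DGModule.Hom.klin_smul {F : DGAlg k} {M M' : DGModule F} (f : M ⟶ M') (e : F) (m : M) :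
    DGModule.Hom.klin f (op e • m) = op e • DGModule.Hom.klin f m :=
  f.toLin.map_smul _ _

theorem DGModule.Hom.klin_d {F : DGAlg k} {M M' : DGModule F} (f : M ⟶ M') (m : M) :
    DGModule.Hom.klin f (M.d m) = M'.d (DGModule.Hom.klin f m) :=
  f.map_d m

/-- The `k`-linear map underlying `f ⊗ N`. -/
def tensorHomAux (f : M ⟶ M') : TensorCarrier E M N →ₗ[k] TensorCarrier E M' N :=
  tensorMapAux E N (DGModule.Hom.klin f) (fun _ _ => DGModule.Hom.klin_smul f _ _)

@[simp]
theorem tensorHomAux_tmk (f : M ⟶ M') (m : M) (n : N) :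
    tensorHomAux E N f (tmk E M N m n) = tmk E M' N (DGModule.Hom.klin f m) n := rfl

theorem tensorHomAux_act (f : M ⟶ M') (e : E.toDGAlg) (x : TensorCarrier E M N) :
    tensorHomAux E N f (tensorAct E M N x e) = tensorAct E M' N (tensorHomAux E N f x) e := by
  refine graded_induction E.isInternal (p := fun e => tensorHomAux E N f (tensorAct E M N x e)
    = tensorAct E M' N (tensorHomAux E N f x) e) ?_ ?_ e
  · intro i e he
    exact tensorMapAux_act E N _ _ he (fun m => DGModule.Hom.klin_smul f _ _) x
  · intro a b ha hb
    simp only [map_add, ha, hb]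

theorem tensorHomAux_d (f : M ⟶ M') (x : TensorCarrier E M N) :
    tensorHomAux E N f (tensorD E M N x) = tensorD E M' N (tensorHomAux E N f x) := by
  refine tensor_induction (p := fun x => tensorHomAux E N f (tensorD E M N x)
    = tensorD E M' N (tensorHomAux E N f x)) ?_ ?_ x
  · intro i j m n hm hn
    rw [tensorHomAux_tmk, tensorD_tmk E M N hm, map_add, map_smul, tensorHomAux_tmk,
      tensorHomAux_tmk, tensorD_tmk E M' N (m := DGModule.Hom.klin f m) (f.map_mem hm),
      DGModule.Hom.klin_d]
  · intro x y hx hy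
    simp only [map_add, hx, hy]

theorem tensorHomAux_mem (f : M ⟶ M') {i : ℤ} {x : TensorCarrier E M N}
    (hx : x ∈ tensorGr E M N i) : tensorHomAux E N f x ∈ tensorGr E M' N i := by
  have := tensorMapAux_mem E N (DGModule.Hom.klin f)
    (fun _ _ => DGModule.Hom.klin_smul f _ _) (c := 0) (fun i m hm => by
      rw [add_zero]; exact f.map_mem hm) hx
  rwa [add_zero] at this

/-- The morphism `f ⊗ N` of dg `E`-modules. -/
noncomputable def tensorHom (f : M ⟶ M') : tensorObj E M N ⟶ tensorObj E M' N where
  toLin :=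
    { toFun := tensorHomAux E N f
      map_add' := fun x y => LinearMap.map_add (tensorHomAux E N f) x y
      map_smul' := fun e x => tensorHomAux_act E N f e.unop x }
  map_mem := fun hx => tensorHomAux_mem E N f hx
  map_d := tensorHomAux_d E N f

/-- The functor `- ⊗_S N` on dg `E`-modules. -/
noncomputable def tensorFunctor : DGModule E.toDGAlg ⥤ DGModule E.toDGAlg where
  obj M := tensorObj E M N
  map f := tensorHom E N f
  map_id M := by
    ext x
    exact tensor_induction (p := fun x => tensorHomAux E N (𝟙 M) x = x)
      (fun i j m n _ _ => rfl) (fun x y hx hy => by rw [map_add, hx, hy]) x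
  map_comp {M M' M''} f g := by
    ext x
    exact tensor_induction (p := fun x => tensorHomAux E N (f ≫ g) x
        = tensorHomAux E N g (tensorHomAux E N f x))
      (fun i j m n _ _ => rfl) (fun x y hx hy => by simp only [map_add, hx, hy]) x

end TensorMap

/-- The `S`-relative quasi-isomorphisms: the morphisms of dg `E`-modules whose restriction to `S`
is a homotopy equivalence. -/
def relQis {S : CDGAlg k} (E : DGAlgebra S) : MorphismProperty (DGModule E.toDGAlg) :=
  fun _ _ f => DGModule.IsHomotopyEquiv ((DGModule.res E.unit).map f)

/-- The `S`-relative derived category of a dg `S`-algebra `E`. -/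
abbrev RelDer {S : CDGAlg k} (E : DGAlgebra S) := (relQis E).Localization

/-- The functor from dg modules to the relative derived category. -/
abbrev relQ {S : CDGAlg k} (E : DGAlgebra S) : DGModule E.toDGAlg ⥤ RelDer E := (relQis E).Q

section Preserve

variable {S : CDGAlg k} (E : DGAlgebra S) (N : DGModule S.toDGAlg)

theorem tensor_homotopy {M M' : DGModule E.toDGAlg} (f g h : M →ₗ[k] M')
    (hf : ∀ (s : S.toDGAlg) (m : M), f (op (E.unit s) • m) = op (E.unit s) • f m)
    (hg : ∀ (s : S.toDGAlg) (m : M), g (op (E.unit s) • m) = op (E.unit s) • g m)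
    (hS : ∀ (s : S.toDGAlg) (m : M), h (op (E.unit s) • m) = op (E.unit s) • h m)
    (hdeg : ∀ (i : ℤ) (m : M), m ∈ M.gr i → h m ∈ M'.gr (i - 1))
    (H : ∀ m, f m - g m = M'.d (h m) + h (M.d m)) (x : TensorCarrier E M N) :
    tensorMapAux E N f hf x - tensorMapAux E N g hg x
      = tensorD E M' N (tensorMapAux E N h hS x) + tensorMapAux E N h hS (tensorD E M N x) := by
  refine tensor_induction (p := fun x =>  tensorMapAux E N f hf x - tensorMapAux E N g hg x
      = tensorD E M' N (tensorMapAux E N h hS x) + tensorMapAux E N h hS (tensorD E M N x)) ?_ ?_ x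
  · intro i j m n hm hn
    simp only [tensorMapAux_tmk]
    rw [tensorD_tmk E M N hm, tensorD_tmk E M' N (hdeg i m hm), map_add, map_smul,
      tensorMapAux_tmk, tensorMapAux_tmk, ← LinearMap.sub_apply, ← map_sub, H, map_add,
      LinearMap.add_apply, zpow_sub₀ (neg_ne_zero.2 one_ne_zero)]
    simp only [zpow_one, div_neg, div_one, neg_smul]
    abel
  · intro x y hx hy
    simp only [map_add]
    rw [add_sub_add_comm, hx, hy]
    abel

variable {B : DGAlg k} (χ : DGAlg.Hom B E.toDGAlg)

/-- If the map `χ` from `B` factors through `S`, then `- ⊗_S N` turns `S`-linear homotopy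
equivalences into `B`-linear ones. -/
theorem tensor_homotopyEquiv (hχ : ∀ b : B, ∃ s : S.toDGAlg, χ b = E.unit s)
    {M M' : DGModule E.toDGAlg} (f : M ⟶ M')
    (hf : DGModule.IsHomotopyEquiv ((DGModule.res E.unit).map f)) :
    DGModule.IsHomotopyEquiv ((DGModule.res χ).map ((tensorFunctor E N).map f)) := by
  have act : ∀ {X Y : DGModule E.toDGAlg} (h : X →ₗ[k] Y) (hS : ∀ (s : S.toDGAlg) (m : X),
      h (op (E.unit s) • m) = op (E.unit s) • h m) (b : B) (x : TensorCarrier E X N),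
      tensorMapAux E N h hS (tensorAct E X N x (χ b))
        = tensorAct E Y N (tensorMapAux E N h hS x) (χ b) := by
    intro X Y h hS b x
    refine graded_induction B.isInternal (p := fun b => tensorMapAux E N h hS
      (tensorAct E X N x (χ b)) = tensorAct E Y N (tensorMapAux E N h hS x) (χ b)) ?_ ?_ b
    · intro i b hb
      obtain ⟨s, hs⟩ := hχ b
      refine tensorMapAux_act E N h hS (χ.map_mem hb) (fun m => ?_) x
      rw [hs, hS]
    · intro a b ha hb
      simp only [map_add, ha, hb]
  obtain ⟨g, ⟨h₁, hd₁, H₁⟩, ⟨h₂, hd₂, H₂⟩⟩ := hf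
  let gk : M' →ₗ[k] M := g.toLin.restrictScalars k
  have hgk : ∀ (s : S.toDGAlg) (m : M'), gk (op (E.unit s) • m) = op (E.unit s) • gk m :=
    fun s m => g.toLin.map_smul (op s) m
  let G : (DGModule.res χ).obj (tensorObj E M' N) ⟶ (DGModule.res χ).obj (tensorObj E M N) :=
    { toLin :=
        { toFun := tensorMapAux E N gk hgk
          map_add' := fun x y => LinearMap.map_add (tensorMapAux E N gk hgk) x y
          map_smul' := fun b x => act gk hgk b.unop x }
      map_mem := fun {i x} hx => by
        have := tensorMapAux_mem E N gk hgk (c := 0) (fun i m hm => by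
          rw [add_zero]; exact g.map_mem hm) hx
        rwa [add_zero] at this
      map_d := fun x => by
        refine tensor_induction (p := fun x => tensorMapAux E N gk hgk (tensorD E M' N x)
          = tensorD E M N (tensorMapAux E N gk hgk x)) ?_ ?_ x
        · intro i j m n hm hn
          have hgd : gk (M'.d m) = M.d (gk m) := g.map_d m
          rw [tensorD_tmk E M' N hm, map_add, map_smul, tensorMapAux_tmk, tensorMapAux_tmk,
            tensorMapAux_tmk, tensorD_tmk E M N (m := gk m) (g.map_mem hm), hgd]
        · intro x y hx hy
          simp only [map_add, hx, hy] }
  let k₁ : M →ₗ[k] M := h₁.restrictScalars k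
  have hk₁ : ∀ (s : S.toDGAlg) (m : M), k₁ (op (E.unit s) • m) = op (E.unit s) • k₁ m :=
    fun s m => h₁.map_smul (op s) m
  let k₂ : M' →ₗ[k] M' := h₂.restrictScalars k
  have hk₂ : ∀ (s : S.toDGAlg) (m : M'), k₂ (op (E.unit s) • m) = op (E.unit s) • k₂ m :=
    fun s m => h₂.map_smul (op s) m
  refine ⟨G, ⟨⟨⟨tensorMapAux E N k₁ hk₁,
      fun x y => LinearMap.map_add (tensorMapAux E N k₁ hk₁) x y⟩, fun b x => act k₁ hk₁ b.unop x⟩,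
    fun i x hx => tensorMapAux_mem E N k₁ hk₁ (c := -1) hd₁ hx, fun x => ?_⟩,
    ⟨⟨⟨tensorMapAux E N k₂ hk₂,
      fun x y => LinearMap.map_add (tensorMapAux E N k₂ hk₂) x y⟩, fun b x => act k₂ hk₂ b.unop x⟩,
    fun i x hx => tensorMapAux_mem E N k₂ hk₂ (c := -1) hd₂ hx, fun x => ?_⟩⟩
  · have e := tensor_homotopy E N (gk ∘ₗ DGModule.Hom.klin f) LinearMap.id k₁
      (fun s m => (congrArg gk (DGModule.Hom.klin_smul f _ m)).trans (hgk s _))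
      (fun _ _ => rfl) hk₁ hd₁ H₁ x
    refine Eq.trans ?_ e
    refine congrArg₂ (fun a b => a - b) ?_ ?_
    · exact tensor_induction (p := fun x => tensorMapAux E N gk hgk (tensorHomAux E N f x)
        = tensorMapAux E N (gk ∘ₗ DGModule.Hom.klin f)
          (fun s m => (congrArg gk (DGModule.Hom.klin_smul f _ m)).trans (hgk s _)) x)
        (fun i j m n _ _ => rfl) (fun x y hx hy => by simp only [map_add, hx, hy]) x
    · exact tensor_induction (p := fun x => x = tensorMapAux E N LinearMap.id (fun _ _ => rfl) x)
        (fun i j m n _ _ => rfl) (fun x y hx hy => by rw [map_add, ← hx, ← hy]) x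
  · have e := tensor_homotopy E N (DGModule.Hom.klin f ∘ₗ gk) LinearMap.id k₂
      (fun s m => (congrArg (DGModule.Hom.klin f) (hgk s m)).trans (DGModule.Hom.klin_smul f _ _))
      (fun _ _ => rfl) hk₂ hd₂ H₂ x
    refine Eq.trans ?_ e
    refine congrArg₂ (fun a b => a - b) ?_ ?_
    · exact tensor_induction (p := fun x => tensorHomAux E N f (tensorMapAux E N gk hgk x)
        = tensorMapAux E N (DGModule.Hom.klin f ∘ₗ gk)
          (fun s m => (congrArg (DGModule.Hom.klin f) (hgk s m)).trans
            (DGModule.Hom.klin_smul f _ _)) x)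
        (fun i j m n _ _ => rfl) (fun x y hx hy => by simp only [map_add, hx, hy]) x
    · exact tensor_induction (p := fun x => x = tensorMapAux E N LinearMap.id (fun _ _ => rfl) x)
        (fun i j m n _ _ => rfl) (fun x y hx hy => by rw [map_add, ← hx, ← hy]) x

theorem shift_homotopyEquiv {F : DGAlg k} {M M' : DGModule F} (f : M ⟶ M')
    (hf : DGModule.IsHomotopyEquiv f) : DGModule.IsHomotopyEquiv (DGModule.shift.map f) := by
  obtain ⟨g, ⟨h₁, hd₁, H₁⟩, ⟨h₂, hd₂, H₂⟩⟩ := hf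
  refine ⟨DGModule.shift.map g, ⟨⟨⟨fun m => -h₁ m, fun x y => ?_⟩, fun e x => ?_⟩, fun i m hm => ?_,
    fun m => ?_⟩, ⟨⟨⟨fun m => -h₂ m, fun x y => ?_⟩, fun e x => ?_⟩, fun i m hm => ?_,
    fun m => ?_⟩⟩
  · exact (congrArg Neg.neg (h₁.map_add x y)).trans (neg_add _ _)
  · exact (congrArg Neg.neg (h₁.map_smul e x)).trans (smul_neg e (h₁ x)).symm
  · have := hd₁ _ _ hm
    rw [show i + 1 - 1 = i - 1 + 1 by ring] at this
    exact neg_mem this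
  · refine (H₁ m).trans ?_
    change _ = -(M.d (-h₁ m)) + -h₁ (-(M.d m))
    rw [map_neg, map_neg, neg_neg, neg_neg]
  · exact (congrArg Neg.neg (h₂.map_add x y)).trans (neg_add _ _)
  · exact (congrArg Neg.neg (h₂.map_smul e x)).trans (smul_neg e (h₂ x)).symm
  · have := hd₂ _ _ hm
    rw [show i + 1 - 1 = i - 1 + 1 by ring] at this
    exact neg_mem this
  · refine (H₂ m).trans ?_
    change _ = -(M'.d (-h₂ m)) + -h₂ (-(M'.d m))
    rw [map_neg, map_neg, neg_neg, neg_neg]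

end Preserve

section Localized

variable {S : CDGAlg k} (E : DGAlgebra S) (N : DGModule S.toDGAlg)

theorem tensorShift_inverts :
    (relQis E).IsInvertedBy (tensorFunctor E N ⋙ DGModule.shift ⋙ relQ E) := by
  intro M M' f hf
  have h1 := tensor_homotopyEquiv E N E.unit (fun b => ⟨b, rfl⟩) f hf
  have h2 : relQis E (DGModule.shift.map ((tensorFunctor E N).map f)) := shift_homotopyEquiv _ h1
  exact (relQis E).Q_inverts _ h2

/-- The functor `M ↦ (M ⊗_S N)[1]` on the `S`-relative derived category of `E`. -/
noncomputable def tensorShift : RelDer E ⥤ RelDer E :=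
  Localization.Construction.lift (tensorFunctor E N ⋙ DGModule.shift ⋙ relQ E)
    (tensorShift_inverts E N)

end Localized

/-! The dg `R`-algebra `A ⊗_S R`. -/

section TensorAlgebra

variable {S : CDGAlg k} (A : DGAlgebra S) (R : AugCDGAlgebra S)

/-- `R` as a dg `S`-module. -/
abbrev AugCDGAlgebra.asModule {S : CDGAlg k} (R : AugCDGAlgebra S) : DGModule S.toDGAlg :=
  (DGModule.res R.unit).obj (DGModule.regular R.toDGAlg)

/-- The vector space underlying `A ⊗_S R`. -/
abbrev TAlg : Type u := TensorCarrier A (DGModule.regular A.toDGAlg) R.asModule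

/-- The class of `a ⊗ r` in `A ⊗_S R`. -/
abbrev tm : A.toDGAlg →ₗ[k] R.toDGAlg →ₗ[k] TAlg A R :=
  tmk A (DGModule.regular A.toDGAlg) R.asModule

theorem tm_balanced {i j : ℤ} {s : S.toDGAlg} {r : R.toDGAlg} (hs : s ∈ S.gr i) (hr : r ∈ R.gr j)
    (a : A.toDGAlg) : tm A R (a * A.unit s) r = (-1 : k) ^ (i * j) • tm A R a (r * R.unit s) :=
  tmk_balanced A (DGModule.regular A.toDGAlg) R.asModule hs hr a

variable {A R} in
/-- Balanced bilinear maps factor through `A ⊗_S R`. -/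
def talgLift {P : Type u} [AddCommGroup P] [Module k P]
    (f : A.toDGAlg →ₗ[k] R.toDGAlg →ₗ[k] P)
    (hf : ∀ (i j : ℤ) (s : S.toDGAlg) (r : R.toDGAlg) (a : A.toDGAlg), s ∈ S.gr i → r ∈ R.gr j →
      f (a * A.unit s) r = (-1 : k) ^ (i * j) • f a (r * R.unit s)) : TAlg A R →ₗ[k] P :=
  tlift (E := A) (M := DGModule.regular A.toDGAlg) (N := R.asModule) f
    (fun i j _ s r a hs hr _ => hf i j s r a hs hr)

/-- The right multiplication `(a ⊗ r) r' = a ⊗ r r'` of `R` on `A ⊗_S R`. -/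
noncomputable def tAlgRight : TAlg A R →ₗ[k] R.toDGAlg →ₗ[k] TAlg A R :=
  talgLift
    (LinearMap.mk₂ k (M := A.toDGAlg) (Nₗ := R.toDGAlg)
      (fun a r => (tm A R a) ∘ₗ LinearMap.mulLeft k r)
      (fun a a' r => by ext x; simp) (fun c a r => by ext x; simp)
      (fun a r r' => by ext x; simp [add_mul]) (fun c a r => by ext x; simp)) <| by
    intro i j s r a hs hr
    refine graded_ext R.isInternal fun q x hx => ?_
    change tm A R (a * A.unit s) (r * x) = (-1 : k) ^ (i * j) • tm A R a (r * R.unit s * x)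
    rw [tm_balanced A R hs (R.mul_mem hr hx), mul_assoc, mul_assoc,
      R.comm (R.unit.map_mem hs) hx, mul_smul_comm, map_smul, smul_smul, sign_mul]
    congr 2
    ring

theorem tAlgRight_tm (a : A.toDGAlg) (r x : R.toDGAlg) :
    tAlgRight A R (tm A R a r) x = tm A R a (r * x) := rfl

/-- The right multiplication `(a ⊗ r) a' = (-1)^{|r||a'|} a a' ⊗ r` of `A` on `A ⊗_S R`. -/
noncomputable abbrev tAlgAct : TAlg A R →ₗ[k] A.toDGAlg →ₗ[k] TAlg A R :=
  tensorAct A (DGModule.regular A.toDGAlg) R.asModule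

theorem tAlgAct_tm {i j : ℤ} {a' : A.toDGAlg} (ha' : a' ∈ A.gr i) {r : R.toDGAlg}
    (hr : r ∈ R.gr j) (a : A.toDGAlg) :
    tAlgAct A R (tm A R a r) a' = (-1 : k) ^ (i * j) • tm A R (a * a') r :=
  tensorAct_tmk A (DGModule.regular A.toDGAlg) R.asModule ha' hr a

theorem tAlgAct_act (x : TAlg A R) (a b : A.toDGAlg) :
    tAlgAct A R x (a * b) = tAlgAct A R (tAlgAct A R x a) b :=
  mul_smul (op b) (op a) (show (tensorObj A (DGModule.regular A.toDGAlg) R.asModule).carrier from x)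

variable {A R} in
theorem talg_induction {p : TAlg A R → Prop}
    (hom : ∀ (i j : ℤ) (a : A.toDGAlg) (r : R.toDGAlg), a ∈ A.gr i → r ∈ R.gr j → p (tm A R a r))
    (add : ∀ x y, p x → p y → p (x + y)) (x : TAlg A R) : p x :=
  tensor_induction hom add x

theorem tAlgAct_unit {i : ℤ} {s : S.toDGAlg} (hs : s ∈ S.gr i) (x : TAlg A R) :
    tAlgAct A R x (A.unit s) = tAlgRight A R x (R.unit s) := by
  refine talg_induction (p := fun x => tAlgAct A R x (A.unit s) = tAlgRight A R x (R.unit s))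
    ?_ ?_ x
  · intro p q a r ha hr
    rw [tAlgAct_tm A R (A.unit.map_mem hs) hr, tAlgRight_tm, tm_balanced A R hs hr, smul_smul,
      sign_mul, (Even.add_self _).neg_one_zpow, one_smul]
  · intro x y hx hy
    simp only [map_add, LinearMap.add_apply, hx, hy]

theorem tAlgRight_right (x : TAlg A R) (r r' : R.toDGAlg) :
    tAlgRight A R (tAlgRight A R x r) r' = tAlgRight A R x (r * r') := by
  refine talg_induction
    (p := fun x => tAlgRight A R (tAlgRight A R x r) r' = tAlgRight A R x (r * r')) ?_ ?_ x
  · intro p q a s ha hs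
    rw [tAlgRight_tm, tAlgRight_tm, tAlgRight_tm, mul_assoc]
  · intro x y hx hy
    simp only [map_add, LinearMap.add_apply, hx, hy]

theorem tAlgAct_right {i j : ℤ} {a : A.toDGAlg} {r : R.toDGAlg} (ha : a ∈ A.gr i)
    (hr : r ∈ R.gr j) (x : TAlg A R) :
    tAlgAct A R (tAlgRight A R x r) a
      = (-1 : k) ^ (i * j) • tAlgRight A R (tAlgAct A R x a) r := by
  refine talg_induction (p := fun x => tAlgAct A R (tAlgRight A R x r) a
      = (-1 : k) ^ (i * j) • tAlgRight A R (tAlgAct A R x a) r) ?_ ?_ x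
  · intro p q b s hb hs
    rw [tAlgRight_tm, tAlgAct_tm A R ha (R.mul_mem hs hr), tAlgAct_tm A R ha hs, map_smul,
      LinearMap.smul_apply, tAlgRight_tm, smul_smul, sign_mul]
    congr 2
    ring
  · intro x y hx hy
    simp only [map_add, LinearMap.add_apply, hx, hy, smul_add]

/-- The multiplication of `A ⊗_S R`: `tAlgMul y x` is the product `x y`, given by
`x (a ⊗ r) = (x a) r`, so that `(a ⊗ r) (a' ⊗ r') = (-1)^{|r||a'|} a a' ⊗ r r'`. -/
noncomputable def tAlgMul : TAlg A R →ₗ[k] TAlg A R →ₗ[k] TAlg A R :=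
  talgLift
    (LinearMap.mk₂ k (M := A.toDGAlg) (Nₗ := R.toDGAlg)
      (fun a r => ((tAlgRight A R).flip r) ∘ₗ ((tAlgAct A R).flip a))
      (fun a a' r => by ext x; simp) (fun c a r => by ext x; simp)
      (fun a r r' => by ext x; simp) (fun c a r => by ext x; simp)) <| by
    intro i j s r a hs hr
    refine LinearMap.ext fun x => ?_
    change tAlgRight A R (tAlgAct A R x (a * A.unit s)) r
      = (-1 : k) ^ (i * j) • tAlgRight A R (tAlgAct A R x a) (r * R.unit s)
    rw [tAlgAct_act, tAlgAct_unit A R hs, tAlgRight_right, R.comm (R.unit.map_mem hs) hr, map_smul]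

theorem tAlgMul_tm (x : TAlg A R) (a : A.toDGAlg) (r : R.toDGAlg) :
    tAlgMul A R (tm A R a r) x = tAlgRight A R (tAlgAct A R x a) r := rfl

theorem tAlgMul_tm_tm {i j : ℤ} {a' : A.toDGAlg} (ha' : a' ∈ A.gr i) {r : R.toDGAlg}
    (hr : r ∈ R.gr j) (a : A.toDGAlg) (r' : R.toDGAlg) :
    tAlgMul A R (tm A R a' r') (tm A R a r) = (-1 : k) ^ (i * j) • tm A R (a * a') (r * r') := by
  rw [tAlgMul_tm, tAlgAct_tm A R ha' hr, map_smul, LinearMap.smul_apply, tAlgRight_tm]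

theorem tAlgMul_assoc (x y z : TAlg A R) :
    tAlgMul A R z (tAlgMul A R y x) = tAlgMul A R (tAlgMul A R z y) x := by
  refine talg_induction (p := fun z =>
    tAlgMul A R z (tAlgMul A R y x) = tAlgMul A R (tAlgMul A R z y) x) ?_ ?_ z
  · intro i j a r ha hr
    refine talg_induction (p := fun y =>
      tAlgMul A R (tm A R a r) (tAlgMul A R y x) = tAlgMul A R (tAlgMul A R (tm A R a r) y) x)
      ?_ ?_ y
    · intro i' j' a' r' ha' hr'
      rw [tAlgMul_tm_tm A R ha hr', map_smul, LinearMap.smul_apply, tAlgMul_tm, tAlgMul_tm,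
        tAlgMul_tm, tAlgAct_right A R ha hr', map_smul, LinearMap.smul_apply, tAlgRight_right,
        tAlgAct_act]
    · intro y y' h h'
      simp only [map_add, LinearMap.add_apply, h, h']
  · intro z z' h h'
    simp only [map_add, LinearMap.add_apply, h, h']

theorem tAlgMul_one (x : TAlg A R) : tAlgMul A R (tm A R 1 1) x = x := by
  refine talg_induction (p := fun x => tAlgMul A R (tm A R 1 1) x = x) ?_ ?_ x
  · intro i j a r ha hr
    rw [tAlgMul_tm_tm A R A.one_mem hr]
    simp
  · intro x y hx hy
    simp only [map_add, hx, hy]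

theorem one_tAlgMul (x : TAlg A R) : tAlgMul A R x (tm A R 1 1) = x := by
  refine talg_induction (p := fun x => tAlgMul A R x (tm A R 1 1) = x) ?_ ?_ x
  · intro i j a r ha hr
    rw [tAlgMul_tm_tm A R ha R.one_mem]
    simp
  · intro x y hx hy
    simp only [map_add, LinearMap.add_apply, hx, hy]

noncomputable instance tAlgRing : Ring (TAlg A R) :=
  { (inferInstance : AddCommGroup (TAlg A R)) with
    mul := fun x y => tAlgMul A R y x
    one := tm A R 1 1
    left_distrib := fun x y z => by
      change tAlgMul A R (y + z) x = tAlgMul A R y x + tAlgMul A R z x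
      simp
    right_distrib := fun x y z => by
      change tAlgMul A R z (x + y) = tAlgMul A R z x + tAlgMul A R z y
      simp
    zero_mul := fun x => by
      change tAlgMul A R x 0 = 0
      simp
    mul_zero := fun x => by
      change tAlgMul A R 0 x = 0
      simp
    mul_assoc := fun x y z => tAlgMul_assoc A R x y z
    one_mul := fun x => one_tAlgMul A R x
    mul_one := fun x => tAlgMul_one A R x }

theorem tAlg_mul_def (x y : TAlg A R) : x * y = tAlgMul A R y x := rfl

theorem tAlg_one_def : (1 : TAlg A R) = tm A R 1 1 := rfl

theorem tm_mul_tm {i j : ℤ} {a' : A.toDGAlg} (ha' : a' ∈ A.gr i) {r : R.toDGAlg}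
    (hr : r ∈ R.gr j) (a : A.toDGAlg) (r' : R.toDGAlg) :
    tm A R a r * tm A R a' r' = (-1 : k) ^ (i * j) • tm A R (a * a') (r * r') :=
  tAlgMul_tm_tm A R ha' hr a r'

noncomputable instance tAlgAlgebra : Algebra k (TAlg A R) :=
  Algebra.ofModule
    (fun c x y => by rw [tAlg_mul_def, tAlg_mul_def, map_smul])
    (fun c x y => by rw [tAlg_mul_def, tAlg_mul_def, map_smul, LinearMap.smul_apply])

theorem DGAlg.d_one (B : DGAlg k) : B.d 1 = 0 := by
  have := B.d_mul B.one_mem 1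
  simp only [mul_one, zpow_zero, one_smul, one_mul] at this
  exact left_eq_add.1 this

noncomputable abbrev tAlgD : TAlg A R →ₗ[k] TAlg A R := tensorD A (DGModule.regular A.toDGAlg) R.asModule

abbrev tAlgGr : ℤ → Submodule k (TAlg A R) := tensorGr A (DGModule.regular A.toDGAlg) R.asModule

theorem tAlgD_tm {i : ℤ} {a : A.toDGAlg} (ha : a ∈ A.gr i) (r : R.toDGAlg) :
    tAlgD A R (tm A R a r) = tm A R (A.d a) r + (-1 : k) ^ i • tm A R a (R.d r) :=
  tensorD_tmk A (DGModule.regular A.toDGAlg) R.asModule ha r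

theorem tm_mem {i j : ℤ} {a : A.toDGAlg} {r : R.toDGAlg} (ha : a ∈ A.gr i) (hr : r ∈ R.gr j) :
    tm A R a r ∈ tAlgGr A R (i + j) :=
  tmk_mem (M := DGModule.regular A.toDGAlg) (N := R.asModule) ha hr

variable {A R} in
theorem tAlgGr_map {P : Type u} [AddCommGroup P] [Module k P]
    {f : TAlg A R →ₗ[k] P} {n : ℤ} {Q : Submodule k P}
    (H : ∀ (i j : ℤ) (a : A.toDGAlg) (r : R.toDGAlg), i + j = n → a ∈ A.gr i → r ∈ R.gr j →
      f (tm A R a r) ∈ Q) {x : TAlg A R} (hx : x ∈ tAlgGr A R n) : f x ∈ Q :=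
  tensorGr_map H hx

theorem tAlg_mul_mem {i j : ℤ} {x y : TAlg A R} (hx : x ∈ tAlgGr A R i) (hy : y ∈ tAlgGr A R j) :
    x * y ∈ tAlgGr A R (i + j) := by
  refine tAlgGr_map (f := (tAlgMul A R).flip x) ?_ hy
  rintro p q a r rfl ha hr
  refine tAlgGr_map (f := tAlgMul A R (tm A R a r)) ?_ hx
  rintro p' q' a' r' rfl ha' hr'
  have := tm_mul_tm A R ha hr' a' r
  change tm A R a' r' * tm A R a r ∈ _
  rw [this, show p' + q' + (p + q) = (p' + p) + (q' + q) by ring]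
  exact Submodule.smul_mem _ _ (tm_mem A R (A.mul_mem ha' ha) (R.mul_mem hr' hr))

theorem tAlg_d_mul {i : ℤ} {x : TAlg A R} (hx : x ∈ tAlgGr A R i) (y : TAlg A R) :
    tAlgD A R (x * y) = tAlgD A R x * y + (-1 : k) ^ i • (x * tAlgD A R y) := by
  refine talg_induction (p := fun y =>
    tAlgD A R (x * y) = tAlgD A R x * y + (-1 : k) ^ i • (x * tAlgD A R y)) ?_ ?_ y
  · intro p q a r ha hr
    have key := tAlgGr_map (n := i) (Q := (⊥ : Submodule k (TAlg A R)))
      (f := tAlgD A R ∘ₗ tAlgMul A R (tm A R a r) - tAlgMul A R (tm A R a r) ∘ₗ tAlgD A R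
        - (-1 : k) ^ i • tAlgMul A R (tAlgD A R (tm A R a r))) ?_ hx
    · rw [Submodule.mem_bot] at key
      simp only [LinearMap.sub_apply, LinearMap.comp_apply, LinearMap.smul_apply] at key
      rw [sub_sub, sub_eq_zero] at key
      exact key
    · rintro p' q' a' r' rfl ha' hr'
      rw [Submodule.mem_bot]
      simp only [LinearMap.sub_apply, LinearMap.comp_apply, LinearMap.smul_apply]
      rw [sub_sub, sub_eq_zero]
      change tAlgD A R (tm A R a' r' * tm A R a r) = tAlgD A R (tm A R a' r') * tm A R a r
        + (-1 : k) ^ (p' + q') • (tm A R a' r' * tAlgD A R (tm A R a r))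
      have ha1 : a' ∈ A.gr p' := ha'
      have hr1 : r' ∈ R.gr q' := hr'
      rw [tm_mul_tm A R ha hr1, map_smul, tAlgD_tm A R (A.mul_mem ha1 ha), tAlgD_tm A R ha1,
        tAlgD_tm A R ha, add_mul, mul_add, smul_mul_assoc, mul_smul_comm, tm_mul_tm A R ha hr1,
        tm_mul_tm A R ha (R.d_mem hr1), tm_mul_tm A R (A.d_mem ha) hr1, tm_mul_tm A R ha hr1,
        A.d_mul ha1, R.d_mul hr1]
      simp only [map_add, map_smul, LinearMap.add_apply, LinearMap.smul_apply, smul_add, smul_smul,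
        sign_mul]
      refine Eq.trans ?_ (add_add_add_comm _ _ _ _)
      refine congrArg₂ (· + ·) (congrArg₂ (· + ·) rfl ?_) (congrArg₂ (· + ·) ?_ ?_)
      all_goals
        congr 1
        apply sign_congr
        simp only [Int.even_add, Int.even_mul, Int.not_even_one]
        tauto
  · intro y y' h h'
    simp only [mul_add, map_add, h, h', smul_add]
    abel

/-- The dg `k`-algebra underlying `A ⊗_S R`. -/
noncomputable def tAlgDG : DGAlg k where
  carrier := TAlg A R
  gr := tAlgGr A R
  isInternal := tensor_isInternal A (DGModule.regular A.toDGAlg) R.asModule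
  one_mem := by
    have := tm_mem A R A.one_mem R.one_mem
    rwa [add_zero] at this
  mul_mem := fun hx hy => tAlg_mul_mem A R hx hy
  d := tAlgD A R
  d_mem := fun hx => tensorD_mem A (DGModule.regular A.toDGAlg) R.asModule hx
  d_d := tensorD_tensorD A (DGModule.regular A.toDGAlg) R.asModule
  d_mul := fun hx y => tAlg_d_mul A R hx y

/-- The morphism `a ↦ a ⊗ 1` from `A` to `A ⊗_S R`. -/
noncomputable def inAlg : DGAlg.Hom A.toDGAlg (tAlgDG A R) where
  toAlgHom := AlgHom.ofLinearMap (A := A.toDGAlg) (B := TAlg A R) ((tm A R).flip 1) rfl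
    (fun a b => by
      change tm A R (a * b) 1 = tm A R a 1 * tm A R b 1
      refine graded_induction A.isInternal
        (p := fun b => tm A R (a * b) 1 = tm A R a 1 * tm A R b 1) ?_ ?_ b
      · intro i b hb
        rw [tm_mul_tm A R hb R.one_mem]
        simp
      · intro b b' h h'
        simp only [mul_add, map_add, LinearMap.add_apply, h, h'])
  map_mem := fun {i a} ha => by
    have := tm_mem A R ha R.one_mem
    rwa [add_zero] at this
  map_d := fun a => by
    change tm A R (A.d a) 1 = tAlgD A R (tm A R a 1)
    refine graded_induction A.isInternal
      (p := fun a => tm A R (A.d a) 1 = tAlgD A R (tm A R a 1)) ?_ ?_ a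
    · intro i a ha
      rw [tAlgD_tm A R ha, DGAlg.d_one]
      simp
    · intro a b h h'
      simp only [map_add, LinearMap.add_apply, h, h']

/-- The morphism `r ↦ 1 ⊗ r` from `R` to `A ⊗_S R`. -/
noncomputable def inR : DGAlg.Hom R.toDGAlg (tAlgDG A R) where
  toAlgHom := AlgHom.ofLinearMap (A := R.toDGAlg) (B := TAlg A R) (tm A R 1) rfl
    (fun r s => by
      change tm A R 1 (r * s) = tm A R 1 r * tm A R 1 s
      refine graded_induction R.isInternal
        (p := fun r => tm A R 1 (r * s) = tm A R 1 r * tm A R 1 s) ?_ ?_ r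
      · intro i r hr
        rw [tm_mul_tm A R A.one_mem hr]
        simp
      · intro b b' h h'
        simp only [add_mul, map_add, h, h'])
  map_mem := fun {i r} hr => by
    have := tm_mem A R A.one_mem hr
    rwa [zero_add] at this
  map_d := fun r => by
    change tm A R 1 (R.d r) = tAlgD A R (tm A R 1 r)
    rw [tAlgD_tm A R A.one_mem, DGAlg.d_one]
    simp

/-- The dg `R`-algebra `A ⊗_S R`. -/
noncomputable def tAlg : DGAlgebra R.toCDGAlg where
  toDGAlg := tAlgDG A R
  unit := inR A R
  central := @fun i j s (x : TAlg A R) hs hx => by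
    change tm A R 1 s * x = (-1 : k) ^ (i * j) • (x * tm A R 1 s)
    have key := tAlgGr_map (n := j) (Q := (⊥ : Submodule k (TAlg A R)))
      (f := (tAlgMul A R).flip (tm A R 1 s) - (-1 : k) ^ (i * j) • tAlgMul A R (tm A R 1 s)) ?_ hx
    · rw [Submodule.mem_bot] at key
      simp only [LinearMap.sub_apply, LinearMap.flip_apply, LinearMap.smul_apply] at key
      rw [sub_eq_zero] at key
      exact key
    · rintro p q a r rfl ha hr
      rw [Submodule.mem_bot]
      simp only [LinearMap.sub_apply, LinearMap.flip_apply, LinearMap.smul_apply]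
      rw [sub_eq_zero]
      change tm A R 1 s * tm A R a r = (-1 : k) ^ (i * (p + q)) • (tm A R a r * tm A R 1 s)
      have hr1 : r ∈ R.gr q := hr
      have ha1 : a ∈ A.gr p := ha
      have hs1 : s ∈ R.gr i := hs
      rw [tm_mul_tm A R ha1 hs1, tm_mul_tm A R A.one_mem hr1, R.comm hs1 hr1, one_mul, mul_one,
        map_smul, smul_smul, smul_smul]
      congr 1
      simp only [sign_mul]
      congr 1
      ring

/-- The morphism `a ↦ a ⊗ 1` from `A` to `A ⊗_S R`. -/
noncomputable def inA : DGAlg.Hom A.toDGAlg (tAlg A R).toDGAlg := inAlg A R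

theorem inA_unit (s : S.toDGAlg) : inA A R (A.unit s) = (tAlg A R).unit (R.unit s) := by
  change tm A R (A.unit s) 1 = tm A R 1 (R.unit s)
  refine graded_induction S.isInternal
    (p := fun s => tm A R (A.unit s) 1 = tm A R 1 (R.unit s)) ?_ ?_ s
  · intro i s hs
    have := tm_balanced A R hs R.one_mem 1
    simpa using this
  · intro a b h h'
    simp only [map_add, LinearMap.add_apply, h, h']

end TensorAlgebra

/-! Deformations and their characteristic classes. -/

section Triangle

variable {E : DGAlg k} {X Y Z : DGModule E}

/-- The morphism `(x, y) ↦ p y` from the cone of `f : X ⟶ Y` to `Z`, if `p ∘ f = 0`. -/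
def coneDesc (f : X ⟶ Y) (p : Y ⟶ Z) (h : ∀ x, p.toLin (f.toLin x) = 0) :
    DGModule.cone f ⟶ Z where
  toLin := p.toLin ∘ₗ LinearMap.snd E.carrierᵐᵒᵖ X.carrier Y.carrier
  map_mem := fun hm => p.map_mem hm.2
  map_d := by
    rintro ⟨x, y⟩
    change p.toLin (f.toLin x + Y.d y) = Z.d (p.toLin y)
    rw [map_add, h, zero_add, p.map_d]

/-- The morphism `(x, y) ↦ -x` from the cone of `f : X ⟶ Y` to `X[1]`. -/
def coneδ (f : X ⟶ Y) : DGModule.cone f ⟶ DGModule.shift.obj X where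
  toLin := -LinearMap.fst E.carrierᵐᵒᵖ X.carrier Y.carrier
  map_mem := fun {i m} hm => (X.gr (i + 1)).neg_mem hm.1
  map_d := by
    rintro ⟨x, y⟩
    change -(-X.d x) = -X.d (-x)
    rw [map_neg]

end Triangle

section Augmentation

variable {S : CDGAlg k} (R : AugCDGAlgebra S)

/-- `S` as a dg `R`-module. -/
abbrev augModule : DGModule R.toDGAlg :=
  (DGModule.res R.aug).obj (DGModule.regular S.toDGAlg)

/-- The kernel `n` of the augmentation `R → S`. -/
def augKer : Submodule k R.toDGAlg := LinearMap.ker R.aug.toAlgHom.toLinearMap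

theorem mem_augKer {x : R.toDGAlg} : x ∈ augKer R ↔ R.aug x = 0 := Iff.rfl

theorem proj_mem_augKer (n : ℤ) {x : R.toDGAlg} (hx : x ∈ augKer R) :
    proj R.isInternal n x ∈ augKer R := by
  have key : R.aug.toAlgHom.toLinearMap ∘ₗ proj R.isInternal n
      = proj S.isInternal n ∘ₗ R.aug.toAlgHom.toLinearMap := by
    refine graded_ext R.isInternal fun i r hr => ?_
    change R.aug (proj R.isInternal n r) = proj S.isInternal n (R.aug r)
    by_cases h : i = n
    · subst h
      rw [proj_of_mem _ hr, proj_of_mem S.isInternal (R.aug.map_mem hr)]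
    · rw [proj_of_mem_ne _ h hr, proj_of_mem_ne S.isInternal h (R.aug.map_mem hr), map_zero]
  have := LinearMap.congr_fun key x
  simp only [LinearMap.comp_apply] at this
  change R.aug.toAlgHom.toLinearMap _ = 0
  rw [this]
  change proj S.isInternal n (R.aug x) = 0
  rw [(mem_augKer R).1 hx, map_zero]

/-- The kernel `n` of the augmentation `R → S` as a dg `R`-module. -/
noncomputable def kerModule : DGModule R.toDGAlg :=
  letI : Module R.toDGAlg.carrierᵐᵒᵖ (augKer R) :=
    { smul := fun r x => ⟨x.1 * r.unop, by
        rw [mem_augKer, map_mul, (mem_augKer R).1 x.2, zero_mul]⟩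
      one_smul := fun x => Subtype.ext (mul_one x.1)
      mul_smul := fun a b x => Subtype.ext (mul_assoc x.1 b.unop a.unop).symm
      smul_zero := fun a => Subtype.ext (zero_mul a.unop)
      smul_add := fun a x y => Subtype.ext (add_mul x.1 y.1 a.unop)
      add_smul := fun a b x => Subtype.ext (mul_add x.1 a.unop b.unop)
      zero_smul := fun x => Subtype.ext (mul_zero x.1) }
  { carrier := augKer R
    isScalarTower := ⟨fun c r x => Subtype.ext (mul_smul_comm c x.1 r.unop)⟩
    gr := fun i => (R.gr i).comap (augKer R).subtype
    isInternal := by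
      refine isInternal_of_proj _
        (fun n => (proj R.isInternal n).restrict fun x hx => proj_mem_augKer R n hx) ?_ ?_ ?_
      · intro i m hm
        exact Subtype.ext (proj_of_mem R.isInternal hm)
      · intro i j hj m hm
        exact Subtype.ext (proj_of_mem_ne R.isInternal hj hm)
      · rintro ⟨x, hx⟩
        have h1 := mem_span_proj R.isInternal x
        have h2 : Submodule.span k (Set.range fun n => proj R.isInternal n x)
            ≤ (⨆ i, (R.gr i).comap (augKer R).subtype).map (augKer R).subtype := by
          refine Submodule.span_le.2 ?_
          rintro _ ⟨n, rfl⟩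
          exact ⟨⟨proj R.isInternal n x, proj_mem_augKer R n hx⟩,
            Submodule.mem_iSup_of_mem n (proj_mem R.isInternal n x), rfl⟩
        obtain ⟨y, hy, hyx⟩ := h2 h1
        have : y = ⟨x, hx⟩ := Subtype.ext hyx
        rwa [← this]
    smul_mem := fun hm ha => R.mul_mem hm ha
    d := R.d.restrict fun x hx => by
      rw [mem_augKer, R.aug.map_d, (mem_augKer R).1 hx, map_zero]
    d_mem := fun hm => R.d_mem hm
    d_d := fun m => Subtype.ext (R.d_d m.1)
    d_smul := fun hm a => Subtype.ext (R.d_mul hm a) }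

/-- The inclusion of `n` into `R`. -/
def kerVal (x : kerModule R) : R.toDGAlg := (show augKer R from x).1

theorem kerVal_mem (x : kerModule R) : R.aug (kerVal R x) = 0 := (show augKer R from x).2

/-- The kernel `n` of the augmentation `R → S` as a dg `S`-module. -/
noncomputable abbrev kerModuleS : DGModule S.toDGAlg := (DGModule.res R.unit).obj (kerModule R)

/-- The condition `n² = 0`. -/
def SquareZero : Prop := ∀ x ∈ augKer R, ∀ y ∈ augKer R, x * y = 0

end Augmentation

section Sequence

variable {S : CDGAlg k} {R : AugCDGAlgebra S} (E : DGAlgebra R.toCDGAlg) (L : DGModule E.toDGAlg)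

/-- The map `l ⊗ x ↦ l x` from `L ⊗_R n` to `L`. -/
noncomputable def kerInclAux : TensorCarrier E L (kerModule R) →ₗ[k] L :=
  tlift (LinearMap.mk₂ k (M := L) (Nₗ := augKer R) (fun l x => op (E.unit x.1) • l)
      (fun l l' x => smul_add _ _ _) (fun c l x => smul_comm _ _ _)
      (fun l x x' => by
        change op (E.unit (x.1 + x'.1)) • l = _
        rw [map_add, MulOpposite.op_add, add_smul])
      (fun c l x => by
        change op (E.unit (c • x.1)) • l = _
        rw [map_smul, MulOpposite.op_smul, smul_assoc])) <| by
    intro i j p r x l hr hx hl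
    change op (E.unit x.1) • op (E.unit r) • l
      = (-1 : k) ^ (i * j) • (op (E.unit (x.1 * r)) • l)
    have hx' : x.1 ∈ R.gr j := hx
    rw [← mul_smul, ← op_mul, ← map_mul, R.comm hr hx', map_smul, MulOpposite.op_smul, smul_assoc]

theorem kerInclAux_tmk (l : L) (x : kerModule R) :
    kerInclAux E L (tmk E L (kerModule R) l x) = op (E.unit (kerVal R x)) • l := rfl

/-- The morphism `L ⊗_R n ⟶ L`, `l ⊗ x ↦ l x`. -/
noncomputable def kerIncl : tensorObj E L (kerModule R) ⟶ L where
  toLin :=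
    { toFun := kerInclAux E L
      map_add' := fun x y => LinearMap.map_add (kerInclAux E L) x y
      map_smul' := fun e t => by
        change kerInclAux E L (tensorAct E L (kerModule R) t e.unop)
          = op e.unop • kerInclAux E L t
        refine graded_induction E.isInternal (p := fun e =>
          kerInclAux E L (tensorAct E L (kerModule R) t e) = op e • kerInclAux E L t) ?_ ?_ e.unop
        · intro i e he
          refine tensor_induction (p := fun t =>
            kerInclAux E L (tensorAct E L (kerModule R) t e) = op e • kerInclAux E L t) ?_ ?_ t
          · intro p q l x hl hx
            have hx' : kerVal R x ∈ R.gr q := hx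
            rw [tensorAct_tmk E L (kerModule R) he hx, map_smul, kerInclAux_tmk, kerInclAux_tmk,
              ← mul_smul, ← mul_smul, ← op_mul, ← op_mul, E.central hx' he, MulOpposite.op_smul,
              smul_assoc, mul_comm q i]
          · intro x y hx hy
            simp only [map_add, LinearMap.add_apply, hx, hy, smul_add]
        · intro a b ha hb
          simp only [map_add, ha, hb, MulOpposite.op_add, add_smul] }
  map_mem := fun {i t} ht => by
    refine tensorGr_map (f := kerInclAux E L) ?_ ht
    rintro p q l x rfl hl hx
    exact L.smul_mem hl (E.unit.map_mem hx)
  map_d := fun t => by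
    refine tensor_induction (p := fun t =>
      kerInclAux E L (tensorD E L (kerModule R) t) = L.d (kerInclAux E L t)) ?_ ?_ t
    · intro p q l x hl hx
      rw [tensorD_tmk E L (kerModule R) hl, map_add, map_smul, kerInclAux_tmk, kerInclAux_tmk,
        kerInclAux_tmk, L.d_smul hl, ← E.unit.map_d]
      rfl
    · intro x y hx hy
      simp only [map_add, hx, hy]

/-- The class of `l ⊗ 1` in `L ⊗_R S`. -/
def redOne : L →ₗ[k] TensorCarrier E L (augModule R) :=
  (tmk E L (augModule R)).flip (1 : S.toDGAlg)

theorem redOne_mem {i : ℤ} {l : L} (hl : l ∈ L.gr i) :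
    redOne E L l ∈ tensorGr E L (augModule R) i := by
  have h1 : (1 : S.toDGAlg) ∈ (augModule R).gr 0 := S.one_mem
  have := tmk_mem (E := E) (N := augModule R) hl h1
  rwa [add_zero] at this

theorem redOne_act (l : L) (e : E.toDGAlg) :
    tensorAct E L (augModule R) (redOne E L l) e = redOne E L (op e • l) := by
  refine graded_induction E.isInternal (p := fun e =>
    tensorAct E L (augModule R) (redOne E L l) e = redOne E L (op e • l)) ?_ ?_ e
  · intro i e he
    have h1 : (1 : S.toDGAlg) ∈ (augModule R).gr 0 := S.one_mem
    have := tensorAct_tmk E L (augModule R) he h1 l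
    rw [mul_zero, zpow_zero, one_smul] at this
    exact this
  · intro a b ha hb
    simp only [map_add, ha, hb, MulOpposite.op_add, add_smul]

theorem redOne_unit (l : L) (r : R.toDGAlg) :
    redOne E L (op (E.unit r) • l) = tmk E L (augModule R) l (R.aug r) := by
  refine graded_induction R.isInternal (p := fun r =>
    redOne E L (op (E.unit r) • l) = tmk E L (augModule R) l (R.aug r)) ?_ ?_ r
  · intro i r hr
    have h1 : (1 : S.toDGAlg) ∈ (augModule R).gr 0 := S.one_mem
    have := tmk_balanced E L (augModule R) hr h1 l
    rw [mul_zero, zpow_zero, one_smul] at this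
    refine this.trans ?_
    change tmk E L (augModule R) l ((1 : S.toDGAlg) * R.aug r) = _
    rw [one_mul]
  · intro a b ha hb
    rw [map_add, MulOpposite.op_add, add_smul, map_add, ha, hb, map_add]
    exact (map_add (tmk E L (augModule R) l) _ _).symm

theorem redOne_d (l : L) : redOne E L (L.d l) = tensorD E L (augModule R) (redOne E L l) := by
  refine graded_induction L.isInternal (p := fun l =>
    redOne E L (L.d l) = tensorD E L (augModule R) (redOne E L l)) ?_ ?_ l
  · intro i l hl
    have h0 : (augModule R).d (1 : S.toDGAlg) = 0 := DGAlg.d_one S.toDGAlg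
    have := tensorD_tmk E L (augModule R) hl (1 : S.toDGAlg)
    rw [h0, map_zero, smul_zero, add_zero] at this
    exact this.symm
  · intro a b ha hb
    simp only [map_add, ha, hb]

/-- The morphism `L ⟶ L ⊗_R S`, `l ↦ l ⊗ 1`. -/
noncomputable def redProj : L ⟶ tensorObj E L (augModule R) where
  toLin :=
    { toFun := redOne E L
      map_add' := (redOne E L).map_add
      map_smul' := fun e l => (redOne_act E L l e.unop).symm }
  map_mem := fun hl => redOne_mem E L hl
  map_d := redOne_d E L

theorem redProj_kerIncl (t : TensorCarrier E L (kerModule R)) :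
    (redProj E L).toLin ((kerIncl E L).toLin t) = 0 := by
  change redOne E L (kerInclAux E L t) = 0
  refine tensor_induction (p := fun t => redOne E L (kerInclAux E L t) = 0) ?_ ?_ t
  · intro i j l x hl hx
    rw [kerInclAux_tmk, redOne_unit, kerVal_mem]
    exact map_zero _
  · intro x y hx hy
    rw [map_add, map_add, hx, hy, add_zero]

end Sequence

section Deformations

variable {S : CDGAlg k} (A : DGAlgebra S) (R : AugCDGAlgebra S)

/-- The restriction functor from dg `A ⊗_S R`-modules to dg `A`-modules. -/
noncomputable abbrev resA : DGModule (tAlg A R).toDGAlg ⥤ DGModule A.toDGAlg :=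
  DGModule.res (inA A R)

/-- The functor `L ↦ L ⊗_R S` from dg `A ⊗_S R`-modules to dg `A`-modules. -/
noncomputable abbrev redFunctor : DGModule (tAlg A R).toDGAlg ⥤ DGModule A.toDGAlg :=
  tensorFunctor (tAlg A R) (augModule R) ⋙ resA A R

theorem red_inverts :
    (relQis (tAlg A R)).IsInvertedBy (redFunctor A R ⋙ relQ A) := by
  intro L L' f hf
  let χ : DGAlg.Hom S.toDGAlg (tAlg A R).toDGAlg :=
    { toAlgHom := (inA A R).toAlgHom.comp A.unit.toAlgHom
      map_mem := fun h => (inA A R).map_mem (A.unit.map_mem h)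
      map_d := fun s => (congrArg (inA A R) (A.unit.map_d s)).trans ((inA A R).map_d _) }
  have h1 := tensor_homotopyEquiv (tAlg A R) (augModule R) χ
    (fun s => ⟨R.unit s, inA_unit A R s⟩) f hf
  have h2 : relQis A ((redFunctor A R).map f) := h1
  exact (relQis A).Q_inverts _ h2

/-- The reduction functor `L ↦ L ⊗_R S` from the `R`-relative derived category of `A ⊗_S R` to
the `S`-relative derived category of `A`. -/
noncomputable def reduction : RelDer (tAlg A R) ⥤ RelDer A :=
  Localization.Construction.lift (redFunctor A R ⋙ relQ A) (red_inverts A R)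

/-- A deformation of `M`: a dg `A ⊗_S R`-module `L`, free as a graded `R`-module, with an
isomorphism `u : L ⊗_R S ≅ M` in the `S`-relative derived category of `A`. -/
structure Deformation (M : DGModule A.toDGAlg) where
  L : DGModule (tAlg A R).toDGAlg
  free : ((DGModule.res (tAlg A R).unit).obj L).IsGradedFree
  u : (reduction A R).obj ((relQ (tAlg A R)).obj L) ≅ (relQ A).obj M

/-- The category of deformations of `M`: the morphisms from `(L, u)` to `(L', u')` are the
morphisms `v : L ⟶ L'` of the `R`-relative derived category such that `u' ∘ (v ⊗_R S) = u`. -/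
noncomputable instance (M : DGModule A.toDGAlg) : Category (Deformation A R M) where
  Hom D D' := {v : (relQ (tAlg A R)).obj D.L ⟶ (relQ (tAlg A R)).obj D'.L //
    (reduction A R).map v ≫ D'.u.hom = D.u.hom}
  id D := ⟨𝟙 _, by simp⟩
  comp f g := ⟨f.1 ≫ g.1, by rw [Functor.map_comp, Category.assoc, g.2, f.2]⟩
  id_comp f := Subtype.ext (Category.id_comp f.1)
  comp_id f := Subtype.ext (Category.comp_id f.1)
  assoc f g h := Subtype.ext (Category.assoc f.1 g.1 h.1)

/-- The set of isomorphism classes of deformations of `M`. -/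
def Defo (M : DGModule A.toDGAlg) := Quotient (isIsomorphicSetoid (Deformation A R M))

end Deformations

section CharacteristicClass

variable {S : CDGAlg k} (A : DGAlgebra S) (R : AugCDGAlgebra S)
  (L : DGModule (tAlg A R).toDGAlg)

/-- The vector space underlying `(L ⊗_R S) ⊗_S n`. -/
abbrev RedTensor : Type u := TensorCarrier A ((redFunctor A R).obj L) (kerModuleS R)

/-- The class of `(l ⊗ 1) ⊗ x` in `(L ⊗_R S) ⊗_S n`. -/
noncomputable def redTmk : L →ₗ[k] augKer R →ₗ[k] RedTensor A R L :=
  LinearMap.comp (M₂ := (redFunctor A R).obj L)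
    (tmk A ((redFunctor A R).obj L) (kerModuleS R)) (redOne (tAlg A R) L)

theorem redTmk_balanced (hn : SquareZero R) {i j : ℤ} {r : R.toDGAlg} {x : augKer R}
    (hr : r ∈ R.gr i) (hx : x ∈ (kerModule R).gr j) (l : L) :
    redTmk A R L (op ((tAlg A R).unit r) • l) x
      = (-1 : k) ^ (i * j) • redTmk A R L l (show (kerModule R).carrier from
        op r • (show (kerModule R).carrier from x)) := by
  have h1 : redOne (tAlg A R) L (op ((tAlg A R).unit r) • l)
      = redOne (tAlg A R) L (op (inA A R (A.unit (R.aug r))) • l) := by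
    rw [inA_unit]
    refine (redOne_unit _ L l r).trans ((redOne_unit _ L l (R.unit (R.aug r))).trans ?_).symm
    rw [R.aug_unit]
  have h2 : redOne (tAlg A R) L (op ((tAlg A R).unit r) • l)
      = tensorAct (tAlg A R) L (augModule R) (redOne (tAlg A R) L l)
        (inA A R (A.unit (R.aug r))) := by
    rw [h1, redOne_act]
  have h3 := tmk_balanced A ((redFunctor A R).obj L) (kerModuleS R) (R.aug.map_mem hr) hx
    (redOne (tAlg A R) L l)
  refine Eq.trans (congrArg (fun t => tmk A ((redFunctor A R).obj L) (kerModuleS R) t x) h2) ?_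
  refine h3.trans ?_
  refine congrArg (fun y => (-1 : k) ^ (i * j) • redTmk A R L l y) ?_
  refine Subtype.ext ?_
  change x.1 * R.unit (R.aug r) = x.1 * r
  rw [← sub_eq_zero, ← mul_sub]
  refine hn _ x.2 _ ?_
  rw [mem_augKer, map_sub, R.aug_unit, sub_self]

/-- The map `l ⊗ x ↦ (l ⊗ 1) ⊗ x` from `L ⊗_R n` to `(L ⊗_R S) ⊗_S n`; it is well defined since
`n² = 0`. -/
noncomputable def thetaAux (hn : SquareZero R) :
    TensorCarrier (tAlg A R) L (kerModule R) →ₗ[k] RedTensor A R L :=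
  tlift (E := tAlg A R) (M := L) (N := kerModule R) (redTmk A R L)
    (fun _ _ _ _ _ l hr hx _ => redTmk_balanced A R L hn hr hx l)

theorem thetaAux_tmk (hn : SquareZero R) (l : L) (x : augKer R) :
    thetaAux A R L hn (tmk (tAlg A R) L (kerModule R) l x) = redTmk A R L l x := rfl

/-- The canonical morphism `L ⊗_R n ⟶ (L ⊗_R S) ⊗_S n` of dg `A`-modules. -/
noncomputable def theta (hn : SquareZero R) :
    (resA A R).obj (tensorObj (tAlg A R) L (kerModule R)) ⟶
      tensorObj A ((redFunctor A R).obj L) (kerModuleS R) where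
  toLin :=
    { toFun := thetaAux A R L hn
      map_add' := fun x y => LinearMap.map_add (thetaAux A R L hn) x y
      map_smul' := fun e t => by
        change thetaAux A R L hn (tensorAct (tAlg A R) L (kerModule R) t (inA A R e.unop))
          = tensorAct A ((redFunctor A R).obj L) (kerModuleS R) (thetaAux A R L hn t) e.unop
        refine graded_induction A.isInternal (p := fun a =>
          thetaAux A R L hn (tensorAct (tAlg A R) L (kerModule R) t (inA A R a))
          = tensorAct A ((redFunctor A R).obj L) (kerModuleS R) (thetaAux A R L hn t) a)
          ?_ ?_ e.unop
        · intro i a ha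
          refine tensor_induction (p := fun t =>
            thetaAux A R L hn (tensorAct (tAlg A R) L (kerModule R) t (inA A R a))
            = tensorAct A ((redFunctor A R).obj L) (kerModuleS R) (thetaAux A R L hn t) a)
            ?_ ?_ t
          · intro p q l x hl hx
            rw [tensorAct_tmk (tAlg A R) L (kerModule R) ((inA A R).map_mem ha) hx, map_smul]
            refine Eq.trans ?_ (tensorAct_tmk A ((redFunctor A R).obj L) (kerModuleS R) ha hx
              (redOne (tAlg A R) L l)).symm
            refine congrArg (fun y => (-1 : k) ^ (i * q) • y) ?_
            exact congrArg (fun t => tmk A ((redFunctor A R).obj L) (kerModuleS R) t x)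
              (redOne_act (tAlg A R) L l (inA A R a)).symm
          · intro x y hx hy
            rw [map_add, LinearMap.add_apply, map_add, hx, hy, map_add, map_add,
              LinearMap.add_apply]
        · intro a b ha hb
          rw [map_add, map_add, map_add, ha, hb, map_add] }
  map_mem := fun {i t} ht => by
    refine tensorGr_map (f := thetaAux A R L hn) ?_ ht
    rintro p q l x rfl hl hx
    exact tmk_mem (E := A) (M := (redFunctor A R).obj L) (N := kerModuleS R)
      (redOne_mem (tAlg A R) L hl) hx
  map_d := fun t => by
    refine tensor_induction (p := fun t =>
      thetaAux A R L hn (tensorD (tAlg A R) L (kerModule R) t)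
        = tensorD A ((redFunctor A R).obj L) (kerModuleS R) (thetaAux A R L hn t)) ?_ ?_ t
    · intro p q l x hl hx
      rw [tensorD_tmk (tAlg A R) L (kerModule R) hl, map_add, map_smul]
      refine Eq.trans ?_ (tensorD_tmk A ((redFunctor A R).obj L) (kerModuleS R)
        (redOne_mem (tAlg A R) L hl) x).symm
      refine congrArg₂ (fun a b => a + b) ?_ rfl
      exact congrArg (fun t => tmk A ((redFunctor A R).obj L) (kerModuleS R) t x)
        (redOne_d (tAlg A R) L l)
    · intro x y hx hy
      simp only [map_add, hx, hy]

/-- The cone of `L ⊗_R n ⟶ L`, as a dg `A`-module. -/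
noncomputable abbrev charCone : DGModule A.toDGAlg :=
  DGModule.cone ((resA A R).map (kerIncl (tAlg A R) L))

/-- The morphism from the cone of `L ⊗_R n ⟶ L` to `L ⊗_R S` induced by `L ⟶ L ⊗_R S`. -/
noncomputable def charRed : charCone A R L ⟶ (redFunctor A R).obj L :=
  coneDesc ((resA A R).map (kerIncl (tAlg A R) L)) ((resA A R).map (redProj (tAlg A R) L))
    (redProj_kerIncl (tAlg A R) L)

/-- The composition of the morphism from the cone to `(L ⊗_R n)[1]` with the canonical morphism to
`((L ⊗_R S) ⊗_S n)[1]`. -/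
noncomputable def charBoundary (hn : SquareZero R) : charCone A R L ⟶
    DGModule.shift.obj (tensorObj A ((redFunctor A R).obj L) (kerModuleS R)) :=
  coneδ ((resA A R).map (kerIncl (tAlg A R) L)) ≫ DGModule.shift.map (theta A R L hn)

variable {A R} in
/-- `c` is the characteristic class `ε(L, u)` of the deformation `(L, u)`: it makes the square
`u ≫ c = ε' ≫ (u ⊗_S n)[1]` commute, where `ε' : L ⊗_R S ⟶ ((L ⊗_R S) ⊗_S n)[1]` is the
connecting morphism of the exact sequence `0 ⟶ L ⊗_R n ⟶ L ⟶ L ⊗_R S ⟶ 0` of dg `A`-modules,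
namely the composition of the inverse of `charRed` with `charBoundary` in the relative derived
category. -/
def IsCharClass (hn : SquareZero R) {M : DGModule A.toDGAlg} (D : Deformation A R M)
    (c : (relQ A).obj M ⟶ (tensorShift A (kerModuleS R)).obj ((relQ A).obj M)) : Prop :=
  ∃ ε' : (reduction A R).obj ((relQ (tAlg A R)).obj D.L) ⟶
      (tensorShift A (kerModuleS R)).obj
        ((reduction A R).obj ((relQ (tAlg A R)).obj D.L)),
    (relQ A).map (charRed A R D.L) ≫ ε' = (relQ A).map (charBoundary A R D.L hn) ∧
    D.u.hom ≫ c = ε' ≫ (tensorShift A (kerModuleS R)).map D.u.hom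

end CharacteristicClass

end DG

/-! Up to resolution, a deformation is a twisted differential. If `L` is graded free over `A ⊗_S R`,
its projection to `L ⊗_R S` has a graded `A`-linear section `σ`. The commutator `dσ - σd` takes
values in the kernel `L n`, which is `(L ⊗_R S) ⊗_S n` because `n² = 0`. It is a closed map of
degree 1 and represents the connecting morphism (`map_connecting`, `exists_map_connecting`).
Conversely, a morphism `f : P ⟶ (P ⊗_S n)[1]` can be added to the differential of `P ⊗_S R`: the new
differential squares to zero because `f` is closed and `n² = 0` (`twisted`). The reduction of the
result is `P`, and its connecting morphism is `f` (`twistedUnit_connecting`).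

To work with morphisms of dg modules instead of morphisms of a localization, one uses relatively
projective modules, those `P` for which graded maps into any `S`-contractible module form an acyclic
complex. Cones of relative quasi-isomorphisms are `S`-contractible, so morphisms from `P` in the
relative derived category are homotopy classes of morphisms of dg modules (`IsRelProj.exists_rep`,
`IsRelProj.homotopic_of_eq`). The bar construction resolves every dg module by a relatively
projective one. Freeness of `A` and of the module over the base makes the resolution graded free
both over the algebra and over the base (`exists_resolution`), and reduction preserves relative
projectivity (`isRelProj_red`).

Surjectivity: resolve `M` by `P`, represent the given class by some `f` and twist `P ⊗_S R` by it
(`exists_charClass_eq`).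

Injectivity: equality of the classes of `(L, u)` and `(L', u')` means that `u'⁻¹ ∘ u` commutes with
the connecting morphisms. After resolution it is represented by some `φ`, which has a graded lift
`w`. The commutator of `w` with the differentials is the difference of the two cocycles, hence the
boundary of some `h`, and correcting `w` by `h` gives a morphism of dg modules lifting `φ`
(`exists_lift_of_connecting`). The lifts of an isomorphism and of its inverse need not be mutually
inverse, but their composites reduce to identities. Up to homotopy such a composite is `1 + ν` with
`ν² = 0`, hence invertible (`isIso_of_red_eq_id`).

Invariance of the class is naturality of the connecting morphism for all morphisms of the relative
derived category (`conn_naturality`), which follows from naturality for morphisms of dg modules by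
resolving the source. -/

namespace DG

variable {k : Type u} [Field k]

/-! Homogeneous linear maps between dg modules. -/

section LinDeg

variable {E : DGAlg k} {M N P : DGModule E}

/-- The linear map `f` is homogeneous of degree `q`. -/
def LinDeg (f : M →ₗ[E.carrierᵐᵒᵖ] N) (q : ℤ) : Prop :=
  ∀ (i : ℤ) (m : M), m ∈ M.gr i → f m ∈ N.gr (i + q)

theorem lin_smul (f : M →ₗ[E.carrierᵐᵒᵖ] N) (c : k) (m : M) : f (c • m) = c • f m :=
  f.map_smul_of_tower c m

theorem DGModule.Hom.linDeg (f : M ⟶ N) : LinDeg f.toLin 0 := fun i m hm => by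
  rw [add_zero]; exact f.map_mem hm

theorem LinDeg.comp {f : M →ₗ[E.carrierᵐᵒᵖ] N} {g : N →ₗ[E.carrierᵐᵒᵖ] P} {p q r : ℤ}
    (hg : LinDeg g q) (hf : LinDeg f p) (h : p + q = r) : LinDeg (g ∘ₗ f) r := fun i m hm => by
  have := hg _ _ (hf i m hm)
  rwa [add_assoc, h] at this

theorem LinDeg.add {f g : M →ₗ[E.carrierᵐᵒᵖ] N} {q : ℤ} (hf : LinDeg f q) (hg : LinDeg g q) :
    LinDeg (f + g) q := fun i m hm => add_mem (hf i m hm) (hg i m hm)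

theorem LinDeg.sub {f g : M →ₗ[E.carrierᵐᵒᵖ] N} {q : ℤ} (hf : LinDeg f q) (hg : LinDeg g q) :
    LinDeg (f - g) q := fun i m hm => sub_mem (hf i m hm) (hg i m hm)

/-- The morphism of dg modules given by a linear map of degree `0` commuting with the
differentials. -/
def homOf (f : M →ₗ[E.carrierᵐᵒᵖ] N) (h0 : LinDeg f 0) (hd : ∀ m, f (M.d m) = N.d (f m)) :
    M ⟶ N where
  toLin := f
  map_mem := fun {i m} hm => by
    have := h0 i m hm
    rwa [add_zero] at this
  map_d := hd

@[simp] theorem homOf_toLin (f : M →ₗ[E.carrierᵐᵒᵖ] N) (h0 hd) : (homOf f h0 hd).toLin = f := rfl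

/-- The graded commutator of a linear map of degree `q` with the differentials. -/
def hd (f : M →ₗ[E.carrierᵐᵒᵖ] N) {q : ℤ} (hf : LinDeg f q) : M →ₗ[E.carrierᵐᵒᵖ] N where
  toFun m := N.d (f m) - (-1 : k) ^ q • f (M.d m)
  map_add' x y := by
    simp only [map_add, smul_add]; abel
  map_smul' e m := by
    induction e using MulOpposite.rec' with | _ e => ?_
    refine graded_induction M.isInternal (p := fun m =>
      N.d (f (op e • m)) - (-1 : k) ^ q • f (M.d (op e • m))
        = op e • (N.d (f m) - (-1 : k) ^ q • f (M.d m))) ?_ ?_ m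
    · intro i m hm
      -- The two terms containing `d e` carry the signs `(-1)^(i+q)` and `(-1)^q (-1)^i`, so they
      -- cancel; this is why the commutator is linear.
      rw [f.map_smul, N.d_smul (hf i m hm), M.d_smul hm, map_add, lin_smul, f.map_smul,
        f.map_smul, smul_sub, smul_add, smul_smul, sign_mul, add_comm q i,
        smul_comm (op e) ((-1 : k) ^ q)]
      abel
    · intro a b ha hb
      simp only [smul_add, map_add]
      rw [add_sub_add_comm, ha, hb]
      simp only [smul_sub, smul_add]
      abel

theorem hd_apply (f : M →ₗ[E.carrierᵐᵒᵖ] N) {q : ℤ} (hf : LinDeg f q) (m : M) :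
    hd f hf m = N.d (f m) - (-1 : k) ^ q • f (M.d m) := rfl

theorem hd_apply_zero (f : M →ₗ[E.carrierᵐᵒᵖ] N) (hf : LinDeg f 0) (m : M) :
    hd f hf m = N.d (f m) - f (M.d m) := by
  rw [hd_apply, zpow_zero, one_smul]

theorem hd_apply_neg_one (f : M →ₗ[E.carrierᵐᵒᵖ] N) (hf : LinDeg f (-1)) (m : M) :
    hd f hf m = N.d (f m) + f (M.d m) := by
  rw [hd_apply]; simp

theorem linDeg_hd (f : M →ₗ[E.carrierᵐᵒᵖ] N) {q r : ℤ} (hf : LinDeg f q) (h : q + 1 = r) :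
    LinDeg (hd f hf) r := fun i m hm => by
  subst h
  refine sub_mem ?_ (Submodule.smul_mem _ _ ?_)
  · rw [← add_assoc]; exact N.d_mem (hf i m hm)
  · rw [add_comm q, ← add_assoc]; exact hf _ _ (M.d_mem hm)

theorem LinDeg.map_proj {f : M →ₗ[E.carrierᵐᵒᵖ] N} {q : ℤ} (hf : LinDeg f q) (j : ℤ) (m : M) :
    f (proj M.isInternal j m) = proj N.isInternal (j + q) (f m) := by
  refine graded_induction M.isInternal
    (p := fun m => f (proj M.isInternal j m) = proj N.isInternal (j + q) (f m)) ?_ ?_ m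
  · intro i m hm
    by_cases h : i = j
    · subst h
      rw [proj_of_mem _ hm, proj_of_mem _ (hf i m hm)]
    · rw [proj_of_mem_ne _ h hm, proj_of_mem_ne _ (by omega) (hf i m hm), map_zero]
  · intro a b ha hb
    simp only [map_add, ha, hb]

theorem DGModule.Hom.map_proj (f : M ⟶ N) (j : ℤ) (m : M) :
    f.toLin (proj M.isInternal j m) = proj N.isInternal j (f.toLin m) := by
  have := f.linDeg.map_proj j m
  rwa [add_zero] at this

theorem basis_induction {ι : Type u} (b : Module.Basis ι E.carrierᵐᵒᵖ M) {p : M → Prop}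
    (zero : p 0) (add : ∀ x y, p x → p y → p (x + y))
    (hom : ∀ (i : ι) (j : ℤ) (e : E), e ∈ E.gr j → p (op e • b i)) (m : M) : p m := by
  have hm : m ∈ Submodule.span E.carrierᵐᵒᵖ (Set.range b) := by rw [b.span_eq]; trivial
  -- Stability of `p` under the action is not assumed, so all multiples of `m` are treated at once.
  have key := Submodule.span_induction (p := fun m _ => ∀ e : E, p (op e • m)) ?_ ?_ ?_ ?_ hm
  · simpa using key 1
  · rintro _ ⟨i, rfl⟩ e
    refine graded_induction E.isInternal (p := fun e => p (op e • b i)) ?_ ?_ e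
    · intro j e he; exact hom i j e he
    · intro x y hx hy; rw [MulOpposite.op_add, add_smul]; exact add _ _ hx hy
  · intro e; rwa [smul_zero]
  · intro x y _ _ hx hy e; rw [smul_add]; exact add _ _ (hx e) (hy e)
  · intro a x _ hx e
    induction a using MulOpposite.rec' with | _ a => ?_
    rw [← mul_smul, ← op_mul]; exact hx _

/-- Commutation with the projections is additive in `m`, so in this form homogeneity can be checked
on generators. -/
theorem linDeg_of_map_proj {f : M →ₗ[E.carrierᵐᵒᵖ] N} {q : ℤ}
    (h : ∀ j m, f (proj M.isInternal j m) = proj N.isInternal (j + q) (f m)) : LinDeg f q :=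
  fun j m hm => by
    rw [← proj_of_mem M.isInternal hm, h]
    exact proj_mem _ _ _

theorem linDeg_of_basis {ι : Type u} (b : Module.Basis ι E.carrierᵐᵒᵖ M) {p : ι → ℤ}
    (hb : ∀ i, b i ∈ M.gr (p i)) (f : M →ₗ[E.carrierᵐᵒᵖ] N) {q : ℤ}
    (hf : ∀ i, f (b i) ∈ N.gr (p i + q)) : LinDeg f q := by
  refine linDeg_of_map_proj fun j m => ?_
  refine basis_induction b
    (p := fun m => f (proj M.isInternal j m) = proj N.isInternal (j + q) (f m))
    (by simp) (fun x y hx hy => by simp only [map_add, hx, hy]) ?_ m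
  intro i t e he
  have h1 := M.smul_mem (hb i) he
  have h2 := N.smul_mem (hf i) he
  rw [f.map_smul]
  by_cases h : p i + t = j
  · rw [proj_of_mem _ (by rwa [← h]), proj_of_mem N.isInternal (n := j + q), f.map_smul]
    rwa [show j + q = p i + q + t by omega]
  · rw [proj_of_mem_ne _ h h1, proj_of_mem_ne _ (by omega) h2, map_zero]

/-- Homogeneous linear maps from a graded free module lift along surjective morphisms. -/
theorem exists_lift (hM : M.IsGradedFree) (π : N ⟶ P) (hπ : Function.Surjective π.toLin)
    (φ : M →ₗ[E.carrierᵐᵒᵖ] P) {q : ℤ} (hφ : LinDeg φ q) :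
    ∃ w : M →ₗ[E.carrierᵐᵒᵖ] N, LinDeg w q ∧ ∀ m, π.toLin (w m) = φ m := by
  obtain ⟨ι, b, hb⟩ := hM
  choose p hp using hb
  have h1 : ∀ i, ∃ n ∈ N.gr (p i + q), π.toLin n = φ (b i) := fun i => by
    obtain ⟨n, hn⟩ := hπ (φ (b i))
    -- An arbitrary preimage of `φ (b i)` need not be homogeneous, but its component of the right
    -- degree is again a preimage.
    refine ⟨proj N.isInternal (p i + q) n, proj_mem _ _ _, ?_⟩
    rw [π.map_proj, hn, proj_of_mem _ (hφ _ _ (hp i))]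
  choose n hn hn' using h1
  refine ⟨b.constr ℕ n, linDeg_of_basis b hp _ (fun i => by rw [b.constr_basis]; exact hn i), ?_⟩
  have : π.toLin ∘ₗ b.constr ℕ n = φ := b.ext fun i => by
    rw [LinearMap.comp_apply, b.constr_basis, hn']
  exact fun m => LinearMap.congr_fun this m

theorem mem_gr_of_injective (j : N ⟶ P) (hj : Function.Injective j.toLin) {i : ℤ} {n : N}
    (h : j.toLin n ∈ P.gr i) : n ∈ N.gr i := by
  have : proj N.isInternal i n = n := hj (by rw [j.map_proj, proj_of_mem _ h])
  rw [← this]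
  exact proj_mem _ _ _

/-- Homogeneous linear maps with values in the image of an injective morphism factor. -/
theorem exists_factor (j : N ⟶ P) (hj : Function.Injective j.toLin)
    (δ : M →ₗ[E.carrierᵐᵒᵖ] P) {q : ℤ} (hδ : LinDeg δ q) (hr : ∀ m, ∃ n, j.toLin n = δ m) :
    ∃ δ' : M →ₗ[E.carrierᵐᵒᵖ] N, LinDeg δ' q ∧ ∀ m, j.toLin (δ' m) = δ m := by
  choose g hg using hr
  refine ⟨⟨⟨g, fun x y => hj ?_⟩, fun e x => hj ?_⟩, fun i m hm => ?_, hg⟩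
  · rw [map_add, hg, hg, hg, map_add]
  · change j.toLin (g (e • x)) = j.toLin (e • g x)
    rw [map_smul, hg, hg, map_smul]
  · refine mem_gr_of_injective j hj ?_
    change j.toLin (g m) ∈ _
    rw [hg]; exact hδ i m hm

/-- Homogeneous linear maps vanishing on the kernel of a surjective morphism factor. -/
theorem exists_descend (π : M ⟶ N) (hπ : Function.Surjective π.toLin)
    (ψ : M →ₗ[E.carrierᵐᵒᵖ] P) {q : ℤ} (hψ : LinDeg ψ q) (hk : ∀ m, π.toLin m = 0 → ψ m = 0) :
    ∃ ψ' : N →ₗ[E.carrierᵐᵒᵖ] P, LinDeg ψ' q ∧ ∀ m, ψ' (π.toLin m) = ψ m := by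
  have hk' : ∀ m m', π.toLin m = π.toLin m' → ψ m = ψ m' := fun m m' h => by
    rw [← sub_eq_zero, ← map_sub]
    exact hk _ (by rw [map_sub, h, sub_self])
  have hs := Function.surjInv_eq hπ
  refine ⟨⟨⟨fun n => ψ (Function.surjInv hπ n), fun x y => ?_⟩, fun e x => ?_⟩,
    fun i n hn => ?_, fun m => hk' _ _ (hs _)⟩
  · rw [← map_add]; exact hk' _ _ (by rw [map_add, hs, hs, hs])
  · change ψ (Function.surjInv hπ (e • x)) = e • ψ (Function.surjInv hπ x)
    rw [← map_smul]; exact hk' _ _ (by rw [map_smul, hs, hs])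
  · change ψ (Function.surjInv hπ n) ∈ _
    -- The chosen preimage is replaced by its component of degree `i`, on which `ψ` takes the same
    -- value.
    rw [hk' _ (proj M.isInternal i (Function.surjInv hπ n))
      (by rw [π.map_proj, hs, proj_of_mem _ hn])]
    exact hψ _ _ (proj_mem _ _ _)

theorem exists_inverse (f : M ⟶ N) (hf : Function.Bijective f.toLin) :
    ∃ g : N ⟶ M, f ≫ g = 𝟙 M ∧ g ≫ f = 𝟙 N := by
  obtain ⟨g, hg, hg'⟩ := exists_factor f hf.1 (M := N) LinearMap.id (q := 0)
    (fun i m hm => by rw [add_zero]; exact hm) hf.2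
  refine ⟨homOf g hg fun n => hf.1 ?_, ?_, ?_⟩
  · rw [hg', f.map_d, hg']; rfl
  · ext m
    exact hf.1 (hg' (f.toLin m))
  · ext n
    exact hg' n

end LinDeg

/-! Homotopies. -/

section Homotopy

variable {E : DGAlg k} {M N P : DGModule E}

theorem homotopic_refl (f : M ⟶ N) : DGModule.Homotopic f f :=
  ⟨0, fun _ _ _ => zero_mem _, fun m => by simp⟩

theorem homotopic_symm {f g : M ⟶ N} (h : DGModule.Homotopic f g) : DGModule.Homotopic g f := by
  obtain ⟨h, hh, H⟩ := h
  refine ⟨-h, fun i m hm => neg_mem (hh i m hm), fun m => ?_⟩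
  rw [← neg_sub, H]
  simp only [LinearMap.neg_apply, map_neg]
  abel

theorem homotopic_trans {f g e : M ⟶ N} (h : DGModule.Homotopic f g)
    (h' : DGModule.Homotopic g e) : DGModule.Homotopic f e := by
  obtain ⟨h, hh, H⟩ := h
  obtain ⟨h', hh', H'⟩ := h'
  refine ⟨h + h', fun i m hm => add_mem (hh i m hm) (hh' i m hm), fun m => ?_⟩
  rw [← sub_add_sub_cancel _ (g.toLin m), H, H']
  simp only [LinearMap.add_apply, map_add]
  abel

theorem homotopic_comp {f g : M ⟶ N} (h : DGModule.Homotopic f g) (e : N ⟶ P) :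
    DGModule.Homotopic (f ≫ e) (g ≫ e) := by
  obtain ⟨h, hh, H⟩ := h
  refine ⟨e.toLin ∘ₗ h, fun i m hm => e.map_mem (hh i m hm), fun m => ?_⟩
  simp only [DGModule.comp_toLin, LinearMap.comp_apply]
  rw [← map_sub, H, map_add, e.map_d]

theorem homotopic_res {B : DGAlg k} (φ : DGAlg.Hom B E) {f g : M ⟶ N}
    (h : DGModule.Homotopic f g) :
    DGModule.Homotopic ((DGModule.res φ).map f) ((DGModule.res φ).map g) := by
  obtain ⟨h, hh, H⟩ := h
  exact ⟨⟨⟨h, h.map_add⟩, fun b m => h.map_smul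
    ((φ.toAlgHom.toRingHom.op : B.carrierᵐᵒᵖ →+* E.carrierᵐᵒᵖ) b) m⟩, hh, H⟩

theorem relQis_of_isHomotopyEquiv {S : CDGAlg k} (E : DGAlgebra S) {M N : DGModule E.toDGAlg}
    {f : M ⟶ N} (hf : DGModule.IsHomotopyEquiv f) : relQis E f := by
  obtain ⟨g, h, h'⟩ := hf
  exact ⟨(DGModule.res E.unit).map g, homotopic_res E.unit h, homotopic_res E.unit h'⟩

/-! ### Cylinders, and homotopic morphisms in the localization -/

/-- The direct sum of two dg modules. -/
def DGModule.prod (X Y : DGModule E) : DGModule E where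
  carrier := X.carrier × Y.carrier
  isScalarTower := ⟨fun a b m => by ext <;> simp⟩
  gr := fun p => (X.gr p).prod (Y.gr p)
  isInternal := by
    refine isInternal_of_proj _
      (fun n => (proj X.isInternal n).prodMap (proj Y.isInternal n)) ?_ ?_ ?_
    · rintro i ⟨x, y⟩ ⟨hx, hy⟩
      simp only [LinearMap.prodMap_apply]
      rw [proj_of_mem X.isInternal hx, proj_of_mem Y.isInternal hy]
    · rintro i j hj ⟨x, y⟩ ⟨hx, hy⟩
      simp only [LinearMap.prodMap_apply]
      rw [proj_of_mem_ne X.isInternal hj hx, proj_of_mem_ne Y.isInternal hj hy]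
      rfl
    · rintro ⟨x, y⟩
      have hx : ((x, 0) : X.carrier × Y.carrier) ∈ ⨆ p, (X.gr p).prod (Y.gr p) := by
        refine graded_induction X.isInternal
          (p := fun x => ((x, 0) : X.carrier × Y.carrier) ∈ ⨆ p, (X.gr p).prod (Y.gr p))
          ?_ ?_ x
        · intro i x hx
          exact Submodule.mem_iSup_of_mem i ⟨hx, zero_mem _⟩
        · intro a b ha hb
          simpa using add_mem ha hb
      have hy : ((0, y) : X.carrier × Y.carrier) ∈ ⨆ p, (X.gr p).prod (Y.gr p) := by
        refine graded_induction Y.isInternal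
          (p := fun y => ((0, y) : X.carrier × Y.carrier) ∈ ⨆ p, (X.gr p).prod (Y.gr p))
          ?_ ?_ y
        · intro i y hy
          exact Submodule.mem_iSup_of_mem i ⟨zero_mem _, hy⟩
        · intro a b ha hb
          simpa using add_mem ha hb
      simpa using add_mem hx hy
  smul_mem := by
    rintro i j ⟨x, y⟩ a ⟨hx, hy⟩ ha
    exact ⟨X.smul_mem hx ha, Y.smul_mem hy ha⟩
  d := X.d.prodMap Y.d
  d_mem := by
    rintro i ⟨x, y⟩ ⟨hx, hy⟩
    exact ⟨X.d_mem hx, Y.d_mem hy⟩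
  d_d := by
    rintro ⟨x, y⟩
    exact Prod.ext (X.d_d x) (Y.d_d y)
  d_smul := by
    rintro i ⟨x, y⟩ ⟨hx, hy⟩ a
    exact Prod.ext (X.d_smul hx a) (Y.d_smul hy a)

/-- The antidiagonal `m ↦ (m, -m)`. -/
def antidiag (M : DGModule E) : M ⟶ M.prod M where
  toLin := LinearMap.prod LinearMap.id (-LinearMap.id)
  map_mem := fun hm => ⟨hm, neg_mem hm⟩
  map_d := fun m => Prod.ext rfl (map_neg M.d m).symm

/-- The cylinder of a dg module. -/
abbrev cylinder (M : DGModule E) : DGModule E := DGModule.cone (antidiag M)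

/-- The sum `(a, b) ↦ a + b`. -/
def prodSum (M : DGModule E) : M.prod M ⟶ M where
  toLin := LinearMap.coprod LinearMap.id LinearMap.id
  map_mem := fun hm => add_mem hm.1 hm.2
  map_d := by
    rintro ⟨a, b⟩
    exact (map_add M.d a b).symm

/-- The projection of the cylinder. -/
def cylProj (M : DGModule E) : cylinder M ⟶ M :=
  coneDesc (antidiag M) (prodSum M) fun x => add_neg_cancel x

/-- The first inclusion in the cylinder. -/
def cylFst (M : DGModule E) : M ⟶ cylinder M where
  toLin := LinearMap.prod 0 (LinearMap.prod LinearMap.id 0)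
  map_mem := fun hm => ⟨zero_mem _, hm, zero_mem _⟩
  map_d := fun m => Prod.ext (by change (0 : M) = -M.d 0; simp)
    (Prod.ext (by change M.d m = 0 + M.d m; simp) (by change (0 : M) = -0 + M.d 0; simp))

/-- The second inclusion in the cylinder. -/
def cylSnd (M : DGModule E) : M ⟶ cylinder M where
  toLin := LinearMap.prod 0 (LinearMap.prod 0 LinearMap.id)
  map_mem := fun hm => ⟨zero_mem _, zero_mem _, hm⟩
  map_d := fun m => Prod.ext (by change (0 : M) = -M.d 0; simp)
    (Prod.ext (by change (0 : M) = 0 + M.d 0; simp) (by change M.d m = -0 + M.d m; simp))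

/-- The first inclusion is a strict section, and the homotopy `(x, a, b) ↦ (b, 0, 0)` moves the
second end of the cylinder to the first. -/
theorem cylProj_isHomotopyEquiv (M : DGModule E) : DGModule.IsHomotopyEquiv (cylProj M) := by
  refine ⟨cylFst M, ⟨LinearMap.prod ((LinearMap.snd _ M.carrier M.carrier) ∘ₗ
    (LinearMap.snd _ M.carrier (M.carrier × M.carrier))) 0, ?_, ?_⟩, ?_⟩
  · rintro i ⟨x, a, b⟩ ⟨hx, ha, hb⟩
    refine ⟨?_, zero_mem _, zero_mem _⟩
    change b ∈ M.gr (i - 1 + 1)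
    rwa [sub_add_cancel]
  · rintro ⟨x, a, b⟩
    refine Prod.ext ?_ (Prod.ext ?_ ?_)
    · change (0 : M) - x = -M.d b + (-x + M.d b)
      abel
    · change (a + b) - a = (b + M.d 0) + (0 : M)
      rw [map_zero]; abel
    · change (0 : M) - b = (-b + M.d 0) + (0 : M)
      rw [map_zero]; abel
  · refine ⟨0, fun _ _ _ => zero_mem _, fun m => ?_⟩
    change (m + 0) - m = M.d 0 + 0
    simp

/-- Homotopic morphisms become equal in the relative derived category. -/
theorem relQ_map_eq_of_homotopic {S : CDGAlg k} (E : DGAlgebra S) {M N : DGModule E.toDGAlg}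
    {f g : M ⟶ N} (H : DGModule.Homotopic f g) : (relQ E).map f = (relQ E).map g := by
  obtain ⟨h, hh, H⟩ := H
  -- A homotopy from `g` to `f` is the same as a morphism from the cylinder whose restrictions to
  -- the ends are `f` and `g`.
  let Φ : cylinder M ⟶ N :=
    { toLin := LinearMap.coprod h (LinearMap.coprod f.toLin g.toLin)
      map_mem := by
        rintro i ⟨x, a, b⟩ ⟨hx, ha, hb⟩
        refine add_mem ?_ (add_mem (f.map_mem ha) (g.map_mem hb))
        have := hh _ _ hx
        rwa [add_sub_cancel_right] at this
      map_d := by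
        rintro ⟨x, a, b⟩
        change h (-M.d x) + (f.toLin (x + M.d a) + g.toLin (-x + M.d b))
          = N.d (h x + (f.toLin a + g.toLin b))
        have e := H x
        rw [sub_eq_iff_eq_add] at e
        simp only [map_add, map_neg, f.map_d, g.map_d, e]
        abel }
  have hf : cylFst M ≫ Φ = f := by
    ext m
    change h 0 + (f.toLin m + g.toLin 0) = f.toLin m
    simp
  have hg : cylSnd M ≫ Φ = g := by
    ext m
    change h 0 + (f.toLin 0 + g.toLin m) = g.toLin m
    simp
  have h1 : cylFst M ≫ cylProj M = 𝟙 M := by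
    ext m
    change m + 0 = m
    simp
  have h2 : cylSnd M ≫ cylProj M = 𝟙 M := by
    ext m
    change 0 + m = m
    simp
  have hp : IsIso ((relQ E).map (cylProj M)) :=
    (relQis E).Q_inverts _ (relQis_of_isHomotopyEquiv E (cylProj_isHomotopyEquiv M))
  -- Both inclusions are sections of the projection, which becomes invertible, so they become equal.
  have key : (relQ E).map (cylFst M) = (relQ E).map (cylSnd M) := by
    rw [← cancel_mono ((relQ E).map (cylProj M)), ← Functor.map_comp, ← Functor.map_comp, h1, h2]
  rw [← hf, ← hg, Functor.map_comp, Functor.map_comp, key]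

end Homotopy

/-! Relatively projective dg modules. -/

section RelProj

variable {S : CDGAlg k} (E : DGAlgebra S)

/-- A dg `E`-module is relatively contractible if its restriction to `S` is contractible. -/
def IsRelContr (N : DGModule E.toDGAlg) : Prop :=
  ∃ c : N →ₗ[k] N, (∀ (s : S.toDGAlg) (m : N), c (op (E.unit s) • m) = op (E.unit s) • c m) ∧
    (∀ (i : ℤ) (m : N), m ∈ N.gr i → c m ∈ N.gr (i - 1)) ∧ ∀ m, N.d (c m) + c (N.d m) = m

/-- A dg `E`-module is relatively projective if the graded space of linear maps to every relatively
contractible dg module is acyclic. -/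
def IsRelProj (P : DGModule E.toDGAlg) : Prop :=
  ∀ N : DGModule E.toDGAlg, IsRelContr E N → ∀ (q : ℤ) (φ : P →ₗ[E.toDGAlg.carrierᵐᵒᵖ] N)
    (hφ : LinDeg φ q), (∀ x, hd φ hφ x = 0) →
    ∃ (ψ : P →ₗ[E.toDGAlg.carrierᵐᵒᵖ] N) (hψ : LinDeg ψ (q - 1)), ∀ x, hd ψ hψ x = φ x

variable {E}

/-- The cone of a relative quasi-isomorphism is relatively contractible. -/
theorem isRelContr_cone {X Y : DGModule E.toDGAlg} (f : X ⟶ Y) (hf : relQis E f) :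
    IsRelContr E (DGModule.cone f) := by
  obtain ⟨g, ⟨h, hh, H⟩, ⟨l, hl, K⟩⟩ := hf
  let f' : X.carrier →ₗ[k] Y.carrier := f.toLin.restrictScalars k
  let g' : Y.carrier →ₗ[k] X.carrier := g.toLin.restrictScalars k
  let h' : X.carrier →ₗ[k] X.carrier := h.restrictScalars k
  let l' : Y.carrier →ₗ[k] Y.carrier := l.restrictScalars k
  have fS : ∀ (s : S.toDGAlg) (m : X), f' (op (E.unit s) • m) = op (E.unit s) • f' m :=
    fun s m => f.toLin.map_smul _ m
  have gS : ∀ (s : S.toDGAlg) (m : Y), g' (op (E.unit s) • m) = op (E.unit s) • g' m :=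
    fun s m => g.toLin.map_smul (op s) m
  have hS : ∀ (s : S.toDGAlg) (m : X), h' (op (E.unit s) • m) = op (E.unit s) • h' m :=
    fun s m => h.map_smul (op s) m
  have lS : ∀ (s : S.toDGAlg) (m : Y), l' (op (E.unit s) • m) = op (E.unit s) • l' m :=
    fun s m => l.map_smul (op s) m
  have fd : ∀ m, f' (X.d m) = Y.d (f' m) := f.map_d
  have gd : ∀ m, g' (Y.d m) = X.d (g' m) := g.map_d
  have fg : ∀ {i : ℤ} {m : X}, m ∈ X.gr i → f' m ∈ Y.gr i := f.map_mem
  have gg : ∀ {i : ℤ} {m : Y}, m ∈ Y.gr i → g' m ∈ X.gr i := g.map_mem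
  have hg : ∀ {i : ℤ} {m : X}, m ∈ X.gr i → h' m ∈ X.gr (i - 1) := fun hm => hh _ _ hm
  have lg : ∀ {i : ℤ} {m : Y}, m ∈ Y.gr i → l' m ∈ Y.gr (i - 1) := fun hm => hl _ _ hm
  have H' : ∀ m, g' (f' m) = m + X.d (h' m) + h' (X.d m) := fun m => by
    rw [add_assoc]
    exact sub_eq_iff_eq_add'.1 (H m)
  have K' : ∀ m, f' (g' m) = m + Y.d (l' m) + l' (Y.d m) := fun m => by
    rw [add_assoc]
    exact sub_eq_iff_eq_add'.1 (K m)
  -- The two homotopies of a homotopy equivalence need not be compatible with `f`. The defect `w` is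
  -- a closed map of degree `-1`, as `wd` shows.
  let w : X.carrier →ₗ[k] Y.carrier := f' ∘ₗ h' - l' ∘ₗ f'
  have wS : ∀ (s : S.toDGAlg) (m : X), w (op (E.unit s) • m) = op (E.unit s) • w m := by
    intro s m
    change f' (h' (op (E.unit s) • m)) - l' (f' (op (E.unit s) • m))
      = op (E.unit s) • (f' (h' m) - l' (f' m))
    rw [hS, fS, fS, lS, smul_sub]
  have wg : ∀ {i : ℤ} {m : X}, m ∈ X.gr i → w m ∈ Y.gr (i - 1) :=
    fun hm => sub_mem (fg (hg hm)) (lg (fg hm))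
  have wdef : ∀ m, f' (h' m) = l' (f' m) + w m := fun m =>
    (add_sub_cancel (l' (f' m)) (f' (h' m))).symm
  have wd : ∀ m, w (X.d m) = -Y.d (w m) := by
    intro m
    have e1 := congrArg f' (H' m)
    have e2 := K' (f' m)
    simp only [map_add, fd, wdef] at e1
    rw [e2] at e1
    rw [eq_neg_iff_add_eq_zero]
    have e3 := sub_eq_zero.2 e1
    rw [← neg_eq_zero, ← e3]
    abel
  -- The naive contraction `(x, y) ↦ (h x + g y, -l y)` gives `y + w x` instead of `y` in the second
  -- component. Subtracting `w (h x + g y)` there removes the error.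
  refine ⟨LinearMap.prod (LinearMap.coprod h' g')
    (LinearMap.coprod (-(w ∘ₗ h')) (-(l' + w ∘ₗ g'))), ?_, ?_, ?_⟩
  · rintro s ⟨x, y⟩
    refine Prod.ext ?_ ?_
    · change h' (op (E.unit s) • x) + g' (op (E.unit s) • y) = op (E.unit s) • (h' x + g' y)
      rw [hS, gS, smul_add]
    · change -(w (h' (op (E.unit s) • x))) + -(l' (op (E.unit s) • y) + w (g' (op (E.unit s) • y)))
        = op (E.unit s) • (-(w (h' x)) + -(l' y + w (g' y)))
      rw [hS, wS, gS, wS, lS, smul_add, smul_neg, smul_neg, smul_add]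
  · rintro i ⟨x, y⟩ ⟨hx, hy⟩
    refine ⟨add_mem ?_ ?_, add_mem (neg_mem ?_) (neg_mem (add_mem (lg hy) (wg (gg hy))))⟩
    · have := hg hx
      rwa [show i + 1 - 1 = i - 1 + 1 by ring] at this
    · change g' y ∈ X.gr (i - 1 + 1)
      rw [sub_add_cancel]
      exact gg hy
    · have := wg (hg hx)
      rwa [add_sub_cancel_right] at this
  · rintro ⟨x, y⟩
    refine Prod.ext ?_ ?_
    · change -X.d (h' x + g' y) + (h' (-X.d x) + g' (f' x + Y.d y)) = x
      rw [map_add, map_add, map_neg, H', gd]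
      abel
    · change (f' (h' x + g' y) + Y.d (-(w (h' x)) + -(l' y + w (g' y))))
        + (-(w (h' (-X.d x))) + -(l' (f' x + Y.d y) + w (g' (f' x + Y.d y)))) = y
      simp only [map_add, map_neg, H', K', wdef, gd, wd]
      abel

variable {P N N' : DGModule E.toDGAlg}

/-- The pair `(0, g)` is a closed map of degree 0 from `P` to the cone of `f`. In a primitive of it,
the first component is the lift and minus the second is the homotopy. -/
theorem IsRelProj.exists_lift (hP : IsRelProj E P) (f : N ⟶ N') (hf : relQis E f) (g : P ⟶ N') :
    ∃ g' : P ⟶ N, DGModule.Homotopic (g' ≫ f) g := by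
  let φ : P.carrier →ₗ[E.toDGAlg.carrierᵐᵒᵖ] (DGModule.cone f).carrier :=
    LinearMap.prod (0 : P.carrier →ₗ[E.toDGAlg.carrierᵐᵒᵖ] N.carrier) g.toLin
  have hφ : LinDeg (M := P) (N := DGModule.cone f) φ 0 := fun i m hm => by
    rw [add_zero]; exact ⟨zero_mem _, g.map_mem hm⟩
  obtain ⟨ψ, hψ, H⟩ := hP _ (isRelContr_cone f hf) 0 φ hφ fun x => by
    rw [hd_apply_zero]
    refine Prod.ext ?_ ?_
    · change -N.d 0 - 0 = (0 : N.carrier)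
      simp
    · change (f.toLin 0 + N'.d (g.toLin x)) - g.toLin (P.d x) = (0 : N'.carrier)
      rw [map_zero, g.map_d]; abel
  have H' : ∀ x, (DGModule.cone f).d (ψ x) + ψ (P.d x) = φ x := fun x =>
    (hd_apply_neg_one ψ hψ x).symm.trans (H x)
  let ψ₁ : P.carrier →ₗ[E.toDGAlg.carrierᵐᵒᵖ] N.carrier := LinearMap.fst _ _ _ ∘ₗ ψ
  let ψ₂ : P.carrier →ₗ[E.toDGAlg.carrierᵐᵒᵖ] N'.carrier := LinearMap.snd _ _ _ ∘ₗ ψ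
  refine ⟨homOf ψ₁ (fun i m hm => ?_) (fun m => ?_), -ψ₂, fun i m hm => neg_mem (hψ i m hm).2,
    fun m => ?_⟩
  · have := (hψ i m hm).1
    rwa [show i + (0 - 1) + 1 = i + 0 by ring] at this
  · have e : -N.d (ψ₁ m) + ψ₁ (P.d m) = 0 := congrArg Prod.fst (H' m)
    rw [neg_add_eq_zero] at e
    exact e.symm
  · have e : f.toLin (ψ₁ m) + N'.d (ψ₂ m) + ψ₂ (P.d m) = g.toLin m := congrArg Prod.snd (H' m)
    change f.toLin (ψ₁ m) - g.toLin m = N'.d (-ψ₂ m) + -ψ₂ (P.d m)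
    rw [← e, map_neg]
    abel

/-- If `t` is the homotopy after composition with `f`, then `(g - g', -t)` is a closed map of degree
`-1` to the cone. Minus the first component of a primitive is a homotopy before composition. -/
theorem IsRelProj.cancel (hP : IsRelProj E P) (f : N ⟶ N') (hf : relQis E f) (g g' : P ⟶ N)
    (h : DGModule.Homotopic (g ≫ f) (g' ≫ f)) : DGModule.Homotopic g g' := by
  obtain ⟨t, ht, T⟩ := h
  let φ : P.carrier →ₗ[E.toDGAlg.carrierᵐᵒᵖ] (DGModule.cone f).carrier :=
    LinearMap.prod (g.toLin - g'.toLin) (-t)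
  have hφ : LinDeg (M := P) (N := DGModule.cone f) φ (-1) := fun i m hm => by
    refine ⟨?_, neg_mem (ht i m hm)⟩
    change g.toLin m - g'.toLin m ∈ N.gr (i + -1 + 1)
    rw [neg_add_cancel_right]
    exact sub_mem (g.map_mem hm) (g'.map_mem hm)
  obtain ⟨ψ, hψ, H⟩ := hP _ (isRelContr_cone f hf) (-1) φ hφ fun x => by
    rw [hd_apply_neg_one]
    refine Prod.ext ?_ ?_
    · change -N.d (g.toLin x - g'.toLin x) + (g.toLin (P.d x) - g'.toLin (P.d x)) = (0 : N.carrier)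
      rw [map_sub, g.map_d, g'.map_d]; abel
    · change (f.toLin (g.toLin x - g'.toLin x) + N'.d (-t x)) + -t (P.d x) = (0 : N'.carrier)
      have e : f.toLin (g.toLin x) - f.toLin (g'.toLin x) = N'.d (t x) + t (P.d x) := T x
      rw [map_sub, e, map_neg]; abel
  let ψ₁ : P.carrier →ₗ[E.toDGAlg.carrierᵐᵒᵖ] N.carrier := LinearMap.fst _ _ _ ∘ₗ ψ
  refine ⟨-ψ₁, fun i m hm => neg_mem ?_, fun m => ?_⟩
  · have := (hψ i m hm).1
    rwa [show i + (-1 - 1) + 1 = i - 1 by ring] at this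
  · have e : -N.d (ψ₁ m) - (-1 : k) ^ (-1 - 1 : ℤ) • ψ₁ (P.d m) = g.toLin m - g'.toLin m :=
      congrArg Prod.fst (H m)
    rw [← e, show (-1 : k) ^ (-1 - 1 : ℤ) = 1 from Even.neg_one_zpow ⟨-1, rfl⟩, one_smul]
    change _ = N.d (-ψ₁ m) + -ψ₁ (P.d m)
    rw [map_neg]
    abel

/-- Morphisms in the relative derived category from a relatively projective dg module are
represented by morphisms of dg modules. -/
theorem IsRelProj.exists_rep (hP : IsRelProj E P) (α : (relQ E).obj P ⟶ (relQ E).obj N) :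
    ∃ f : P ⟶ N, α = (relQ E).map f := by
  -- `W` consists of the morphisms whose composition with any representable morphism from `P` is
  -- representable. It is stable under composition and contains the generators of the localization;
  -- the formal inverses belong to it by `exists_lift`. The claim is its value at the identity of
  -- `P`.
  let W : MorphismProperty (RelDer E) := fun X Y β =>
    ∀ g : P ⟶ X.as.obj, ∃ g' : P ⟶ Y.as.obj,
      ((relQ E).map g : (relQ E).obj P ⟶ X) ≫ β = (relQ E).map g'
  have : W.IsStableUnderComposition := ⟨fun {X Y Z} β γ hβ hγ g => by
    obtain ⟨g', h'⟩ := hβ g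
    obtain ⟨g'', h''⟩ := hγ g'
    exact ⟨g'', (Category.assoc _ _ _).symm.trans ((congrArg (fun t => t ≫ γ) h').trans h'')⟩⟩
  have hW : W = ⊤ := by
    refine Localization.Construction.morphismProperty_eq_top W ?_ ?_
    · intro X Y f g
      exact ⟨g ≫ f, ((relQ E).map_comp g f).symm⟩
    · intro X Y w hw g
      obtain ⟨g', hg'⟩ := hP.exists_lift w hw g
      refine ⟨g', ?_⟩
      have e := relQ_map_eq_of_homotopic E hg'
      rw [Functor.map_comp] at e
      exact (congrArg (fun t => t ≫ (Localization.Construction.wIso w hw).inv) e.symm).trans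
        ((Category.assoc _ _ _).trans ((congrArg (fun t => (relQ E).map g' ≫ t)
          (Localization.Construction.wIso w hw).hom_inv_id).trans (Category.comp_id _)))
  have h : W α := by rw [hW]; trivial
  obtain ⟨f, hf⟩ := h (𝟙 P)
  exact ⟨f, ((congrArg (fun t => t ≫ α) ((relQ E).map_id P)).trans
    (Category.id_comp α)).symm.trans hf⟩

/-- Makes equality in the quotient by homotopy the same as homotopy itself, not merely the generated
equivalence relation. -/
theorem homotopic_equivalence (M N : DGModule E.toDGAlg) :
    Equivalence (DGModule.Homotopic (M := M) (N := N)) :=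
  ⟨homotopic_refl, homotopic_symm, homotopic_trans⟩

/-- The functor of homotopy classes of morphisms from `P`. -/
def homotopyClasses (P : DGModule E.toDGAlg) : DGModule E.toDGAlg ⥤ Type u where
  obj N := Quot (DGModule.Homotopic (M := P) (N := N))
  map f := ↾Quot.map (fun g => g ≫ f) fun _ _ h => homotopic_comp h f
  map_id N := by
    ext ⟨g⟩
    exact congrArg (Quot.mk _) (Category.comp_id g)
  map_comp f f' := by
    ext ⟨g⟩
    exact congrArg (Quot.mk _) (Category.assoc g f f').symm

/-- Injectivity on homotopy classes is `cancel`, surjectivity is `exists_lift`. -/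
theorem IsRelProj.inverts (hP : IsRelProj E P) : (relQis E).IsInvertedBy (homotopyClasses P) := by
  intro X Y f hf
  rw [isIso_iff_bijective]
  constructor
  · rintro ⟨g⟩ ⟨g'⟩ h
    exact Quot.sound (hP.cancel f hf g g' ((homotopic_equivalence P Y).eqvGen_iff.1
      (Quot.eqvGen_exact h)))
  · rintro ⟨g⟩
    obtain ⟨g', h⟩ := hP.exists_lift f hf g
    exact ⟨Quot.mk _ g', Quot.sound h⟩

/-- The functor of homotopy classes factors through the localization, so it takes the same value on
`f` and `g`; evaluate at the class of the identity of `P`. -/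
theorem IsRelProj.homotopic_of_eq (hP : IsRelProj E P) {f g : P ⟶ N}
    (h : (relQ E).map f = (relQ E).map g) : DGModule.Homotopic f g := by
  let F := Localization.Construction.lift (homotopyClasses P) hP.inverts
  have e : (homotopyClasses P).map f = (homotopyClasses P).map g := by
    have := congrArg F.map h
    exact this
  have e' := congrArg (fun t => t (Quot.mk _ (𝟙 P))) e
  have := (homotopic_equivalence P N).eqvGen_iff.1 (Quot.eqvGen_exact e')
  exact this

end RelProj

/-! Extension of scalars of graded free modules. -/

section Basis

/-- A basis of a module gives a basis of its extension of scalars. -/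
theorem exists_basis_of_universal {R₁ R₂ Y X : Type u} [Ring R₁] [Algebra k R₁] [Ring R₂]
    [Algebra k R₂] [AddCommGroup Y] [Module k Y] [Module R₁ Y] [IsScalarTower k R₁ Y]
    [AddCommGroup X] [Module k X] [Module R₂ X] (φ : R₁ →ₐ[k] R₂)
    (j : Y →ₗ[k] X) (hj : ∀ r y, j (r • y) = φ r • j y)
    (hspan : Submodule.span R₂ (Set.range j) = ⊤) {ι : Type u} (b : Module.Basis ι R₁ Y)
    (hlift : ∀ g : Y →ₗ[k] (ι →₀ R₂), (∀ r y, g (r • y) = φ r • g y) →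
      ∃ G : X →ₗ[R₂] (ι →₀ R₂), ∀ y, G (j y) = g y) :
    ∃ b' : Module.Basis ι R₂ X, ∀ i, b' i = j (b i) := by
  -- The universal property is applied to the coordinates with respect to `b`. The resulting map
  -- sends each `j (b i)` to a standard basis vector, whence linear independence.
  obtain ⟨G, hG⟩ := hlift
    ((Finsupp.mapRange.linearMap φ.toLinearMap) ∘ₗ (b.repr.toLinearMap.restrictScalars k))
    (fun r y => by
      ext i
      simp)
  have hGb : ∀ i, G (j (b i)) = Finsupp.single i 1 := fun i => by
    rw [hG]
    simp
  have hli : LinearIndependent R₂ (fun i => j (b i)) := by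
    refine LinearIndependent.of_comp G ?_
    have : (⇑G ∘ fun i => j (b i)) = Finsupp.basisSingleOne (R := R₂) (ι := ι) := by
      ext1 i
      simp [hGb]
    rw [this]
    exact Module.Basis.linearIndependent _
  refine ⟨Module.Basis.mk hli ?_, fun i => Module.Basis.mk_apply _ _ i⟩
  rw [← hspan]
  refine Submodule.span_le.2 ?_
  rintro _ ⟨y, rfl⟩
  have hy : y ∈ Submodule.span R₁ (Set.range b) := by rw [b.span_eq]; trivial
  refine Submodule.span_induction (p := fun y _ => j y ∈ Submodule.span R₂
    (Set.range fun i => j (b i))) ?_ ?_ ?_ ?_ hy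
  · rintro _ ⟨i, rfl⟩
    exact Submodule.subset_span ⟨i, rfl⟩
  · rw [map_zero]; exact zero_mem _
  · intro x y _ _ hx hy
    rw [map_add]; exact add_mem hx hy
  · intro r x _ hx
    rw [hj]; exact Submodule.smul_mem _ _ hx

/-- Graded freeness is transitive. -/
theorem isGradedFree_res {B E : DGAlg k} (φ : DGAlg.Hom B E)
    (hE : ((DGModule.res φ).obj (DGModule.regular E)).IsGradedFree) {X : DGModule E}
    (hX : X.IsGradedFree) : ((DGModule.res φ).obj X).IsGradedFree := by
  obtain ⟨κ, e, he⟩ := hE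
  obtain ⟨ι, b, hb⟩ := hX
  let EB := ((DGModule.res φ).obj (DGModule.regular E)).carrier
  let XB := ((DGModule.res φ).obj X).carrier
  let f : ι → (EB →ₗ[B.carrierᵐᵒᵖ] XB) := fun i =>
    { toFun := fun e => (op (show E.carrier from e) • b i : X.carrier)
      map_add' := fun x y => by
        change (op ((show E.carrier from x) + (show E.carrier from y)) • b i : X.carrier) = _
        rw [MulOpposite.op_add, add_smul]; rfl
      map_smul' := fun r x => by
        change (op ((show E.carrier from x) * φ r.unop) • b i : X.carrier)
          = op (φ r.unop) • op (show E.carrier from x) • b i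
        rw [op_mul, mul_smul] }
  let Ψ : (ι →₀ EB) →ₗ[B.carrierᵐᵒᵖ] XB := Finsupp.lsum ℕ f
  have hΨ : ∀ i x, Ψ (Finsupp.single i x) = f i x := fun i x => by
    simp [Ψ]
  -- The coordinates of `Ψ g` with respect to `b` are `g` itself, which gives injectivity; the
  -- products of the two bases then form a basis over `B`.
  have hrepr : ∀ (g : ι →₀ EB) (i : ι), b.repr (show X.carrier from Ψ g) i
      = op (show E.carrier from g i) := by
    intro g i
    induction g using Finsupp.induction_linear with
    | zero =>
      rw [map_zero]
      exact (DFunLike.congr_fun (map_zero b.repr) i)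
    | add g g' h h' =>
      rw [map_add]
      refine (DFunLike.congr_fun (map_add b.repr (show X.carrier from Ψ g) (Ψ g')) i).trans ?_
      rw [Finsupp.add_apply, h, h', Finsupp.add_apply]
      rfl
    | single j x =>
      rw [hΨ]
      change b.repr (op (show E.carrier from x) • b j) i = _
      rw [map_smul, b.repr_self, Finsupp.smul_apply]
      by_cases h : j = i
      · subst h
        rw [Finsupp.single_eq_same, Finsupp.single_eq_same, smul_eq_mul, mul_one]
      · rw [Finsupp.single_eq_of_ne' h, Finsupp.single_eq_of_ne' h, smul_zero]
        rfl
  have hbij : Function.Bijective Ψ := by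
    constructor
    · intro g g' h
      ext1 i
      have h1 := hrepr g i
      rw [h, hrepr g' i] at h1
      exact (op_injective h1).symm
    · intro x
      refine basis_induction b (p := fun x => ∃ g, Ψ g = x) ⟨0, map_zero _⟩ ?_ ?_ x
      · rintro _ _ ⟨g, rfl⟩ ⟨g', rfl⟩
        exact ⟨g + g', map_add _ _ _⟩
      · intro i j e _
        exact ⟨Finsupp.single i e, hΨ i e⟩
  refine ⟨Σ _ : ι, κ, (Finsupp.basis fun _ => e).map (LinearEquiv.ofBijective Ψ hbij), ?_⟩
  rintro ⟨i, j⟩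
  obtain ⟨p, hp⟩ := hb i
  obtain ⟨q, hq⟩ := he j
  refine ⟨p + q, ?_⟩
  have : (Finsupp.basis fun _ => e).map (LinearEquiv.ofBijective Ψ hbij) ⟨i, j⟩ = f i (e j) := by
    rw [Module.Basis.map_apply, Finsupp.coe_basis]
    exact hΨ i (e j)
  rw [this]
  exact X.smul_mem hp hq

end Basis

/-! Induced dg modules. -/

section Ind

variable {S : CDGAlg k} (E : DGAlgebra S) (Y : DGModule S.toDGAlg)

/-- The dg `E`-module induced from a dg `S`-module. -/
noncomputable abbrev ind : DGModule E.toDGAlg := tensorObj E (DGModule.regular E.toDGAlg) Y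

/-- The unit `y ↦ 1 ⊗ y`. -/
def indEta : Y →ₗ[k] (ind E Y).carrier := tmk E (DGModule.regular E.toDGAlg) Y (1 : E.toDGAlg)

/-- The class of `e ⊗ y`. -/
def indMk : E.toDGAlg →ₗ[k] Y →ₗ[k] (ind E Y).carrier := tmk E (DGModule.regular E.toDGAlg) Y

theorem indEta_mem {i : ℤ} {y : Y} (hy : y ∈ Y.gr i) : indEta E Y y ∈ (ind E Y).gr i := by
  have h1 : (1 : E.toDGAlg) ∈ (DGModule.regular E.toDGAlg).gr 0 := E.one_mem
  have := tmk_mem (E := E) h1 hy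
  rwa [zero_add] at this

theorem indEta_d (y : Y) : (ind E Y).d (indEta E Y y) = indEta E Y (Y.d y) := by
  have h1 : (1 : E.toDGAlg) ∈ (DGModule.regular E.toDGAlg).gr 0 := E.one_mem
  have h0 : (DGModule.regular E.toDGAlg).d (1 : E.toDGAlg) = 0 := DGAlg.d_one E.toDGAlg
  have := tensorD_tmk E (DGModule.regular E.toDGAlg) Y h1 y
  rw [h0, map_zero, LinearMap.zero_apply, zero_add, zpow_zero, one_smul] at this
  exact this

variable {E Y} in
-- The right action moves `e` past `y`, hence the Koszul sign. Up to it, the elements `1 ⊗ y`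
-- generate.
theorem ind_tmk {i j : ℤ} {e : E.toDGAlg} {y : Y} (he : e ∈ E.gr i) (hy : y ∈ Y.gr j) :
    (op e • indEta E Y y : (ind E Y).carrier) = (-1 : k) ^ (i * j) • indMk E Y e y := by
  refine (tensorAct_tmk E (DGModule.regular E.toDGAlg) Y he hy (1 : E.toDGAlg)).trans ?_
  change (-1 : k) ^ (i * j) • indMk E Y ((1 : E.toDGAlg) * e) y = _
  rw [one_mul]

/-- The sign of the action and the sign of the balancing relation are equal, so the unit is
`S`-linear without sign. -/
theorem indEta_smul (s : S.toDGAlg) (y : Y) :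
    indEta E Y (op s • y) = op (E.unit s) • indEta E Y y := by
  refine graded_induction S.isInternal (p := fun s =>
    indEta E Y (op s • y) = op (E.unit s) • indEta E Y y) ?_ ?_ s
  · intro i s hs
    refine graded_induction Y.isInternal (p := fun y =>
      indEta E Y (op s • y) = op (E.unit s) • indEta E Y y) ?_ ?_ y
    · intro j y hy
      rw [ind_tmk (E.unit.map_mem hs) hy]
      have : indMk E Y ((1 : E.toDGAlg) * E.unit s) y = (-1 : k) ^ (i * j) • indEta E Y (op s • y) :=
        tmk_balanced E (DGModule.regular E.toDGAlg) Y hs hy (1 : E.toDGAlg)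
      rw [one_mul] at this
      rw [this, smul_smul, sign_mul, (Even.add_self _).neg_one_zpow, one_smul]
    · intro a b ha hb
      rw [smul_add, map_add, map_add, smul_add, ha, hb]
  · intro a b ha hb
    rw [MulOpposite.op_add, add_smul, map_add, ha, hb, map_add, MulOpposite.op_add, add_smul]

variable {E Y} in
theorem ind_induction {p : (ind E Y).carrier → Prop}
    (hom : ∀ (i j : ℤ) (e : E.toDGAlg) (y : Y), e ∈ E.gr i → y ∈ Y.gr j →
      p (op e • indEta E Y y)) (add : ∀ x y, p x → p y → p (x + y)) (x : (ind E Y).carrier) :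
    p x := by
  refine tensor_induction (E := E) (M := DGModule.regular E.toDGAlg) (N := Y) ?_ add x
  intro i j e y he hy
  have he' : e ∈ E.gr i := he
  -- Rescaling `y` by the Koszul sign makes the product exactly `e ⊗ y`.
  have h := hom i j e ((-1 : k) ^ (i * j) • y) he (Submodule.smul_mem _ _ hy)
  rw [map_smul, smul_comm, ind_tmk he' hy, smul_smul, sign_mul, (Even.add_self _).neg_one_zpow,
    one_smul] at h
  exact h

variable {E Y} in
theorem ind_ext {N : Type u} [AddCommGroup N] [Module E.toDGAlg.carrierᵐᵒᵖ N]
    {f g : (ind E Y).carrier →ₗ[E.toDGAlg.carrierᵐᵒᵖ] N}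
    (h : ∀ y, f (indEta E Y y) = g (indEta E Y y)) : f = g := by
  ext x
  refine ind_induction (p := fun x => f x = g x) ?_ ?_ x
  · intro i j e y _ _
    rw [map_smul, map_smul, h]
  · intro x y hx hy
    rw [map_add, map_add, hx, hy]

/-! ### The universal property of induced modules -/

section Lift

variable {N : Type u} [AddCommGroup N] [Module k N] [Module E.toDGAlg.carrierᵐᵒᵖ N]
  [IsScalarTower k E.toDGAlg.carrierᵐᵒᵖ N]

/-- The map `e, y ↦ (-1)^{|e||y|} f(y) e`. -/
noncomputable def indLiftAux (f : Y →ₗ[k] N) : E.toDGAlg →ₗ[k] Y →ₗ[k] N :=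
  gradedLift E.isInternal fun i =>
    { toFun := fun e => ((Algebra.lsmul k k N (op e.1)) ∘ₗ f) ∘ₗ tw Y.isInternal i
      map_add' := fun a b => by ext y; simp
      map_smul' := fun c a => by ext y; simp }

variable {E Y} in
theorem indLiftAux_apply (f : Y →ₗ[k] N) {i j : ℤ} {e : E.toDGAlg} {y : Y} (he : e ∈ E.gr i)
    (hy : y ∈ Y.gr j) : indLiftAux E Y f e y = (-1 : k) ^ (i * j) • (op e • f y) := by
  rw [indLiftAux, gradedLift_of_mem _ _ he]
  change (op e : E.toDGAlg.carrierᵐᵒᵖ) • f (tw Y.isInternal i y) = _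
  rw [tw_of_mem Y.isInternal i hy, map_smul, smul_algebra_smul_comm]

variable (f : Y →ₗ[k] N) (hf : ∀ (s : S.toDGAlg) (y : Y), f (op s • y) = op (E.unit s) • f y)

/-- The `k`-linear map underlying `indLift`. -/
noncomputable def indLiftLin : (ind E Y).carrier →ₗ[k] N :=
  tlift (E := E) (M := DGModule.regular E.toDGAlg) (N := Y) (indLiftAux E Y f) <| by
    intro i j l s y e hs hy he
    have he' : e ∈ E.gr l := he
    change indLiftAux E Y f ((show E.toDGAlg from e) * E.unit s) y
      = (-1 : k) ^ (i * j) • indLiftAux E Y f e (op s • y)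
    rw [indLiftAux_apply f (E.mul_mem he' (E.unit.map_mem hs)) hy,
      indLiftAux_apply f he' (Y.smul_mem hy hs), hf, ← mul_smul (op (show E.toDGAlg from e)),
      ← op_mul, E.central hs he', MulOpposite.op_smul, smul_assoc, smul_smul, smul_smul]
    congr 1
    simp only [sign_mul]
    apply sign_congr
    simp only [Int.even_add, Int.even_mul]
    tauto

variable {Y} in
theorem indLiftLin_smul_eta (e : E.toDGAlg) (y : Y) :
    indLiftLin E Y f hf (op e • indEta E Y y) = op e • f y := by
  refine graded_induction E.isInternal (p := fun e =>
    indLiftLin E Y f hf (op e • indEta E Y y) = op e • f y) ?_ ?_ e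
  · intro i e he
    refine graded_induction Y.isInternal (p := fun y =>
      indLiftLin E Y f hf (op e • indEta E Y y) = op e • f y) ?_ ?_ y
    · intro j y hy
      rw [ind_tmk he hy, map_smul]
      refine (congrArg (fun t => (-1 : k) ^ (i * j) • t) (indLiftAux_apply f he hy)).trans ?_
      rw [smul_smul, sign_mul, (Even.add_self _).neg_one_zpow, one_smul]
    · intro a b ha hb
      rw [map_add, smul_add, map_add, ha, hb, map_add, smul_add]
  · intro a b ha hb
    rw [MulOpposite.op_add, add_smul, map_add, ha, hb, add_smul]

/-- The linear map on an induced module extending an `S`-linear map. -/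
noncomputable def indLift : (ind E Y).carrier →ₗ[E.toDGAlg.carrierᵐᵒᵖ] N where
  toFun := indLiftLin E Y f hf
  map_add' := map_add _
  map_smul' e x := by
    induction e using MulOpposite.rec' with | _ e => ?_
    refine ind_induction (p := fun x => indLiftLin E Y f hf (op e • x)
      = op e • indLiftLin E Y f hf x) ?_ ?_ x
    · intro i j e' y _ _
      rw [← mul_smul, ← op_mul, indLiftLin_smul_eta, indLiftLin_smul_eta, op_mul, mul_smul]
    · intro x y hx hy
      rw [smul_add, map_add, map_add, hx, hy, smul_add]

theorem indLift_eta (y : Y) : indLift E Y f hf (indEta E Y y) = f y := by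
  have := indLiftLin_smul_eta E f hf 1 y
  rwa [op_one, one_smul, one_smul] at this

end Lift

theorem linDeg_indLift {N : DGModule E.toDGAlg} (f : Y →ₗ[k] N)
    (hf : ∀ (s : S.toDGAlg) (y : Y), f (op s • y) = op (E.unit s) • f y) {q : ℤ}
    (hq : ∀ (i : ℤ) (y : Y), y ∈ Y.gr i → f y ∈ N.gr (i + q)) :
    LinDeg (M := ind E Y) (indLift E Y f hf) q := by
  intro n x hx
  refine tensorGr_map (f := indLiftLin E Y f hf) ?_ hx
  rintro i j e y rfl he hy
  have he' : e ∈ E.gr i := he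
  change indLiftAux E Y f e y ∈ _
  rw [indLiftAux_apply f he' hy]
  refine Submodule.smul_mem _ _ ?_
  rw [show i + j + q = j + q + i by ring]
  exact N.smul_mem (hq _ _ hy) he'

/-- Linear maps out of the induced module are `S`-linear maps out of `Y`, so an `S`-linear
contraction `c` of the target is enough: the extension of `c ∘ φ ∘ η` is a primitive of `φ`. -/
theorem isRelProj_ind : IsRelProj E (ind E Y) := by
  rintro N ⟨c, cS, cg, hc⟩ q φ hφ hd0
  have φeta : ∀ (s : S.toDGAlg) (y : Y), φ (indEta E Y (op s • y))
      = op (E.unit s) • φ (indEta E Y y) := fun s y => by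
    rw [indEta_smul, map_smul]
  let f : Y →ₗ[k] N := c ∘ₗ (φ.restrictScalars k) ∘ₗ indEta E Y
  have hf : ∀ (s : S.toDGAlg) (y : Y), f (op s • y) = op (E.unit s) • f y := fun s y => by
    change c (φ (indEta E Y (op s • y))) = op (E.unit s) • c (φ (indEta E Y y))
    rw [φeta, cS]
  have hq : LinDeg (M := ind E Y) (N := N) (indLift E Y f hf) (q - 1) :=
    linDeg_indLift E Y f hf fun i y hy => by
      have := cg _ _ (hφ _ _ (indEta_mem E Y hy))
      rwa [add_sub_assoc] at this
  refine ⟨indLift E Y f hf, hq, fun x => ?_⟩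
  have key : hd (M := ind E Y) (N := N) (indLift E Y f hf) hq = φ := by
    refine ind_ext fun y => ?_
    rw [hd_apply, indEta_d, indLift_eta, indLift_eta]
    have h1 : N.d (φ (indEta E Y y)) - (-1 : k) ^ q • φ ((ind E Y).d (indEta E Y y)) = 0 :=
      hd0 (indEta E Y y)
    rw [indEta_d, sub_eq_zero] at h1
    have h2 := hc (φ (indEta E Y y))
    rw [h1, map_smul] at h2
    refine Eq.trans ?_ h2
    change N.d (c (φ (indEta E Y y))) - (-1 : k) ^ (q - 1) • c (φ (indEta E Y (Y.d y))) = _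
    rw [zpow_sub₀ (neg_ne_zero.2 one_ne_zero), zpow_one, div_neg, div_one, neg_smul,
      sub_neg_eq_add]
  exact LinearMap.congr_fun key x

/-- The elements `1 ⊗ b i` form a basis, by the universal property. -/
theorem isGradedFree_ind (hY : Y.IsGradedFree) : (ind E Y).IsGradedFree := by
  obtain ⟨ι, b, hb⟩ := hY
  obtain ⟨b', hb'⟩ := exists_basis_of_universal (k := k) (AlgHom.op E.unit.toAlgHom)
    (indEta E Y) (fun s y => indEta_smul E Y s.unop y) (by
      refine eq_top_iff.2 fun x _ => ?_
      refine ind_induction (p := fun x => x ∈ Submodule.span E.toDGAlg.carrierᵐᵒᵖ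
        (Set.range (indEta E Y))) ?_ (fun x y hx hy => add_mem hx hy) x
      intro i j e y _ _
      exact Submodule.smul_mem _ _ (Submodule.subset_span ⟨y, rfl⟩)) b
    (fun g hg => ⟨indLift E Y g (fun s y => hg (op s) y), fun y => indLift_eta E Y g _ y⟩)
  refine ⟨ι, b', fun i => ?_⟩
  obtain ⟨p, hp⟩ := hb i
  exact ⟨p, by rw [hb']; exact indEta_mem E Y hp⟩

end Ind

/-! Total dg modules of complexes of dg modules. -/

section Tot

variable {E : DGAlg k} (X : ℕ → DGModule E) (δ : ∀ n, X (n + 1) ⟶ X n)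

/-- The vector space underlying the total dg module. -/
abbrev TotCarrier : Type u := Π₀ n, (X n).carrier

/-- The inclusion of a component. -/
def totSingle (n : ℕ) : (X n).carrier →ₗ[E.carrierᵐᵒᵖ] TotCarrier X :=
  DFinsupp.lsingle (R := E.carrierᵐᵒᵖ) (M := fun n => (X n).carrier) n

variable {X} in
theorem totSingle_apply_self (n : ℕ) (x : X n) : totSingle X n x n = x :=
  DFinsupp.single_eq_same

variable {X} in
theorem totSingle_apply_ne {n m : ℕ} (h : n ≠ m) (x : X n) : totSingle X n x m = 0 :=
  DFinsupp.single_eq_of_ne h.symm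

variable {X} in
theorem tot_induction {p : TotCarrier X → Prop} (zero : p 0)
    (add : ∀ x y, p x → p y → p (x + y))
    (hom : ∀ (n : ℕ) (i : ℤ) (x : X n), x ∈ (X n).gr i → p (totSingle X n x))
    (x : TotCarrier X) : p x := by
  refine DFinsupp.induction x zero fun n x f _ _ hf => add _ _ ?_ hf
  refine graded_induction (X n).isInternal (p := fun x => p (totSingle X n x)) (hom n) ?_ x
  intro a b ha hb
  rw [map_add]; exact add _ _ ha hb

/-- The differential `x ↦ (-1)^n d x + δ x` on the component of index `n`. -/
def totDAux : ∀ n, (X n).carrier →ₗ[k] TotCarrier X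
  | 0 => (totSingle X 0).restrictScalars k ∘ₗ (X 0).d
  | n + 1 => (totSingle X (n + 1)).restrictScalars k ∘ₗ ((-1 : k) ^ (n + 1) • (X (n + 1)).d)
      + (totSingle X n).restrictScalars k ∘ₗ (DGModule.Hom.klin (δ n))

/-- The differential of the total dg module. -/
def totD : TotCarrier X →ₗ[k] TotCarrier X := DFinsupp.lsum ℕ (totDAux X δ)

theorem totD_single (n : ℕ) (x : X n) : totD X δ (totSingle X n x) = totDAux X δ n x := by
  change DFinsupp.lsum ℕ (totDAux X δ) (DFinsupp.single n x) = _
  rw [DFinsupp.lsum_single]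

theorem totD_single_zero (x : X 0) :
    totD X δ (totSingle X 0 x) = totSingle X 0 ((X 0).d x) := totD_single X δ 0 x

theorem totD_single_succ (n : ℕ) (x : X (n + 1)) : totD X δ (totSingle X (n + 1) x)
    = (-1 : k) ^ (n + 1) • totSingle X (n + 1) ((X (n + 1)).d x)
      + totSingle X n ((δ n).toLin x) := by
  refine (totD_single X δ (n + 1) x).trans ?_
  change totSingle X (n + 1) ((-1 : k) ^ (n + 1) • (X (n + 1)).d x) + _ = _
  rw [LinearMap.map_smul_of_tower]
  rfl

/-- In this componentwise form the identities required of `tot` are checked one index at a time. -/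
theorem totD_apply (x : TotCarrier X) (n : ℕ) :
    totD X δ x n = (-1 : k) ^ n • (X n).d (x n) + (δ n).toLin (x (n + 1)) := by
  refine tot_induction (p := fun x => totD X δ x n
    = (-1 : k) ^ n • (X n).d (x n) + (δ n).toLin (x (n + 1))) ?_ ?_ ?_ x
  · simp
  · intro x y hx hy
    rw [map_add, DFinsupp.add_apply, hx, hy, DFinsupp.add_apply, DFinsupp.add_apply, map_add,
      map_add, smul_add]
    abel
  · intro m i x _
    rcases m with _ | m
    · rw [totD_single_zero, totSingle_apply_ne (Nat.succ_ne_zero n).symm, map_zero, add_zero]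
      rcases n with _ | n
      · rw [totSingle_apply_self, totSingle_apply_self, pow_zero, one_smul]
      · rw [totSingle_apply_ne (Nat.succ_ne_zero n).symm,
          totSingle_apply_ne (Nat.succ_ne_zero n).symm, map_zero, smul_zero]
    · rw [totD_single_succ, DFinsupp.add_apply, DFinsupp.smul_apply]
      congr 1
      · by_cases h : m + 1 = n
        · subst h
          rw [totSingle_apply_self, totSingle_apply_self]
        · rw [totSingle_apply_ne h, totSingle_apply_ne h, map_zero, smul_zero, smul_zero]
      · by_cases h : m = n
        · subst h
          rw [totSingle_apply_self, totSingle_apply_self]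
        · rw [totSingle_apply_ne h, totSingle_apply_ne (by omega), map_zero]

/-- The component of degree `p` of the total dg module. -/
def totGr (p : ℤ) : Submodule k (TotCarrier X) where
  carrier := {x | ∀ n : ℕ, x n ∈ (X n).gr (p + n)}
  add_mem' ha hb n := add_mem (ha n) (hb n)
  zero_mem' _ := zero_mem _
  smul_mem' c _ ha n := Submodule.smul_mem _ c (ha n)

theorem totSingle_mem {n : ℕ} {x : X n} {p : ℤ} (hx : x ∈ (X n).gr (p + n)) :
    totSingle X n x ∈ totGr X p := fun m => by
  by_cases h : n = m
  · subst h
    rwa [totSingle_apply_self]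
  · rw [totSingle_apply_ne h]
    exact zero_mem _

/-- The total dg module of a complex of dg modules: the sum of the `X n`, with the component `X n`
shifted `n` times. -/
noncomputable def tot (hδ : ∀ n x, (δ n).toLin ((δ (n + 1)).toLin x) = 0) : DGModule E where
  carrier := TotCarrier X
  isScalarTower := DFinsupp.isScalarTower
  gr := totGr X
  isInternal := by
    refine isInternal_of_proj _
      (fun p => DFinsupp.mapRange.linearMap fun n => proj (X n).isInternal (p + n)) ?_ ?_ ?_
    · intro p x hx
      ext n
      exact proj_of_mem (X n).isInternal (hx n)
    · intro p q h x hx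
      ext n
      exact proj_of_mem_ne (X n).isInternal (fun e => h (add_right_cancel e)) (hx n)
    · intro x
      refine tot_induction (p := fun x => x ∈ ⨆ i, totGr X i) (zero_mem _)
        (fun x y hx hy => add_mem hx hy) ?_ x
      intro n i x hx
      refine Submodule.mem_iSup_of_mem (i - n) (totSingle_mem X ?_)
      rwa [sub_add_cancel]
  smul_mem := fun {i j x a} hx ha n => by
    have := (X n).smul_mem (hx n) ha
    rwa [show i + j + n = i + n + j by ring]
  d := totD X δ
  d_mem := fun {i x} hx n => by
    rw [totD_apply]
    refine add_mem (Submodule.smul_mem _ _ ?_) ?_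
    · rw [show i + 1 + (n : ℤ) = i + n + 1 by ring]
      exact (X n).d_mem (hx n)
    · have := (δ n).map_mem (hx (n + 1))
      push_cast at this
      rwa [show i + 1 + (n : ℤ) = i + (n + 1) by ring]
  -- The cross terms `d δ` and `δ d` carry the opposite signs `(-1)^n` and `(-1)^(n+1)`, and cancel.
  d_d := fun x => by
    ext n
    rw [totD_apply, totD_apply, totD_apply, map_add, map_add, hδ, map_smul, (X n).d_d, lin_smul,
      (δ n).map_d, pow_succ]
    simp
  -- The component `x n` has degree `i + n` in `X n`. The factor `(-1)^n` of the total differential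
  -- turns its sign `(-1)^(i+n)` into the required `(-1)^i`.
  d_smul := fun {i x} hx a => by
    refine DFinsupp.ext fun n => ?_
    rw [totD_apply]
    change (-1 : k) ^ n • (X n).d (op a • x n) + (δ n).toLin (op a • x (n + 1))
      = op a • totD X δ x n + (-1 : k) ^ i • (op (E.d a) • x n)
    rw [totD_apply, (X n).d_smul (hx n), map_smul, smul_add, smul_add, smul_smul,
      zpow_add₀ (neg_ne_zero.2 one_ne_zero), zpow_natCast, mul_comm ((-1 : k) ^ i), ← mul_assoc,
      ← mul_pow, smul_comm (op a) ((-1 : k) ^ n)]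
    simp only [mul_neg, mul_one, neg_neg, one_pow, one_mul]
    abel

variable {X δ} (hδ : ∀ n x, (δ n).toLin ((δ (n + 1)).toLin x) = 0)

/-- The inclusion of a component in the total dg module. -/
def totIn (n : ℕ) : (X n).carrier →ₗ[E.carrierᵐᵒᵖ] (tot X δ hδ).carrier := totSingle X n

theorem totIn_mem {n : ℕ} {x : X n} {p : ℤ} (hx : x ∈ (X n).gr p) :
    totIn hδ n x ∈ (tot X δ hδ).gr (p - n) :=
  totSingle_mem X (by rwa [sub_add_cancel])

theorem tot_d_zero (x : X 0) : (tot X δ hδ).d (totIn hδ 0 x) = totIn hδ 0 ((X 0).d x) :=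
  totD_single_zero X δ x

theorem tot_d_succ (n : ℕ) (x : X (n + 1)) : (tot X δ hδ).d (totIn hδ (n + 1) x)
    = (-1 : k) ^ (n + 1) • totIn hδ (n + 1) ((X (n + 1)).d x) + totIn hδ n ((δ n).toLin x) :=
  totD_single_succ X δ n x

variable {hδ} in
theorem totIn_induction {p : (tot X δ hδ).carrier → Prop} (zero : p 0)
    (add : ∀ x y, p x → p y → p (x + y))
    (hom : ∀ (n : ℕ) (i : ℤ) (x : X n), x ∈ (X n).gr i → p (totIn hδ n x))
    (x : (tot X δ hδ).carrier) : p x :=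
  tot_induction (X := X) zero add hom x

/-- The linear map on the total dg module with prescribed restrictions to the components. -/
def totLift {N : Type u} [AddCommGroup N] [Module E.carrierᵐᵒᵖ N]
    (ψ : ∀ n, (X n).carrier →ₗ[E.carrierᵐᵒᵖ] N) : (tot X δ hδ).carrier →ₗ[E.carrierᵐᵒᵖ] N :=
  DFinsupp.lsum (R := E.carrierᵐᵒᵖ) (M := fun n => (X n).carrier) ℕ ψ

theorem totLift_in {N : Type u} [AddCommGroup N] [Module E.carrierᵐᵒᵖ N]
    (ψ : ∀ n, (X n).carrier →ₗ[E.carrierᵐᵒᵖ] N) (n : ℕ) (x : X n) :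
    totLift hδ ψ (totIn hδ n x) = ψ n x :=
  DFinsupp.lsum_single (R := E.carrierᵐᵒᵖ) (M := fun n => (X n).carrier) ℕ ψ n x

/-- The `k`-linear map on the total dg module with prescribed restrictions to the components. -/
def totLiftK {N : Type u} [AddCommGroup N] [Module k N] (ψ : ∀ n, (X n).carrier →ₗ[k] N) :
    (tot X δ hδ).carrier →ₗ[k] N :=
  DFinsupp.lsum (R := k) (M := fun n => (X n).carrier) ℕ ψ

theorem totLiftK_in {N : Type u} [AddCommGroup N] [Module k N]
    (ψ : ∀ n, (X n).carrier →ₗ[k] N) (n : ℕ) (x : X n) :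
    totLiftK hδ ψ (totIn hδ n x) = ψ n x :=
  DFinsupp.lsum_single (R := k) (M := fun n => (X n).carrier) ℕ ψ n x

theorem linDeg_totLift {N : DGModule E} (ψ : ∀ n, (X n).carrier →ₗ[E.carrierᵐᵒᵖ] N.carrier) {q : ℤ}
    (h : ∀ n : ℕ, LinDeg (ψ n) (q - n)) : LinDeg (totLift hδ ψ) q := by
  refine linDeg_of_map_proj fun j x => ?_
  refine totIn_induction (p := fun x => totLift hδ ψ (proj (tot X δ hδ).isInternal j x)
    = proj N.isInternal (j + q) (totLift hδ ψ x)) (by simp)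
    (fun x y hx hy => by simp only [map_add, hx, hy]) ?_ x
  intro n i x hx
  have h1 := totIn_mem hδ hx
  have h2 := h n i x hx
  rw [totLift_in]
  by_cases hj : i - n = j
  · rw [proj_of_mem (tot X δ hδ).isInternal (hj ▸ h1), totLift_in,
      proj_of_mem N.isInternal (n := j + q)]
    rwa [show j + q = i + (q - n) by omega]
  · rw [proj_of_mem_ne (tot X δ hδ).isInternal hj h1, proj_of_mem_ne N.isInternal (by omega) h2,
      map_zero]

theorem isGradedFree_tot (h : ∀ n, (X n).IsGradedFree) : (tot X δ hδ).IsGradedFree := by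
  choose ι b hb using h
  refine ⟨Σ n, ι n, DFinsupp.basis b, ?_⟩
  rintro ⟨n, i⟩
  obtain ⟨p, hp⟩ := hb n i
  refine ⟨p - n, ?_⟩
  have : DFinsupp.basis b ⟨n, i⟩ = totSingle X n (b n i) := by
    rw [← Module.Basis.repr_symm_single_one]
    change DFinsupp.mapRange.linearEquiv (fun n => (b n).repr.symm)
      (sigmaFinsuppEquivDFinsupp (Finsupp.single ⟨n, i⟩ 1)) = _
    rw [sigmaFinsuppEquivDFinsupp_single]
    refine (DFinsupp.mapRange_single (hf := fun n => map_zero (b n).repr.symm)).trans ?_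
    rw [Module.Basis.repr_symm_single_one]
    rfl
  refine Eq.mpr (congrArg (fun t => t ∈ totGr X (p - n)) this) (totSingle_mem X ?_)
  rwa [sub_add_cancel]

end Tot

/-! ### Relative projectivity of total modules -/

section TotRelProj

variable {S : CDGAlg k} {E : DGAlgebra S} {X : ℕ → DGModule E.toDGAlg} {δ : ∀ n, X (n + 1) ⟶ X n}
  (hδ : ∀ n x, (δ n).toLin ((δ (n + 1)).toLin x) = 0)

/-- A primitive of `φ` is built one index at a time: its component of index `n + 1` must be a
primitive of the corresponding component of `φ` corrected by the previous component composed with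
`δ`. Since the total module is a direct sum, the components need no finiteness condition to
assemble. -/
theorem isRelProj_tot (h : ∀ n, IsRelProj E (X n)) : IsRelProj E (tot X δ hδ) := by
  intro N hN q φ hφ hd0
  let φ' : ∀ n, (X n).carrier →ₗ[E.toDGAlg.carrierᵐᵒᵖ] N.carrier := fun n => φ ∘ₗ totIn hδ n
  have hφ' : ∀ n : ℕ, LinDeg (φ' n) (q - n) := fun n i x hx => by
    have := hφ (i - n) _ (totIn_mem hδ hx)
    rwa [show i + (q - n) = i - n + q by ring]
  have hd0' : ∀ x, N.d (φ x) = (-1 : k) ^ q • φ ((tot X δ hδ).d x) := fun x => sub_eq_zero.1 (hd0 x)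
  have φ0 : ∀ x, N.d (φ' 0 x) = (-1 : k) ^ q • φ' 0 ((X 0).d x) := fun x =>
    (hd0' (totIn hδ 0 x)).trans (by rw [tot_d_zero]; rfl)
  have φs : ∀ n x, N.d (φ' (n + 1) x) = (-1 : k) ^ (q + (n + 1)) • φ' (n + 1) ((X (n + 1)).d x)
      + (-1 : k) ^ q • φ' n ((δ n).toLin x) := fun n x =>
    (hd0' (totIn hδ (n + 1) x)).trans (by
      rw [tot_d_succ, map_add, smul_add]
      refine congrArg₂ (· + ·) ?_ rfl
      refine (congrArg (fun t => (-1 : k) ^ q • t) (lin_smul (M := tot X δ hδ) φ _ _)).trans ?_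
      rw [smul_smul, zpow_add₀ (neg_ne_zero.2 one_ne_zero)]
      norm_cast)
  have sgn : ∀ n : ℕ, (-1 : k) ^ (q + (n + 1)) = (-1 : k) ^ (q - (n + 1 : ℕ)) := fun n => by
    apply sign_congr
    push_cast
    simp only [Int.even_add, Int.even_sub]
  -- The recursion carries the equation for `ψ` only on the image of `δ`. There the correction by
  -- the previous component vanishes because `δ δ = 0`, so the condition concerns `ψ` alone.
  let C : ∀ n, ((X n).carrier →ₗ[E.toDGAlg.carrierᵐᵒᵖ] N.carrier) → Prop := fun n ψ =>
    ∃ hψ : LinDeg (M := X n) (N := N) ψ (q - 1 - n), ∀ x : X (n + 1),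
      hd ψ hψ ((δ n).toLin x) = φ' n ((δ n).toLin x)
  have base : ∃ ψ : {ψ // C 0 ψ}, ∃ hψ : LinDeg (M := X 0) (N := N) ψ.1 (q - 1), ∀ x,
      hd ψ.1 hψ x = φ' 0 x := by
    have h0 : LinDeg (M := X 0) (N := N) (φ' 0) q := by
      have := hφ' 0
      rwa [Nat.cast_zero, sub_zero] at this
    obtain ⟨ψ, hψ, H⟩ := h 0 N hN q (φ' 0) h0 (fun x => by rw [hd_apply, φ0, sub_self])
    have hψ' : LinDeg (M := X 0) (N := N) ψ (q - 1 - (0 : ℕ)) := by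
      rwa [Nat.cast_zero, sub_zero]
    refine ⟨⟨ψ, hψ', fun x => ?_⟩, hψ, H⟩
    rw [← H, hd_apply, hd_apply, Nat.cast_zero, sub_zero]
  have step : ∀ (n : ℕ) (ψ : {ψ // C n ψ}), ∃ ψ' : {ψ // C (n + 1) ψ},
      ∃ hψ : LinDeg (M := X (n + 1)) (N := N) ψ'.1 (q - (n + 1 : ℕ) - 1), ∀ x,
        hd ψ'.1 hψ x = φ' (n + 1) x + (-1 : k) ^ (q - 1) • ψ.1 ((δ n).toLin x) := by
    rintro n ⟨ψ, hψ, H⟩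
    -- This map is closed: its boundary involves the boundary of `ψ` only on the image of `δ`, where
    -- `C n ψ` gives it.
    let θ : (X (n + 1)).carrier →ₗ[E.toDGAlg.carrierᵐᵒᵖ] N.carrier :=
      φ' (n + 1) + (-1 : k) ^ (q - 1) • (ψ ∘ₗ (δ n).toLin)
    have hθ : LinDeg (M := X (n + 1)) (N := N) θ (q - (n + 1 : ℕ)) := by
      intro i x hx
      refine add_mem (hφ' (n + 1) i x hx) (Submodule.smul_mem _ _ ?_)
      have := hψ i _ ((δ n).map_mem hx)
      push_cast
      rwa [show q - (n + 1 : ℤ) = q - 1 - n by ring]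
    obtain ⟨ψ', hψ', H'⟩ := h (n + 1) N hN _ θ hθ fun x => by
      have e := H x
      rw [hd_apply, sub_eq_iff_eq_add] at e
      rw [hd_apply]
      change N.d (φ' (n + 1) x + (-1 : k) ^ (q - 1) • ψ ((δ n).toLin x)) - _ • (φ' (n + 1) _
        + (-1 : k) ^ (q - 1) • ψ ((δ n).toLin _)) = 0
      rw [map_add, φs, map_smul, e, (δ n).map_d, sgn, smul_add, smul_add, smul_smul, smul_smul,
        sign_mul, sign_mul]
      have s1 : (-1 : k) ^ (q - 1) = -(-1 : k) ^ q := by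
        rw [zpow_sub₀ (neg_ne_zero.2 one_ne_zero), zpow_one, div_neg, div_one]
      rw [s1, show q - 1 + (q - 1 - (n : ℤ)) = q - ((n + 1 : ℕ) : ℤ) + (q - 1) by push_cast; ring,
        neg_smul]
      abel
    have hψ'' : LinDeg (M := X (n + 1)) (N := N) ψ' (q - 1 - (n + 1 : ℕ)) := by
      rwa [show q - 1 - ((n + 1 : ℕ) : ℤ) = q - (n + 1 : ℕ) - 1 by ring]
    refine ⟨⟨ψ', hψ'', fun x => ?_⟩, hψ', H'⟩
    have e := H' ((δ (n + 1)).toLin x)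
    rw [hd_apply] at e ⊢
    rw [show q - 1 - ((n + 1 : ℕ) : ℤ) = q - (n + 1 : ℕ) - 1 by ring, e]
    change _ + (-1 : k) ^ (q - 1) • ψ ((δ n).toLin ((δ (n + 1)).toLin x)) = _
    rw [hδ, map_zero, smul_zero, add_zero]
  obtain ⟨ψ0, hψ0, H0⟩ := base
  choose next hnext Hnext using step
  let seq : ∀ n, {ψ // C n ψ} := fun n => Nat.rec ψ0 next n
  have hseq : ∀ n : ℕ, LinDeg (M := X n) (N := N) (seq n).1 (q - 1 - n) := fun n => (seq n).2.1
  refine ⟨totLift hδ fun n => (seq n).1, linDeg_totLift hδ _ hseq, fun x => ?_⟩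
  rw [hd_apply]
  refine totIn_induction (p := fun x => N.d (totLift hδ (fun n => (seq n).1) x)
    - (-1 : k) ^ (q - 1) • totLift hδ (fun n => (seq n).1) ((tot X δ hδ).d x) = φ x) ?_ ?_ ?_ x
  · simp
  · intro x y hx hy
    simp only [map_add, smul_add]
    rw [add_sub_add_comm, hx, hy]
  · intro n i x _
    rcases n with _ | n
    · rw [tot_d_zero, totLift_in, totLift_in]
      exact H0 x
    · rw [tot_d_succ, map_add, LinearMap.map_smul_of_tower, totLift_in, totLift_in, totLift_in]
      have e := Hnext n (seq n) x
      rw [hd_apply] at e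
      change _ = φ' (n + 1) x
      rw [← sub_eq_iff_eq_add.2 e, smul_add, smul_smul, sub_add_eq_sub_sub]
      refine congrArg₂ _ (congrArg₂ _ rfl (congrArg₂ _ ?_ rfl)) rfl
      rw [← zpow_natCast, sign_mul]
      apply sign_congr
      push_cast
      simp only [Int.even_add, Int.even_sub]
      tauto

end TotRelProj

/-! Complexes of dg modules with an `S`-linear contraction. -/

/-- An augmented complex `⋯ ⟶ X 2 ⟶ X 1 ⟶ X 0` of dg modules over a dg `S`-algebra with an
`S`-linear contraction. -/
structure ContrComplex {S : CDGAlg k} (E : DGAlgebra S) where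
  X : ℕ → DGModule E.toDGAlg
  δ : ∀ n, X (n + 1) ⟶ X n
  hδ : ∀ n x, (δ n).toLin ((δ (n + 1)).toLin x) = 0
  η : ∀ n, (X n).carrier →ₗ[k] (X (n + 1)).carrier
  η_mem : ∀ n {i : ℤ} {x : X n}, x ∈ (X n).gr i → η n x ∈ (X (n + 1)).gr i
  η_d : ∀ n x, (X (n + 1)).d (η n x) = η n ((X n).d x)
  η_smul : ∀ n (s : S.toDGAlg) (x : X n), η n (op (E.unit s) • x) = op (E.unit s) • η n x
  δ_η_zero : ∀ x, (δ 0).toLin (η 0 x) = x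
  δ_η_succ : ∀ n x, (δ (n + 1)).toLin (η (n + 1) x) = x - η n ((δ n).toLin x)

section Contr

variable {S : CDGAlg k} {E : DGAlgebra S} (C : ContrComplex E)

/-- The tail of a contracted complex. -/
noncomputable def tail : DGModule E.toDGAlg :=
  tot (fun n => C.X (n + 1)) (fun n => C.δ (n + 1)) (fun n => C.hδ (n + 1))

/-- The inclusion of a component in the tail of a contracted complex. -/
noncomputable def tailIn (n : ℕ) :
    (C.X (n + 1)).carrier →ₗ[E.toDGAlg.carrierᵐᵒᵖ] (tail C).carrier :=
  totIn (X := fun n => C.X (n + 1)) (fun n => C.hδ (n + 1)) n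

theorem tailIn_mem {n : ℕ} {x : C.X (n + 1)} {p : ℤ}
    (hx : x ∈ (C.X (n + 1)).gr p) : tailIn C n x ∈ (tail C).gr (p - n) :=
  totIn_mem (X := fun n => C.X (n + 1)) (fun n => C.hδ (n + 1)) hx

theorem tail_d_zero (x : C.X (0 + 1)) :
    (tail C).d (tailIn C 0 x) = tailIn C 0 ((C.X (0 + 1)).d x) :=
  tot_d_zero (X := fun n => C.X (n + 1)) (fun n => C.hδ (n + 1)) x

theorem tail_d_succ (n : ℕ) (x : C.X (n + 1 + 1)) :
    (tail C).d (tailIn C (n + 1) x)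
      = (-1 : k) ^ (n + 1) • tailIn C (n + 1) ((C.X (n + 1 + 1)).d x)
        + tailIn C n ((C.δ (n + 1)).toLin x) :=
  tot_d_succ (X := fun n => C.X (n + 1)) (fun n => C.hδ (n + 1)) n x

variable {C} in
theorem tail_induction {p : (tail C).carrier → Prop} (zero : p 0)
    (add : ∀ x y, p x → p y → p (x + y))
    (hom : ∀ (n : ℕ) (i : ℤ) (x : C.X (n + 1)), x ∈ (C.X (n + 1)).gr i → p (tailIn C n x))
    (x : (tail C).carrier) : p x :=
  totIn_induction (X := fun n => C.X (n + 1)) zero add hom x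

/-- The components of the augmentation of the tail of a contracted complex. -/
noncomputable def tailAugAux :
    ∀ n, (C.X (n + 1)).carrier →ₗ[E.toDGAlg.carrierᵐᵒᵖ] (C.X 0).carrier
  | 0 => (C.δ 0).toLin
  | _ + 1 => 0

/-- The linear map underlying the augmentation of the tail of a contracted complex. -/
noncomputable def tailAugLin : (tail C).carrier →ₗ[E.toDGAlg.carrierᵐᵒᵖ] (C.X 0).carrier :=
  totLift (X := fun n => C.X (n + 1)) (fun n => C.hδ (n + 1)) (tailAugAux C)

theorem tailAugLin_zero (x : C.X (0 + 1)) :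
    tailAugLin C (tailIn C 0 x) = (C.δ 0).toLin x :=
  totLift_in (X := fun n => C.X (n + 1)) (fun n => C.hδ (n + 1)) (tailAugAux C) 0 x

theorem tailAugLin_succ (n : ℕ) (x : C.X (n + 1 + 1)) :
    tailAugLin C (tailIn C (n + 1) x) = 0 :=
  totLift_in (X := fun n => C.X (n + 1)) (fun n => C.hδ (n + 1)) (tailAugAux C) (n + 1) x

/-- The augmentation of the tail of a contracted complex. -/
noncomputable def tailAug : tail C ⟶ C.X 0 :=
  homOf (tailAugLin C)
    (linDeg_totLift (X := fun n => C.X (n + 1)) (fun n => C.hδ (n + 1)) (tailAugAux C)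
      fun n i x hx => by
        rcases n with _ | n
        · have := (C.δ 0).map_mem hx
          rwa [Nat.cast_zero, sub_zero, add_zero]
        · exact zero_mem _) fun x => by
    refine tail_induction (p := fun x => tailAugLin C ((tail C).d x) = (C.X 0).d (tailAugLin C x))
      (by simp) (fun x y hx hy => by simp only [map_add, hx, hy]) ?_ x
    rintro (_ | n) _ x _
    · rw [tail_d_zero, tailAugLin_zero, tailAugLin_zero, (C.δ 0).map_d]
    · refine (congrArg (tailAugLin C) (tail_d_succ C n x)).trans ?_
      rw [map_add, LinearMap.map_smul_of_tower]
      refine Eq.trans ?_ ((congrArg (C.X 0).d (tailAugLin_succ C n x)).trans (map_zero _)).symm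
      refine (congrArg (fun t => _ • t + _) (tailAugLin_succ C n _)).trans ?_
      rw [smul_zero, zero_add]
      rcases n with _ | n
      · exact (tailAugLin_zero C _).trans (C.hδ 0 x)
      · exact tailAugLin_succ C n _

/-- The contracting homotopy of the tail of a contracted complex. -/
noncomputable def tailHomotopy : (tail C).carrier →ₗ[k] (tail C).carrier :=
  totLiftK (X := fun n => C.X (n + 1)) (fun n => C.hδ (n + 1)) fun n =>
    -((tailIn C (n + 1)).restrictScalars k ∘ₗ C.η (n + 1))

theorem tailHomotopy_in (n : ℕ) (x : C.X (n + 1)) :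
    tailHomotopy C (tailIn C n x) = -tailIn C (n + 1) (C.η (n + 1) x) :=
  totLiftK_in (X := fun n => C.X (n + 1)) (fun n => C.hδ (n + 1)) _ n x

theorem tailHomotopy_smul (s : S.toDGAlg) (x : tail C) :
    tailHomotopy C (op (E.unit s) • x) = op (E.unit s) • tailHomotopy C x := by
  refine tail_induction (p := fun x =>
    tailHomotopy C (op (E.unit s) • x) = op (E.unit s) • tailHomotopy C x) (by simp)
    (fun x y hx hy => by rw [smul_add, map_add, hx, hy, map_add, smul_add]) ?_ x
  intro n _ x _
  rw [← map_smul, tailHomotopy_in, tailHomotopy_in, C.η_smul, map_smul, smul_neg]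

theorem tailHomotopy_mem {i : ℤ} {x : tail C} (hx : x ∈ (tail C).gr i) :
    tailHomotopy C x ∈ (tail C).gr (i - 1) := by
  have key : ∀ x, tailHomotopy C (proj (tail C).isInternal i x)
      = proj (tail C).isInternal (i - 1) (tailHomotopy C x) := fun x => by
    refine tail_induction (p := fun x => tailHomotopy C (proj (tail C).isInternal i x)
        = proj (tail C).isInternal (i - 1) (tailHomotopy C x)) (by simp)
      (fun x y hx hy => by simp only [map_add, hx, hy]) ?_ x
    · intro n p x hx
      have h1 := tailIn_mem C hx
      have h2 := tailIn_mem C (n := n + 1) (C.η_mem (n + 1) hx)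
      rw [tailHomotopy_in, map_neg]
      push_cast at h2
      by_cases h : p - n = i
      · rw [proj_of_mem _ (h ▸ h1), tailHomotopy_in, proj_of_mem]
        rwa [show i - 1 = p - (n + 1) by omega]
      · rw [proj_of_mem_ne _ h h1, proj_of_mem_ne _ (by omega) h2, map_zero, neg_zero]
  rw [← proj_of_mem (tail C).isInternal hx, key]
  exact proj_mem _ _ _

/-- The internal terms cancel, because the differential has the sign `-1` in index 1. What remains
is `-δ η x`, that is `η δ x - x`, and `δ x` is the augmentation. -/
theorem tailHomotopy_zero (x : C.X (0 + 1)) :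
    tailIn C 0 (C.η 0 (tailAugLin C (tailIn C 0 x))) - tailIn C 0 x
      = (tail C).d (tailHomotopy C (tailIn C 0 x))
        + tailHomotopy C ((tail C).d (tailIn C 0 x)) := by
  rw [tail_d_zero, tailHomotopy_in, tailHomotopy_in, map_neg, tail_d_succ, C.η_d, C.δ_η_succ,
    tailAugLin_zero, map_sub]
  simp only [zero_add, pow_one, neg_smul, one_smul]
  abel

/-- In positive index the augmentation vanishes. The internal terms cancel by the alternating sign,
and the others add up to `-(δ η + η δ)`, which is minus the identity. -/
theorem tailHomotopy_succ (n : ℕ) (x : C.X (n + 1 + 1)) :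
    -tailIn C (n + 1) x = (tail C).d (tailHomotopy C (tailIn C (n + 1) x))
        + tailHomotopy C ((tail C).d (tailIn C (n + 1) x)) := by
  have e1 : tailHomotopy C (tailIn C (n + 1) x)
      = -tailIn C (n + 1 + 1) (C.η (n + 1 + 1) x) :=
    tailHomotopy_in C (n + 1) x
  have e2 := tail_d_succ C (n + 1) (C.η (n + 1 + 1) x)
  have e3 := C.δ_η_succ (n + 1) x
  have e4 : tailHomotopy C (tailIn C (n + 1) ((C.X (n + 1 + 1)).d x))
      = -tailIn C (n + 1 + 1) (C.η (n + 1 + 1)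
        ((C.X (n + 1 + 1)).d x)) :=
    tailHomotopy_in C (n + 1) _
  have e5 := C.η_d (n + 1 + 1) x
  have e6 : (tail C).d (tailIn C (n + 1 + 1) (C.η (n + 1 + 1) x))
      = (-1 : k) ^ (n + 1 + 1) • tailIn C (n + 1 + 1) (C.η (n + 1 + 1)
        ((C.X (n + 1 + 1)).d x))
        + (tailIn C (n + 1) x - tailIn C (n + 1)
          (C.η (n + 1) ((C.δ (n + 1)).toLin x))) := by
    refine e2.trans (congrArg₂ _ (congrArg (fun t => (-1 : k) ^ (n + 1 + 1) •
      tailIn C (n + 1 + 1) t) e5) ?_)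
    rw [← map_sub]
    exact congrArg (tailIn C (n + 1)) e3
  rw [e1, map_neg, e6, tail_d_succ, map_add, map_smul, e4, tailHomotopy_in, pow_succ _ (n + 1)]
  simp only [mul_neg, mul_one, neg_smul, smul_neg]
  abel

/-- The augmentation of the tail of a contracted complex is a relative quasi-isomorphism. -/
theorem relQis_tailAug : relQis E (tailAug C) := by
  -- The homotopy inverse is `η 0` followed by the inclusion of index 0. It is linear over `S` only,
  -- which is all that a relative quasi-isomorphism requires.
  refine ⟨⟨⟨⟨fun m => tailIn C 0 (C.η 0 m), fun x y => ?_⟩, fun s x => ?_⟩,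
    fun {i m} hm => ?_, fun m => ?_⟩, ⟨⟨⟨tailHomotopy C, map_add _⟩,
      fun s x => tailHomotopy_smul C s.unop x⟩, fun i x hx => tailHomotopy_mem C hx, fun x => ?_⟩,
      ⟨0, fun _ _ _ => zero_mem _, fun m => ?_⟩⟩
  · exact (congrArg (tailIn C 0) (map_add (C.η 0) x y)).trans (map_add _ _ _)
  · exact (congrArg (tailIn C 0) (C.η_smul 0 s.unop x)).trans (map_smul _ _ _)
  · have := tailIn_mem C (n := 0) (C.η_mem 0 hm)
    rwa [Nat.cast_zero, sub_zero] at this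
  · exact (congrArg (tailIn C 0) (C.η_d 0 m)).symm.trans
      (tail_d_zero C _).symm
  · change tailIn C 0 (C.η 0 (tailAugLin C x)) - (show (tail C).carrier from x)
      = (tail C).d (tailHomotopy C x) + tailHomotopy C ((tail C).d x)
    refine tail_induction (p := fun x =>
      tailIn C 0 (C.η 0 (tailAugLin C x)) - x
        = (tail C).d (tailHomotopy C x) + tailHomotopy C ((tail C).d x)) ?_
      (fun x y hx hy => ?_) ?_ x
    · rw [map_zero, map_zero, map_zero, map_zero, map_zero, map_zero, add_zero, sub_zero]
    · have e : tailIn C 0 (C.η 0 (tailAugLin C (x + y)))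
          = tailIn C 0 (C.η 0 (tailAugLin C x))
            + tailIn C 0 (C.η 0 (tailAugLin C y)) := by
        rw [← map_add, map_add]
        exact congrArg (tailIn C 0) (map_add (C.η 0) _ _)
      rw [e, add_sub_add_comm, hx, hy]
      simp only [map_add]
      abel
    · rintro (_ | n) _ x _
      · exact tailHomotopy_zero C x
      · refine Eq.trans ?_ (tailHomotopy_succ C n x)
        rw [← zero_sub]
        refine congrArg (fun t => t - tailIn C (n + 1) x) ?_
        refine (congrArg (fun t => tailIn C 0 (C.η 0 t))
          (tailAugLin_succ C n x)).trans ?_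
        exact (congrArg (tailIn C 0) (map_zero (C.η 0))).trans (map_zero _)
  · change tailAugLin C (tailIn C 0 (C.η 0 m)) - (show (C.X 0).carrier from m) = (C.X 0).d 0 + 0
    have e : tailAugLin C (tailIn C 0 (C.η 0 m)) = m :=
      (tailAugLin_zero C _).trans (C.δ_η_zero m)
    exact (sub_eq_zero.2 e).trans (by simp)

end Contr

/-! The bar resolution. -/

section Bar

variable {S : CDGAlg k} (E : DGAlgebra S)

/-! ### Induction after restriction, as a comonad -/

section Comonad

variable (X : DGModule E.toDGAlg)

/-- The dg module induced from the restriction of a dg module. -/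
noncomputable def cob : DGModule E.toDGAlg := ind E ((DGModule.res E.unit).obj X)

/-- The unit `x ↦ 1 ⊗ x`. -/
noncomputable def cobEta : X.carrier →ₗ[k] (cob E X).carrier :=
  indEta E ((DGModule.res E.unit).obj X)

theorem cobEta_mem {i : ℤ} {x : X} (hx : x ∈ X.gr i) : cobEta E X x ∈ (cob E X).gr i :=
  indEta_mem E ((DGModule.res E.unit).obj X) hx

theorem cobEta_d (x : X) : (cob E X).d (cobEta E X x) = cobEta E X (X.d x) :=
  indEta_d E ((DGModule.res E.unit).obj X) x

theorem cobEta_smul (s : S.toDGAlg) (x : X) :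
    cobEta E X (op (E.unit s) • x) = op (E.unit s) • cobEta E X x :=
  indEta_smul E ((DGModule.res E.unit).obj X) s x

variable {E X}

theorem cob_ext {N : Type u} [AddCommGroup N] [Module E.toDGAlg.carrierᵐᵒᵖ N]
    {f g : (cob E X).carrier →ₗ[E.toDGAlg.carrierᵐᵒᵖ] N}
    (h : ∀ x : X, f (cobEta E X x) = g (cobEta E X x)) : f = g :=
  ind_ext h

/-- The commutator of a linear map with the differentials is linear, so compatibility with them need
only be checked on the generators `1 ⊗ x`. -/
theorem exists_cobLift {N : DGModule E.toDGAlg} (f : X.carrier →ₗ[k] N.carrier)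
    (hS : ∀ (s : S.toDGAlg) (x : X), f (op (E.unit s) • x) = op (E.unit s) • f x)
    (h0 : ∀ (i : ℤ) (x : X), x ∈ X.gr i → f x ∈ N.gr i) (hd : ∀ x, f (X.d x) = N.d (f x)) :
    ∃ g : cob E X ⟶ N, ∀ x, g.toLin (cobEta E X x) = f x := by
  obtain ⟨l, hl, he⟩ : ∃ l : (cob E X).carrier →ₗ[E.toDGAlg.carrierᵐᵒᵖ] N.carrier,
      LinDeg l 0 ∧ ∀ x, l (cobEta E X x) = f x :=
    ⟨indLift E ((DGModule.res E.unit).obj X) f hS,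
      linDeg_indLift E ((DGModule.res E.unit).obj X) f hS
        fun i y hy => by rw [add_zero]; exact h0 i y hy,
      fun x => indLift_eta E ((DGModule.res E.unit).obj X) f hS x⟩
  refine ⟨homOf l hl fun x => ?_, he⟩
  have key : DG.hd l hl = 0 := cob_ext fun y => by
    rw [hd_apply_zero, cobEta_d, he, he, LinearMap.zero_apply, sub_eq_zero, hd]
  have := LinearMap.congr_fun key x
  rw [hd_apply_zero, LinearMap.zero_apply, sub_eq_zero] at this
  exact this.symm

/-- The morphism on `cob E X` extending an `S`-linear chain map. -/
noncomputable def cobLift {N : DGModule E.toDGAlg} (f : X.carrier →ₗ[k] N.carrier)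
    (hS : ∀ (s : S.toDGAlg) (x : X), f (op (E.unit s) • x) = op (E.unit s) • f x)
    (h0 : ∀ (i : ℤ) (x : X), x ∈ X.gr i → f x ∈ N.gr i) (hd : ∀ x, f (X.d x) = N.d (f x)) :
    cob E X ⟶ N :=
  (exists_cobLift f hS h0 hd).choose

theorem cobLift_eta {N : DGModule E.toDGAlg} (f : X.carrier →ₗ[k] N.carrier) (hS h0 hd) (x : X) :
    (cobLift (E := E) f hS h0 hd).toLin (cobEta E X x) = f x :=
  (exists_cobLift f hS h0 hd).choose_spec x

end Comonad

/-! ### The augmented bar complex -/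

variable (M : DGModule E.toDGAlg)

/-- The terms of the augmented bar complex: `M`, and iterated induced modules. -/
noncomputable def barObj : ℕ → DGModule E.toDGAlg
  | 0 => M
  | n + 1 => cob E (barObj n)

/-- The differentials of the augmented bar complex. -/
noncomputable def barδ : ∀ n, cob E (barObj E M n) ⟶ barObj E M n
  | 0 => cobLift LinearMap.id (fun _ _ => rfl) (fun _ _ h => h) (fun _ => rfl)
  -- The value on `1 ⊗ x` is forced by the requirement `δ η + η δ = 1`, so the units form a
  -- contraction by construction.
  | n + 1 => cobLift (X := cob E (barObj E M n))
      (LinearMap.id - cobEta E (barObj E M n) ∘ₗ DGModule.Hom.klin (barδ n))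
      (fun s x => by
        change op (E.unit s) • x - cobEta E (barObj E M n) ((barδ n).toLin (op (E.unit s) • x))
          = op (E.unit s) • (x - cobEta E (barObj E M n) ((barδ n).toLin x))
        rw [map_smul, cobEta_smul, smul_sub])
      (fun i x hx => sub_mem hx (cobEta_mem E (barObj E M n) ((barδ n).map_mem hx)))
      (fun x => by
        change _ - cobEta E (barObj E M n) ((barδ n).toLin _) = (cob E (barObj E M n)).d
          (x - cobEta E (barObj E M n) ((barδ n).toLin x))
        rw [map_sub, cobEta_d, (barδ n).map_d]
        rfl)

theorem barδ_zero_eta (x : barObj E M 0) :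
    (barδ E M 0).toLin (cobEta E (barObj E M 0) x) = x :=
  cobLift_eta (X := barObj E M 0) _ _ _ _ x

theorem barδ_succ_eta (n : ℕ) (x : cob E (barObj E M n)) :
    (barδ E M (n + 1)).toLin (cobEta E (cob E (barObj E M n)) x)
      = x - cobEta E (barObj E M n) ((barδ E M n).toLin x) :=
  cobLift_eta (X := cob E (barObj E M n)) _ _ _ _ x

/-- By linearity it suffices to take `x = η y`. The composite is then `δ y - δ η δ y`; rewriting `δ
η` as `1 - η δ` leaves `η δ δ y`, which vanishes by induction. In index 0 one has `δ η = 1`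
directly. -/
theorem barδ_barδ (n : ℕ) (x : cob E (cob E (barObj E M n))) :
    (barδ E M n).toLin ((barδ E M (n + 1)).toLin x) = 0 := by
  induction n with
  | zero =>
    have : (barδ E M 0).toLin ∘ₗ (barδ E M 1).toLin = 0 :=
        cob_ext (X := cob E (barObj E M 0)) fun y => by
      change (barδ E M 0).toLin ((barδ E M 1).toLin (cobEta E (cob E (barObj E M 0)) y)) = 0
      rw [barδ_succ_eta, map_sub, barδ_zero_eta, sub_self]
    exact LinearMap.congr_fun this x
  | succ n ih =>
    have : (barδ E M (n + 1)).toLin ∘ₗ (barδ E M (n + 1 + 1)).toLin = 0 :=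
        cob_ext (X := cob E (barObj E M (n + 1))) fun y => by
      change (barδ E M (n + 1)).toLin
        ((barδ E M (n + 1 + 1)).toLin (cobEta E (cob E (barObj E M (n + 1))) y)) = 0
      rw [barδ_succ_eta, map_sub]
      refine sub_eq_zero.2 ((barδ_succ_eta E M n _).trans ?_).symm
      have e : cobEta E (barObj E M n) ((barδ E M n).toLin ((barδ E M (n + 1)).toLin y)) = 0 :=
        (congrArg (cobEta E (barObj E M n)) (ih y)).trans (map_zero _)
      exact (congrArg (fun t => (barδ E M (n + 1)).toLin y - t) e).trans (sub_zero _)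
    exact LinearMap.congr_fun this x

/-- The augmented bar complex. -/
noncomputable def barComplex : ContrComplex E where
  X := barObj E M
  δ := barδ E M
  hδ := barδ_barδ E M
  η n := cobEta E (barObj E M n)
  η_mem n _ _ h := cobEta_mem E (barObj E M n) h
  η_d n x := cobEta_d E (barObj E M n) x
  η_smul n s x := cobEta_smul E (barObj E M n) s x
  δ_η_zero := barδ_zero_eta E M
  δ_η_succ n x := barδ_succ_eta E M n x

variable {E M} in
-- The terms of the bar complex are induced from graded free `S`-modules, hence graded free over
-- `E`, and over `S` by transitivity. Freeness over `E` serves to lift graded maps, freeness over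
-- `S` to split the sequence of the reduction.
theorem exists_resolution
    (hE : ((DGModule.res E.unit).obj (DGModule.regular E.toDGAlg)).IsGradedFree)
    (hM : ((DGModule.res E.unit).obj M).IsGradedFree) :
    ∃ (P : DGModule E.toDGAlg) (s : P ⟶ M), IsRelProj E P ∧ P.IsGradedFree ∧
      ((DGModule.res E.unit).obj P).IsGradedFree ∧ relQis E s := by
  have h : ∀ n, ((DGModule.res E.unit).obj (barObj E M n)).IsGradedFree := by
    intro n
    induction n with
    | zero => exact hM
    | succ n ih => exact isGradedFree_res E.unit hE (isGradedFree_ind E _ ih)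
  have h' : (tail (barComplex E M)).IsGradedFree :=
    isGradedFree_tot _ fun n => isGradedFree_ind E _ (h n)
  exact ⟨tail (barComplex E M), tailAug (barComplex E M),
    isRelProj_tot _ fun n => isRelProj_ind E ((DGModule.res E.unit).obj (barObj E M n)), h',
    isGradedFree_res E.unit hE h', relQis_tailAug (barComplex E M)⟩

end Bar

/-! The reduction of dg modules along the augmentation. -/

theorem op_smul_smul {F : DGAlg k} (M : DGModule F) (c : k) (a : F) (m : M) :
    op (c • a) • m = c • op a • m := by
  rw [MulOpposite.op_smul, smul_assoc]

section Reduction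

variable {S : CDGAlg k} {R : AugCDGAlgebra S} (E : DGAlgebra R.toCDGAlg) (L : DGModule E.toDGAlg)

/-- Since `S` lifts to `R`, `l ⊗ s` equals `l s ⊗ 1`. -/
theorem redOne_surjective : Function.Surjective (redOne E L) := fun t => by
  refine tensor_induction (p := fun t => ∃ l, redOne E L l = t) ?_ ?_ t
  · intro i j l s _ _
    exact ⟨op (E.unit (R.unit s)) • l, (redOne_unit E L l (R.unit s)).trans
      (congrArg (tmk E L (augModule R) l) (R.aug_unit s))⟩
  · rintro _ _ ⟨l, rfl⟩ ⟨l', rfl⟩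
    exact ⟨l + l', map_add _ _ _⟩

theorem redOne_aug (l : L) (r : R.toDGAlg) :
    redOne E L (op (E.unit r) • l) = redOne E L (op (E.unit (R.unit (R.aug r))) • l) := by
  rw [redOne_unit, redOne_unit, R.aug_unit]

theorem sub_unit_aug_mem (r : R.toDGAlg) : r - R.unit (R.aug r) ∈ augKer R := by
  rw [mem_augKer, map_sub, R.aug_unit, sub_self]

variable {E L}

/-- Linear maps which vanish on `L n` factor through the reduction of `L`. -/
theorem exists_redLift {P : Type u} [AddCommGroup P] [Module k P] (ψ : L →ₗ[k] P)
    (hψ : ∀ x ∈ augKer R, ∀ l, ψ (op (E.unit x) • l) = 0) :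
    ∃ ψ' : TensorCarrier E L (augModule R) →ₗ[k] P, ∀ l, ψ' (redOne E L l) = ψ l := by
  have hψ' : ∀ (r : R.toDGAlg) (l : L),
      ψ (op (E.unit r) • l) = ψ (op (E.unit (R.unit (R.aug r))) • l) := fun r l => by
    rw [← sub_eq_zero, ← map_sub, ← sub_smul, ← MulOpposite.op_sub, ← map_sub]
    exact hψ _ (sub_unit_aug_mem r) l
  refine ⟨tlift (E := E) (M := L) (N := augModule R)
    (LinearMap.mk₂ k (M := L) (Nₗ := S.toDGAlg) (fun l s => ψ (op (E.unit (R.unit s)) • l))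
      (fun l l' s => by rw [smul_add, map_add])
      (fun c l s => by rw [smul_comm, map_smul])
      (fun l s s' => by rw [map_add, map_add, MulOpposite.op_add, add_smul, map_add])
      (fun c l s => by rw [map_smul R.unit.toAlgHom, map_smul E.unit.toAlgHom, op_smul_smul,
        map_smul])) ?_,
      fun l => ?_⟩
  · intro i j q r (s : S.toDGAlg) l hr hs hl
    have hs' : s ∈ S.gr j := hs
    change ψ (op (E.unit (R.unit s)) • op (E.unit r) • l)
      = (-1 : k) ^ (i * j) • ψ (op (E.unit (R.unit (s * R.aug r))) • l)
    have e : E.unit r * E.unit (R.unit s) = (-1 : k) ^ (i * j) • E.unit (R.unit s * r) := by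
      rw [← map_mul, R.comm hr (R.unit.map_mem hs'), map_smul]
    have e' : R.aug (R.unit s * r) = s * R.aug r := by rw [map_mul, R.aug_unit]
    rw [← mul_smul, ← op_mul, e, op_smul_smul, map_smul, hψ' (_ * _), e']
  · change ψ (op (E.unit (R.unit (1 : S.toDGAlg))) • l) = ψ l
    rw [map_one, map_one, op_one, one_smul]

/-- The quotient of `L` by the image of `L ⊗_R n` kills `L n`, so the class of `l` in it depends
only on `l ⊗ 1`. -/
theorem exists_kerIncl_eq {l : L} (hl : redOne E L l = 0) :
    ∃ t : TensorCarrier E L (kerModule R), kerInclAux E L t = l := by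
  obtain ⟨ψ, hψ⟩ := exists_redLift (LinearMap.range (kerInclAux E L)).mkQ fun x hx l =>
    (Submodule.Quotient.mk_eq_zero _).2 ⟨tmk E L (kerModule R) l ⟨x, hx⟩, rfl⟩
  have := hψ l
  rw [hl, map_zero] at this
  exact (Submodule.Quotient.mk_eq_zero _).1 this.symm

/-- The kernel of the reduction is `L n`, and `n² = 0`. -/
theorem smul_eq_zero_of_redOne (hn : SquareZero R) {l : L} (hl : redOne E L l = 0)
    {x : R.toDGAlg} (hx : x ∈ augKer R) : op (E.unit x) • l = 0 := by
  obtain ⟨t, rfl⟩ := exists_kerIncl_eq hl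
  refine tensor_induction (p := fun t => op (E.unit x) • kerInclAux E L t = 0) ?_ ?_ t
  · intro i j l y _ _
    rw [kerInclAux_tmk, ← mul_smul, ← op_mul, ← map_mul, hn _ (kerVal_mem R y) _ hx, map_zero,
      op_zero, zero_smul]
  · intro a b ha hb
    rw [map_add, smul_add, ha, hb, add_zero]

theorem smul_aug_of_redOne (hn : SquareZero R) {l : L} (hl : redOne E L l = 0) (r : R.toDGAlg) :
    op (E.unit r) • l = op (E.unit (R.unit (R.aug r))) • l := by
  rw [← sub_eq_zero, ← sub_smul, ← MulOpposite.op_sub, ← map_sub]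
  exact smul_eq_zero_of_redOne hn hl (sub_unit_aug_mem r)

/-- A basis of `L` over `R` presents `L ⊗_R n` as a quotient of a sum of copies of `n`, and the
composite into `L` is the inclusion of sums of `n` in sums of `R`. As this composite is injective,
only surjectivity of `Ψ` is needed. -/
theorem kerIncl_injective (hL : ((DGModule.res E.unit).obj L).IsGradedFree) :
    Function.Injective (kerInclAux E L) := by
  obtain ⟨ι, b, hb⟩ := hL
  let b' : ι → L := b
  let Ψ : (ι →₀ augKer R) →ₗ[k] TensorCarrier E L (kerModule R) :=
    Finsupp.lsum k fun i => tmk E L (kerModule R) (b' i)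
  have hΨ : ∀ i x, Ψ (Finsupp.single i x) = tmk E L (kerModule R) (b' i) x := fun i x =>
    Finsupp.lsum_single ..
  have hsurj : Function.Surjective Ψ := fun t => by
    refine tensor_induction (p := fun t => ∃ y, Ψ y = t) ?_ ?_ t
    · intro i j l x _ hx
      refine basis_induction b (p := fun l : L => ∃ y, Ψ y = tmk E L (kerModule R) l x)
        ⟨0, (map_zero _).trans
          (LinearMap.congr_fun (map_zero (tmk E L (kerModule R))) x).symm⟩ ?_ ?_ l
      · rintro l l' ⟨y, hy⟩ ⟨y', hy'⟩
        refine ⟨y + y', (map_add _ _ _).trans ((congrArg₂ _ hy hy').trans ?_)⟩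
        exact (LinearMap.congr_fun (map_add (tmk E L (kerModule R)) (show L from l)
          (show L from l')) x).symm
      · intro i' j' r hr
        exact ⟨Finsupp.single i' (show augKer R from
          (-1 : k) ^ (j' * j) • (op r • x : kerModule R)), (hΨ _ _).trans
            ((map_smul (tmk E L (kerModule R) (b' i')) _ _).trans
            (tmk_balanced E L (kerModule R) hr hx (b' i')).symm)⟩
    · rintro _ _ ⟨y, rfl⟩ ⟨y', rfl⟩
      exact ⟨y + y', map_add _ _ _⟩
  refine (injective_iff_map_eq_zero _).2 fun t ht => ?_
  obtain ⟨y, rfl⟩ := hsurj t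
  let ν : augKer R →ₗ[k] R.carrierᵐᵒᵖ := (opLinearEquiv k).toLinearMap ∘ₗ (augKer R).subtype
  have e : ∀ y, kerInclAux E L (Ψ y)
      = Finsupp.linearCombination R.carrierᵐᵒᵖ b (y.mapRange ν (map_zero ν)) := fun y => by
    induction y using Finsupp.induction_linear with
    | zero => simp; rfl
    | add y y' h h' =>
      rw [map_add, map_add, h, h', Finsupp.mapRange_add (by simp), map_add]
      rfl
    | single i x =>
      rw [hΨ, Finsupp.mapRange_single, Finsupp.linearCombination_single]
      rfl
  have h0 := linearIndependent_iff.1 b.linearIndependent _ ((e y).symm.trans ht)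
  have : y = 0 := by
    ext i
    have := congrArg unop (DFunLike.congr_fun h0 i)
    exact this
  rw [this, map_zero]

/-- Freeness of the reduction. -/
theorem isGradedFree_tensor_aug {F G : DGAlg k} (α : DGAlg.Hom F E.toDGAlg)
    (β : DGAlg.Hom G E.toDGAlg) (ψ : DGAlg.Hom F G)
    (h : ∀ (f : F) (l : L), redOne E L (op (α f) • l) = redOne E L (op (β (ψ f)) • l))
    (hk : ∀ x ∈ augKer R, ∃ f, ψ f = 0 ∧ α f = E.unit x)
    (hs : ∀ g, ∃ f, ψ f = g ∧ α f = β g)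
    (hL : ((DGModule.res α).obj L).IsGradedFree) :
    ((DGModule.res β).obj (tensorObj E L (augModule R))).IsGradedFree := by
  -- The algebra map `F ⟶ G` is left abstract because two instances are used: `R ⟶ S`, and the
  -- augmentation `A ⊗_S R ⟶ A`.
  obtain ⟨ι, b, hb⟩ := hL
  let X := (DGModule.res β).obj (tensorObj E L (augModule R))
  let j : ((DGModule.res α).obj L).carrier →ₗ[k] X.carrier := redOne E L
  have hβ : ∀ (g : G) (l : L), (op g • (show X.carrier from redOne E L l))
      = (show X.carrier from redOne E L (op (β g) • l)) := fun g l => redOne_act E L l (β g)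
  let φ : F.carrierᵐᵒᵖ →ₐ[k] G.carrierᵐᵒᵖ := AlgHom.op ψ.toAlgHom
  obtain ⟨b', hb'⟩ := exists_basis_of_universal φ j
    (fun f l => (h f.unop l).trans (hβ (ψ f.unop) l).symm)
    (by
      refine eq_top_iff.2 fun t _ => ?_
      obtain ⟨l, hl⟩ := redOne_surjective E L t
      exact Submodule.subset_span ⟨l, hl⟩) b (fun g hg => by
      obtain ⟨g', hg'⟩ := exists_redLift (E := E) (L := L) g fun x hx l => by
        obtain ⟨f, hf, hf'⟩ := hk x hx
        rw [← hf']
        refine (hg (op f) l).trans ?_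
        change op (ψ f) • _ = _
        rw [hf, op_zero, zero_smul]
      refine ⟨⟨⟨g', map_add g'⟩, fun c t => ?_⟩, hg'⟩
      induction c using MulOpposite.rec' with | _ c => ?_
      obtain ⟨l, rfl⟩ := redOne_surjective E L t
      obtain ⟨f, hf, hf'⟩ := hs c
      refine (congrArg g' (hβ c l)).trans ((hg' _).trans ?_)
      rw [← hf']
      refine (hg (op f) l).trans ?_
      change op (ψ f) • _ = op c • g' (redOne E L l)
      rw [hf, hg']
      rfl)
  refine ⟨ι, b', fun i => ?_⟩
  obtain ⟨p, hp⟩ := hb i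
  exact ⟨p, by rw [hb']; exact redOne_mem E L hp⟩

end Reduction

/-! The augmentation of `A ⊗_S R`. -/

section Augmented

variable {S : CDGAlg k} (A : DGAlgebra S) (R : AugCDGAlgebra S)

theorem tm_eq_mul (a : A.toDGAlg) (r : R.toDGAlg) :
    tm A R a r = inA A R a * (tAlg A R).unit r := by
  change _ = tm A R a 1 * tm A R 1 r
  rw [tm_mul_tm A R A.one_mem R.one_mem]
  simp

variable {A R} in
theorem tAlg_induction {p : (tAlg A R).toDGAlg → Prop}
    (hom : ∀ a r, p (inA A R a * (tAlg A R).unit r)) (add : ∀ x y, p x → p y → p (x + y))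
    (x : (tAlg A R).toDGAlg) : p x :=
  talg_induction (A := A) (R := R) (p := p) (fun _ _ a r _ _ => by
    have := hom a r
    rwa [← tm_eq_mul] at this) add x

/-- The linear map underlying the augmentation of `A ⊗_S R`. -/
noncomputable def tAugLin : TAlg A R →ₗ[k] A.toDGAlg :=
  talgLift (LinearMap.mk₂ k (M := A.toDGAlg) (Nₗ := R.toDGAlg)
    (fun a r => a * A.unit (R.aug r)) (fun _ _ _ => add_mul _ _ _)
    (fun _ _ _ => smul_mul_assoc _ _ _) (fun a r r' => by rw [map_add, map_add, mul_add])
    (fun c a r => by rw [map_smul, map_smul, mul_smul_comm])) <| by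
    intro i j s r a hs hr
    change a * A.unit s * A.unit (R.aug r) = (-1 : k) ^ (i * j) • (a * A.unit (R.aug (r * R.unit s)))
    rw [map_mul R.aug.toAlgHom, R.aug_unit, mul_assoc, ← map_mul,
      S.comm hs (R.aug.map_mem hr), map_smul, mul_smul_comm]

theorem tAugLin_tm (a : A.toDGAlg) (r : R.toDGAlg) :
    tAugLin A R (tm A R a r) = a * A.unit (R.aug r) := rfl

/-- The Koszul sign of the product in `A ⊗_S R` is the one which appears when the image of `S` is
moved past an element of `A`. -/
theorem tAugLin_mul (x y : TAlg A R) : tAugLin A R (x * y) = tAugLin A R x * tAugLin A R y := by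
  refine talg_induction (p := fun y =>
    tAugLin A R (x * y) = tAugLin A R x * tAugLin A R y) ?_ ?_ y
  · intro i j a r ha hr
    refine talg_induction (p := fun x =>
      tAugLin A R (x * tm A R a r) = tAugLin A R x * tAugLin A R (tm A R a r)) ?_ ?_ x
    · intro i' j' a' r' ha' hr'
      rw [tm_mul_tm A R ha hr', map_smul, tAugLin_tm, tAugLin_tm, tAugLin_tm,
        map_mul R.aug.toAlgHom, map_mul A.unit.toAlgHom, mul_assoc a' (A.unit _),
        ← mul_assoc (A.unit _) a, A.central (R.aug.map_mem hr') ha, smul_mul_assoc,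
        mul_smul_comm, mul_comm i j']
      simp only [mul_assoc]
    · intro x x' h h'
      simp only [add_mul, map_add, h, h']
  · intro y y' h h'
    simp only [mul_add, map_add, h, h']

/-- The augmentation `a ⊗ r ↦ a ε(r)` of `A ⊗_S R`. -/
noncomputable def tAug : DGAlg.Hom (tAlg A R).toDGAlg A.toDGAlg where
  toAlgHom := AlgHom.ofLinearMap (A := TAlg A R) (B := A.toDGAlg) (tAugLin A R)
    ((tAugLin_tm A R 1 1).trans (by rw [map_one, map_one, mul_one])) (tAugLin_mul A R)
  map_mem := fun {n x} hx => by
    refine tAlgGr_map (f := tAugLin A R) ?_ hx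
    rintro i j a r rfl ha hr
    exact A.mul_mem ha (A.unit.map_mem (R.aug.map_mem hr))
  map_d := fun x => by
    change tAugLin A R (tAlgD A R x) = A.d (tAugLin A R x)
    refine talg_induction (p := fun x => tAugLin A R (tAlgD A R x) = A.d (tAugLin A R x)) ?_ ?_ x
    · intro i j a r ha hr
      rw [tAlgD_tm A R ha, map_add, map_smul, tAugLin_tm, tAugLin_tm, tAugLin_tm, A.d_mul ha,
        ← A.unit.map_d, ← R.aug.map_d]
    · intro x y hx hy
      simp only [map_add, hx, hy]

theorem tAug_inA (a : A.toDGAlg) : tAug A R (inA A R a) = a := by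
  change a * A.unit (R.aug 1) = a
  rw [map_one, map_one, mul_one]

theorem tAug_unit (r : R.toDGAlg) : tAug A R ((tAlg A R).unit r) = A.unit (R.aug r) := by
  change 1 * A.unit (R.aug r) = A.unit (R.aug r)
  rw [one_mul]

variable {A R} (L : DGModule (tAlg A R).toDGAlg)

/-- `A ⊗_S R` acts on the reduction through its augmentation to `A`. -/
theorem redOne_tAug (l : L) (b : (tAlg A R).toDGAlg) :
    redOne (tAlg A R) L (op b • l) = redOne (tAlg A R) L (op (inA A R (tAug A R b)) • l) := by
  refine tAlg_induction (p := fun b => ∀ l, redOne (tAlg A R) L (op b • l)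
    = redOne (tAlg A R) L (op (inA A R (tAug A R b)) • l)) ?_ ?_ b l
  · intro a r l
    rw [map_mul (tAug A R).toAlgHom, tAug_inA, tAug_unit, map_mul (inA A R).toAlgHom, inA_unit,
      op_mul, op_mul, mul_smul, mul_smul, redOne_aug]
  · intro x y hx hy l
    rw [map_add, map_add, MulOpposite.op_add, MulOpposite.op_add, add_smul, add_smul, map_add,
      map_add, hx, hy]

variable {L} in
-- Because `n² = 0`, the action on `L n` also factors through `A`. This is why `A`-linear maps from
-- a reduction to `L n` define `A ⊗_S R`-linear maps.
theorem smul_tAug_of_redOne (hn : SquareZero R) {l : L} (hl : redOne (tAlg A R) L l = 0)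
    (b : (tAlg A R).toDGAlg) : op b • l = op (inA A R (tAug A R b)) • l := by
  refine tAlg_induction (p := fun b => op b • l = op (inA A R (tAug A R b)) • l) ?_ ?_ b
  · intro a r
    rw [map_mul (tAug A R).toAlgHom, tAug_inA, tAug_unit, map_mul (inA A R).toAlgHom, inA_unit,
      op_mul, op_mul, mul_smul, mul_smul]
    refine smul_aug_of_redOne hn ?_ r
    rw [← redOne_act, hl]
    simp
  · intro x y hx hy
    rw [map_add, map_add, MulOpposite.op_add, MulOpposite.op_add, add_smul, add_smul, hx, hy]

/-- The projection `L ⟶ L ⊗_R S` of dg `A`-modules. -/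
noncomputable def toRed : (resA A R).obj L ⟶ (redFunctor A R).obj L :=
  (resA A R).map (redProj (tAlg A R) L)

theorem toRed_surjective : Function.Surjective (toRed L).toLin := redOne_surjective (tAlg A R) L

theorem toRed_smul (l : L) (b : (tAlg A R).toDGAlg) : (toRed L).toLin (op b • l)
    = op (tAug A R b) • (toRed L).toLin l :=
  (redOne_tAug L l b).trans (redOne_act (tAlg A R) L l _).symm

/-- The inclusion of `L ⊗_R n` in `L`, as a morphism of dg `A`-modules. -/
noncomputable def ofKer : (resA A R).obj (tensorObj (tAlg A R) L (kerModule R)) ⟶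
    (resA A R).obj L :=
  (resA A R).map (kerIncl (tAlg A R) L)

theorem toRed_ofKer (t) : (toRed L).toLin ((ofKer L).toLin t) = 0 :=
  redProj_kerIncl (tAlg A R) L t

theorem exists_ofKer_eq {l : L} (hl : (toRed L).toLin l = 0) : ∃ t, (ofKer L).toLin t = l :=
  exists_kerIncl_eq hl

theorem isGradedFree_red_unit (hL : ((DGModule.res (tAlg A R).unit).obj L).IsGradedFree) :
    ((DGModule.res A.unit).obj ((redFunctor A R).obj L)).IsGradedFree := by
  let β : DGAlg.Hom S.toDGAlg (tAlg A R).toDGAlg :=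
    { toAlgHom := (inA A R).toAlgHom.comp A.unit.toAlgHom
      map_mem := fun h => (inA A R).map_mem (A.unit.map_mem h)
      map_d := fun s => (congrArg (inA A R) (A.unit.map_d s)).trans ((inA A R).map_d _) }
  have hβ : ∀ s, β s = (tAlg A R).unit (R.unit s) := inA_unit A R
  have := isGradedFree_tensor_aug (tAlg A R).unit β R.aug
    (fun r l => by rw [hβ, redOne_aug]) (fun x hx => ⟨x, hx, rfl⟩)
    (fun s => ⟨R.unit s, R.aug_unit s, (hβ s).symm⟩) hL
  exact this

theorem isGradedFree_red (hL : L.IsGradedFree) : ((redFunctor A R).obj L).IsGradedFree := by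
  let α : DGAlg.Hom (tAlg A R).toDGAlg (tAlg A R).toDGAlg :=
    { toAlgHom := AlgHom.id k _
      map_mem := id
      map_d := fun _ => rfl }
  exact isGradedFree_tensor_aug α (inA A R) (tAug A R) (fun b l => redOne_tAug L l b)
    (fun x hx => ⟨(tAlg A R).unit x, by
      rw [tAug_unit, (mem_augKer R).1 hx, map_zero], rfl⟩)
    (fun a => ⟨inA A R a, tAug_inA A R a, rfl⟩) hL

/-- The reduction of a relatively projective dg module is relatively projective. -/
theorem isRelProj_red {L : DGModule (tAlg A R).toDGAlg} (hL : IsRelProj (tAlg A R) L) :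
    IsRelProj A ((redFunctor A R).obj L) := by
  intro N hN q φ hφ h0
  obtain ⟨c, hc, hc', hc''⟩ := hN
  -- Reduction is left adjoint to restriction along the augmentation. Restriction preserves relative
  -- contractibility, the contraction being `R`-linear through `R ⟶ S`.
  let N' := (DGModule.res (tAug A R)).obj N
  have hN' : IsRelContr (tAlg A R) N' := ⟨c, fun r m => by
    change c (op (tAug A R ((tAlg A R).unit r)) • (show N.carrier from m))
      = op (tAug A R ((tAlg A R).unit r)) • c m
    rw [tAug_unit, hc], hc', hc''⟩
  let φ' : L.carrier →ₗ[(tAlg A R).toDGAlg.carrierᵐᵒᵖ] N'.carrier :=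
    { toFun := fun l => φ ((toRed L).toLin l)
      map_add' := fun l l' => (congrArg φ (map_add (toRed L).toLin l l')).trans (map_add φ _ _)
      map_smul' := fun b l => (congrArg φ (toRed_smul L l b.unop)).trans (map_smul φ _ _) }
  have hφ' : LinDeg φ' q := fun i l hl => hφ i _ ((toRed L).map_mem hl)
  have hd' : ∀ l, hd φ' hφ' l = hd φ hφ ((toRed L).toLin l) := fun l => by
    rw [hd_apply, hd_apply]
    exact congrArg (fun t => N.d (φ ((toRed L).toLin l)) - (-1 : k) ^ q • φ t) ((toRed L).map_d l)
  obtain ⟨ψ, hψ, H⟩ := hL N' hN' q φ' hφ' fun l => (hd' l).trans (h0 _)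
  let ψA : ((resA A R).obj L).carrier →ₗ[A.toDGAlg.carrierᵐᵒᵖ] N.carrier :=
    { toFun := ψ
      map_add' := ψ.map_add
      map_smul' := fun a l => (ψ.map_smul (op (inA A R a.unop)) l).trans
        (congrArg (fun b => op b • (show N.carrier from ψ l)) (tAug_inA A R a.unop)) }
  -- The primitive vanishes on `L n` because `n` acts by zero on `N'`.
  obtain ⟨ψ', hψ', e⟩ := exists_descend (toRed L) (toRed_surjective L) ψA hψ fun l hl => by
    obtain ⟨t, rfl⟩ := exists_ofKer_eq L hl
    refine tensor_induction (E := tAlg A R) (M := L) (N := kerModule R)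
      (p := fun t => ψ (kerInclAux (tAlg A R) L t) = 0) ?_ ?_ t
    · intro i j l x _ _
      refine (map_smul ψ (op ((tAlg A R).unit (kerVal R x))) l).trans ?_
      change op (tAug A R ((tAlg A R).unit (kerVal R x))) • (show N.carrier from ψ l) = 0
      rw [tAug_unit, kerVal_mem, map_zero, op_zero, zero_smul]
    · intro t t' h h'
      rw [map_add]
      exact (map_add ψ _ _).trans ((congrArg₂ _ h h').trans (add_zero _))
  refine ⟨ψ', hψ', fun y => ?_⟩
  obtain ⟨l, rfl⟩ := toRed_surjective L y
  refine Eq.trans ?_ (H l)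
  rw [hd_apply, ← (toRed L).map_d]
  exact congrArg₂ (fun s t => N.d s - (-1 : k) ^ (q - 1) • t) (e l) (e (L.d l))

end Augmented

/-! The exact sequence of a deformation. -/

section ExactSequence

variable {S : CDGAlg k} {A : DGAlgebra S} {R : AugCDGAlgebra S} (hn : SquareZero R)
  {L : DGModule (tAlg A R).toDGAlg}

theorem redTensor_induction {p : RedTensor A R L → Prop}
    (hom : ∀ (l : L) (x : augKer R), p (redTmk A R L l x))
    (add : ∀ x y, p x → p y → p (x + y)) (t : RedTensor A R L) : p t := by
  refine tensor_induction (p := p) (fun i j y x _ _ => ?_) add t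
  obtain ⟨l, rfl⟩ := toRed_surjective L y
  exact hom l x

theorem theta_surjective : Function.Surjective (theta A R L hn).toLin := fun t =>
  redTensor_induction (p := fun t => ∃ s, (theta A R L hn).toLin s = t)
    (fun l x => ⟨tmk (tAlg A R) L (kerModule R) l x, rfl⟩)
    (by
      rintro _ _ ⟨s, rfl⟩ ⟨s', rfl⟩
      exact ⟨s + s', map_add _ _ _⟩) t

/-- For fixed `x` in `n`, the map `l ↦ l x` kills `L n` because `n² = 0`, so it factors through the
reduction. -/
theorem exists_redTensorLift (hn : SquareZero R) : ∃ J : RedTensor A R L →ₗ[k] L,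
    ∀ l x, J (redTmk A R L l x) = op ((tAlg A R).unit x.1) • l := by
  obtain ⟨J, hJ⟩ := exists_redLift (E := tAlg A R) (L := L) (P := augKer R →ₗ[k] L)
    (LinearMap.mk₂ k (M := L) (Nₗ := augKer R) (fun l x => op ((tAlg A R).unit x.1) • l)
      (fun l l' x => smul_add _ _ _) (fun c l x => smul_comm _ _ _)
      (fun l x x' => by
        change op ((tAlg A R).unit (x.1 + x'.1)) • l = _
        rw [map_add, MulOpposite.op_add, add_smul])
      (fun c l x => by
        change op ((tAlg A R).unit (c • x.1)) • l = _
        rw [map_smul, op_smul_smul])) (fun x hx l => by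
      ext y
      change op ((tAlg A R).unit y.1) • op ((tAlg A R).unit x) • l = 0
      rw [← mul_smul, ← op_mul, ← map_mul, hn _ hx _ y.2, map_zero, op_zero, zero_smul])
  refine ⟨tlift (E := A) (M := (redFunctor A R).obj L) (N := kerModuleS R) J ?_, fun l x => ?_⟩
  · intro i j q s (x : augKer R) y hs hx hy
    have hx' : x.1 ∈ R.gr j := hx
    obtain ⟨l, rfl⟩ : ∃ l : L, (toRed L).toLin l = y := toRed_surjective L y
    have e : (op (A.unit s) • (toRed L).toLin l : (redFunctor A R).obj L)
        = redOne (tAlg A R) L (op ((tAlg A R).unit (R.unit s)) • l) := by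
      rw [← inA_unit]
      exact redOne_act (tAlg A R) L l _
    refine (congrArg (fun t => J t x) e).trans ?_
    refine (LinearMap.congr_fun (hJ _) x).trans ?_
    refine Eq.trans ?_ (congrArg (fun t => (-1 : k) ^ (i * j) • t)
      (LinearMap.congr_fun (hJ l) (show augKer R from
        (op s • (show (kerModuleS R).carrier from x) : (kerModuleS R).carrier)))).symm
    change op ((tAlg A R).unit x.1) • op ((tAlg A R).unit (R.unit s)) • l
      = (-1 : k) ^ (i * j) • (op ((tAlg A R).unit (x.1 * R.unit s)) • l)
    rw [← mul_smul, ← op_mul, ← map_mul, R.comm (R.unit.map_mem hs) hx', map_smul, op_smul_smul]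
  · exact LinearMap.congr_fun (hJ l) x

variable (hL : ((DGModule.res (tAlg A R).unit).obj L).IsGradedFree)

theorem ofKer_injective (hL : ((DGModule.res (tAlg A R).unit).obj L).IsGradedFree) : Function.Injective (ofKer L).toLin := kerIncl_injective hL

/-- Composing with `(l ⊗ 1) ⊗ x ↦ l x` gives the inclusion of `L ⊗_R n` in `L`, which is injective
by freeness. -/
theorem theta_bijective (hL : ((DGModule.res (tAlg A R).unit).obj L).IsGradedFree) :
    Function.Bijective (theta A R L hn).toLin := by
  refine ⟨fun t t' h => ?_, theta_surjective hn⟩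
  obtain ⟨J, hJ⟩ := exists_redTensorLift (A := A) (L := L) hn
  have e : ∀ t, J ((theta A R L hn).toLin t) = (ofKer L).toLin t := fun t =>
    tensor_induction (E := tAlg A R) (M := L) (N := kerModule R)
      (p := fun t => J ((theta A R L hn).toLin t) = (ofKer L).toLin t)
      (fun _ _ l x _ _ => hJ l x) (fun x y hx hy => by
        refine (congrArg J (map_add (theta A R L hn).toLin x y)).trans ((map_add J _ _).trans ?_)
        exact (congrArg₂ _ hx hy).trans (map_add (ofKer L).toLin x y).symm) t
  exact ofKer_injective hL ((e t).symm.trans ((congrArg J h).trans (e t')))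

/-- The inverse of the canonical morphism `L ⊗_R n ⟶ (L ⊗_R S) ⊗_S n`. -/
noncomputable def thetaInv (hL : ((DGModule.res (tAlg A R).unit).obj L).IsGradedFree) :
    tensorObj A ((redFunctor A R).obj L) (kerModuleS R) ⟶
      (resA A R).obj (tensorObj (tAlg A R) L (kerModule R)) :=
  (exists_inverse (theta A R L hn) (theta_bijective hn hL)).choose

theorem theta_thetaInv (t) : (theta A R L hn).toLin ((thetaInv hn hL).toLin t) = t :=
  LinearMap.congr_fun (congrArg DGModule.Hom.toLin
    (exists_inverse (theta A R L hn) (theta_bijective hn hL)).choose_spec.2) t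

theorem thetaInv_theta (t) : (thetaInv hn hL).toLin ((theta A R L hn).toLin t) = t :=
  LinearMap.congr_fun (congrArg DGModule.Hom.toLin
    (exists_inverse (theta A R L hn) (theta_bijective hn hL)).choose_spec.1) t

/-- The morphism `(L ⊗_R S) ⊗_S n ⟶ L`, `(l ⊗ 1) ⊗ x ↦ l x`. -/
noncomputable def redIncl : tensorObj A ((redFunctor A R).obj L) (kerModuleS R) ⟶
    (resA A R).obj L :=
  thetaInv hn hL ≫ ofKer L

theorem redIncl_injective : Function.Injective (redIncl hn hL).toLin := fun t t' h => by
  have := congrArg (theta A R L hn).toLin (ofKer_injective hL h)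
  rwa [theta_thetaInv, theta_thetaInv] at this

theorem redIncl_theta (t) : (redIncl hn hL).toLin ((theta A R L hn).toLin t) = (ofKer L).toLin t :=
  congrArg (ofKer L).toLin (thetaInv_theta hn hL t)

theorem redIncl_redTmk (l : L) (x : augKer R) :
    (redIncl hn hL).toLin (redTmk A R L l x) = op ((tAlg A R).unit x.1) • l :=
  redIncl_theta hn hL (tmk (tAlg A R) L (kerModule R) l x)

theorem toRed_redIncl (t) : (toRed L).toLin ((redIncl hn hL).toLin t) = 0 := toRed_ofKer L _

theorem exists_redIncl_eq {l : L} (hl : (toRed L).toLin l = 0) :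
    ∃ t, (redIncl hn hL).toLin t = l := by
  obtain ⟨t, rfl⟩ := exists_ofKer_eq L hl
  exact ⟨(theta A R L hn).toLin t, redIncl_theta hn hL t⟩

/-- The morphism from the cone of the kernel of a surjection which splits over graded modules is
a homotopy equivalence. -/
theorem isHomotopyEquiv_coneDesc {E : DGAlg k} {X Y Z : DGModule E} (i : X ⟶ Y) (p : Y ⟶ Z)
    (hpi : ∀ x, p.toLin (i.toLin x) = 0) (hi : Function.Injective i.toLin)
    (hp : Function.Surjective p.toLin) (hker : ∀ y, p.toLin y = 0 → ∃ x, i.toLin x = y)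
    (hZ : Z.IsGradedFree) : DGModule.IsHomotopyEquiv (coneDesc i p hpi) := by
  -- Freeness of `Z` gives a graded section `σ`. From it come a graded retraction `ρ` of `i`, and
  -- the map `α` with `i α = σ d - d σ`, which measures the failure of `σ` to be a chain map.
  obtain ⟨σ, hσ, hpσ⟩ := exists_lift hZ p hp LinearMap.id (q := 0)
    (fun i m hm => by rw [add_zero]; exact hm)
  have hpσ' : ∀ z, p.toLin (σ z) = z := hpσ
  obtain ⟨ρ, hρ, hiρ⟩ := exists_factor (M := Y) i hi (LinearMap.id - σ ∘ₗ p.toLin) (q := 0)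
    (fun j y hy => sub_mem (by rw [add_zero]; exact hy) (hσ _ _ (p.map_mem hy)))
    (fun y => hker _ (by
      change p.toLin (y - σ (p.toLin y)) = 0
      rw [map_sub, hpσ', sub_self]))
  have hiρ' : ∀ y, i.toLin (ρ y) = y - σ (p.toLin y) := hiρ
  obtain ⟨α, hα, hiα⟩ := exists_factor (M := Z) i hi (-hd σ hσ) (q := 1)
    (fun j z hz => neg_mem (linDeg_hd σ hσ rfl j z hz)) (fun z => hker _ (by
      change p.toLin (-(hd σ hσ z)) = 0
      rw [hd_apply_zero, map_neg, map_sub, p.map_d, hpσ', hpσ', sub_self, neg_zero]))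
  have hiα' : ∀ z, i.toLin (α z) = σ (Z.d z) - Y.d (σ z) := fun z => by
    rw [hiα, LinearMap.neg_apply, hd_apply_zero, neg_sub]
  have hρi : ∀ x, ρ (i.toLin x) = x := fun x => hi (by rw [hiρ', hpi, map_zero, sub_zero])
  have hρd : ∀ y, ρ (Y.d y) = X.d (ρ y) - α (p.toLin y) := fun y => hi (by
    rw [map_sub, hiα', hiρ', i.map_d, hiρ', map_sub, p.map_d]
    abel)
  -- In the cone, the defect of `σ` is compensated by the component `α`. The homotopy for the other
  -- composite is `(x, y) ↦ (-ρ y, 0)`.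
  let g : Z ⟶ DGModule.cone i :=
    { toLin := LinearMap.prod α σ
      map_mem := fun {j z} hz => ⟨hα j z hz, by
        have := hσ j z hz
        rwa [add_zero] at this⟩
      map_d := fun z => Prod.ext (hi (by
        change i.toLin (α (Z.d z)) = i.toLin (-X.d (α z))
        rw [map_neg, i.map_d, hiα', hiα', Z.d_d, map_sub, map_zero, Y.d_d]
        abel)) (by
        change σ (Z.d z) = i.toLin (α z) + Y.d (σ z)
        rw [hiα', sub_add_cancel]) }
  refine ⟨g, ⟨-LinearMap.prod (ρ ∘ₗ LinearMap.snd _ X.carrier Y.carrier) 0, ?_, ?_⟩, ?_⟩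
  · rintro j ⟨x, y⟩ ⟨hx, hy⟩
    refine neg_mem (S := Submodule k (X.carrier × Y.carrier)) ⟨?_, zero_mem _⟩
    have := hρ j y hy
    change ρ y ∈ X.gr (j - 1 + 1)
    rwa [sub_add_cancel, ← add_zero j]
  · rintro ⟨x, y⟩
    refine Prod.ext ?_ ?_
    · change α (p.toLin y) - x = -X.d (-ρ y) + -ρ (i.toLin x + Y.d y)
      rw [map_add, hρi, hρd, map_neg]
      abel
    · change σ (p.toLin y) - y = i.toLin (-ρ y) + Y.d (-0) + -0
      rw [map_neg, hiρ', neg_zero, map_zero]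
      abel
  · have : g ≫ coneDesc i p hpi = 𝟙 Z := by
      ext z
      exact hpσ' z
    rw [this]
    exact homotopic_refl _

/-- The reduction is graded free over `S`, so `isHomotopyEquiv_coneDesc` applies to the sequence
restricted to `S`. The final repackaging identifies the cone of the restriction with the restriction
of the cone. -/
theorem relQis_charRed (hL : ((DGModule.res (tAlg A R).unit).obj L).IsGradedFree) :
    relQis A (charRed A R L) := by
  have h := isHomotopyEquiv_coneDesc ((DGModule.res A.unit).map (ofKer L))
    ((DGModule.res A.unit).map (toRed L)) (toRed_ofKer L) (ofKer_injective hL)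
    (toRed_surjective L) (fun _ => exists_ofKer_eq L) (isGradedFree_red_unit L hL)
  obtain ⟨g, ⟨h₁, hd₁, H₁⟩, ⟨h₂, hd₂, H₂⟩⟩ := h
  exact ⟨⟨⟨⟨g.toLin, map_add g.toLin⟩, map_smul g.toLin⟩, g.map_mem, g.map_d⟩,
    ⟨⟨⟨h₁, map_add h₁⟩, map_smul h₁⟩, hd₁, H₁⟩, ⟨⟨⟨h₂, map_add h₂⟩, map_smul h₂⟩, hd₂, H₂⟩⟩

end ExactSequence

/-! The connecting morphism. -/

section Connecting

variable {S : CDGAlg k} {A : DGAlgebra S} {R : AugCDGAlgebra S} (hn : SquareZero R)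

/-- The dg `A`-module `(X ⊗_S n)[1]`. -/
noncomputable abbrev shiftKer (R : AugCDGAlgebra S) (X : DGModule A.toDGAlg) :
    DGModule A.toDGAlg :=
  DGModule.shift.obj (tensorObj A X (kerModuleS R))

/-- The morphism `(f ⊗_S n)[1]`. -/
noncomputable abbrev shiftKerMap (R : AugCDGAlgebra S) {X Y : DGModule A.toDGAlg} (f : X ⟶ Y) :
    shiftKer R X ⟶ shiftKer R Y :=
  DGModule.shift.map (tensorHom A (kerModuleS R) f)

variable {L L' : DGModule (tAlg A R).toDGAlg}
  (hL : ((DGModule.res (tAlg A R).unit).obj L).IsGradedFree)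
  (hL' : ((DGModule.res (tAlg A R).unit).obj L').IsGradedFree)

/-- As `charRed` becomes invertible, its defining equation determines the connecting morphism. -/
theorem exists_connecting (hL : ((DGModule.res (tAlg A R).unit).obj L).IsGradedFree) :
    ∃ ε : (relQ A).obj ((redFunctor A R).obj L) ⟶
      (tensorShift A (kerModuleS R)).obj ((relQ A).obj ((redFunctor A R).obj L)),
      ∀ ε', (relQ A).map (charRed A R L) ≫ ε' = (relQ A).map (charBoundary A R L hn) ↔ ε = ε' := by
  have := (relQis A).Q_inverts _ (relQis_charRed hL)
  refine ⟨inv ((relQ A).map (charRed A R L)) ≫ (relQ A).map (charBoundary A R L hn), fun ε' => ?_⟩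
  exact eq_comm.trans (IsIso.inv_comp_eq _).symm

/-- The connecting morphism `L ⊗_R S ⟶ ((L ⊗_R S) ⊗_S n)[1]`. -/
noncomputable def connecting (hL : ((DGModule.res (tAlg A R).unit).obj L).IsGradedFree) :
    (relQ A).obj ((redFunctor A R).obj L) ⟶
      (tensorShift A (kerModuleS R)).obj ((relQ A).obj ((redFunctor A R).obj L)) :=
  (exists_connecting hn hL).choose

theorem eq_connecting_iff (ε') :
    (relQ A).map (charRed A R L) ≫ ε' = (relQ A).map (charBoundary A R L hn) ↔
      connecting hn hL = ε' :=
  (exists_connecting hn hL).choose_spec ε'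

theorem charRed_connecting :
    (relQ A).map (charRed A R L) ≫ connecting hn hL = (relQ A).map (charBoundary A R L hn) :=
  (eq_connecting_iff hn hL _).2 rfl

/-- The composition of the connecting morphism with a morphism of dg modules which lifts to a
linear map `g` with values in `L` is represented by the differential of `g`. -/
theorem map_connecting {Z : DGModule A.toDGAlg} (φ : Z ⟶ (redFunctor A R).obj L)
    (g : Z.carrier →ₗ[A.toDGAlg.carrierᵐᵒᵖ] ((resA A R).obj L).carrier) (hg : LinDeg g 0)
    (hφ : ∀ z, (toRed L).toLin (g z) = φ.toLin z) (f : Z ⟶ shiftKer R ((redFunctor A R).obj L))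
    (hf : ∀ z, (redIncl hn hL).toLin (f.toLin z) = hd g hg z) :
    (relQ A).map φ ≫ connecting hn hL = (relQ A).map f := by
  have hf1 : ∀ z, f.toLin (Z.d z) = -(tensorObj A ((redFunctor A R).obj L) (kerModuleS R)).d
    (f.toLin z) := f.map_d
  have hf2 : ∀ z, (ofKer L).toLin ((thetaInv hn hL).toLin (f.toLin z)) = hd g hg z := hf
  -- `z ↦ (-θ⁻¹ f z, g z)` is a chain map to the cone exactly because `f` is the commutator of `g`.
  -- Its projection is `φ` and its boundary is `f`.
  let G : Z ⟶ charCone A R L :=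
    { toLin := LinearMap.prod (-((thetaInv hn hL).toLin ∘ₗ f.toLin)) g
      map_mem := fun {i z} hz => ⟨neg_mem ((thetaInv hn hL).map_mem (f.map_mem hz)), by
        have := hg i z hz
        rwa [add_zero] at this⟩
      map_d := fun z => Prod.ext (by
        change -(thetaInv hn hL).toLin (f.toLin (Z.d z))
          = -((resA A R).obj (tensorObj (tAlg A R) L (kerModule R))).d
            (-(thetaInv hn hL).toLin (f.toLin z))
        refine (congrArg (fun t => -(thetaInv hn hL).toLin t) (hf1 z)).trans ?_
        refine (congrArg Neg.neg ((map_neg _ _).trans (congrArg Neg.neg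
          ((thetaInv hn hL).map_d _)))).trans ?_
        rw [map_neg]) (by
        change g (Z.d z) = (ofKer L).toLin (-(thetaInv hn hL).toLin (f.toLin z))
          + ((resA A R).obj L).d (g z)
        rw [map_neg, hf2, hd_apply_zero]
        abel) }
  have e1 : G ≫ charRed A R L = φ := by
    ext z
    exact hφ z
  have e2 : G ≫ charBoundary A R L hn = f := by
    ext z
    change (theta A R L hn).toLin (-(-(thetaInv hn hL).toLin (f.toLin z))) = f.toLin z
    rw [neg_neg]
    exact theta_thetaInv hn hL _
  rw [← e1, ← e2, Functor.map_comp, Functor.map_comp, Category.assoc, charRed_connecting]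
  rfl

/-- Since `φ` is a chain map, the commutator of its graded lift `g` vanishes in the reduction, hence
comes from `(L ⊗_R S) ⊗_S n`. -/
theorem exists_map_connecting {Z : DGModule A.toDGAlg} (φ : Z ⟶ (redFunctor A R).obj L)
    (g : Z.carrier →ₗ[A.toDGAlg.carrierᵐᵒᵖ] ((resA A R).obj L).carrier) (hg : LinDeg g 0)
    (hφ : ∀ z, (toRed L).toLin (g z) = φ.toLin z) :
    ∃ f : Z ⟶ shiftKer R ((redFunctor A R).obj L),
      (∀ z, (redIncl hn hL).toLin (f.toLin z) = hd g hg z) ∧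
        (relQ A).map φ ≫ connecting hn hL = (relQ A).map f := by
  have hker : ∀ z, (toRed L).toLin (hd g hg z) = 0 := fun z => by
    rw [hd_apply_zero, map_sub, (toRed L).map_d, hφ, hφ, φ.map_d, sub_self]
  obtain ⟨f, hf, e⟩ := exists_factor (M := Z) (redIncl hn hL) (redIncl_injective hn hL) (hd g hg)
    (linDeg_hd g hg rfl) fun z => exists_redIncl_eq hn hL (hker z)
  let f' : Z ⟶ shiftKer R ((redFunctor A R).obj L) :=
    { toLin := f
      map_mem := fun hz => hf _ _ hz
      map_d := fun z => redIncl_injective hn hL (by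
        change (redIncl hn hL).toLin (f (Z.d z)) = (redIncl hn hL).toLin
          (-(tensorObj A ((redFunctor A R).obj L) (kerModuleS R)).d (f z))
        rw [map_neg, (redIncl hn hL).map_d, e, e, hd_apply_zero, hd_apply_zero, Z.d_d, map_zero,
          map_sub, DGModule.d_d, zero_sub, sub_zero, neg_neg]) }
  exact ⟨f', e, map_connecting hn hL φ g hg hφ f' e⟩

/-- The lift `w` need not commute with the differentials: linearity gives `w (l x) = w(l) x`, and
the right side depends only on the reduction of `w`. -/
theorem redIncl_naturality (w : L.carrier →ₗ[(tAlg A R).toDGAlg.carrierᵐᵒᵖ] L'.carrier)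
    (φ : (redFunctor A R).obj L ⟶ (redFunctor A R).obj L')
    (hw : ∀ l, (toRed L').toLin (w l) = φ.toLin ((toRed L).toLin l)) (t) :
    (redIncl hn hL').toLin ((tensorHom A (kerModuleS R) φ).toLin t)
      = w ((redIncl hn hL).toLin t) :=
  redTensor_induction (p := fun t =>
    (redIncl hn hL').toLin ((tensorHom A (kerModuleS R) φ).toLin t)
      = w ((redIncl hn hL).toLin t))
    (fun l x => (congrArg (fun y => (redIncl hn hL').toLin
      (tmk A ((redFunctor A R).obj L') (kerModuleS R) y x)) (hw l).symm).trans
        ((redIncl_redTmk hn hL' (w l) x).trans ((map_smul w _ _).symm.trans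
          (congrArg w (redIncl_redTmk hn hL l x)).symm)))
    (fun x y hx hy => by
      refine ((congrArg _ (map_add _ x y)).trans (map_add _ _ _)).trans ((congrArg₂ _ hx hy).trans ?_)
      exact ((congrArg w (map_add (redIncl hn hL).toLin x y)).trans (map_add _ _ _)).symm) t

theorem connecting_naturality (v : L ⟶ L') :
    (relQ A).map ((redFunctor A R).map v) ≫ connecting hn hL'
      = connecting hn hL ≫ (relQ A).map (shiftKerMap R ((redFunctor A R).map v)) := by
  have := (relQis A).Q_inverts _ (relQis_charRed hL)
  refine (cancel_epi ((relQ A).map (charRed A R L))).1 ?_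
  have e1 := (Category.assoc _ _ _).symm.trans (congrArg
    (fun t => t ≫ (relQ A).map (shiftKerMap R ((redFunctor A R).map v)))
    (charRed_connecting hn hL))
  refine Eq.trans ?_ e1.symm
  refine (Category.assoc _ _ _).symm.trans ?_
  refine Eq.trans ?_ ((relQ A).map_comp _ _)
  refine (congrArg (fun t => t ≫ connecting hn hL') ((relQ A).map_comp _ _).symm).trans ?_
  -- `map_connecting` is applied with the cone of `L` as source. The lift `(x, y) ↦ v y` has
  -- commutator `-v (i x)`, which matches the boundary `(x, y) ↦ -x`.
  let g : (charCone A R L).carrier →ₗ[A.toDGAlg.carrierᵐᵒᵖ] ((resA A R).obj L').carrier :=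
    ((resA A R).map v).toLin ∘ₗ LinearMap.snd _ _ ((resA A R).obj L).carrier
  have hg : LinDeg (M := charCone A R L) (N := (resA A R).obj L') g 0 := fun i z hz => by
    rw [add_zero]
    exact v.map_mem hz.2
  refine map_connecting hn hL' (charRed A R L ≫ (redFunctor A R).map v) g hg (fun z => rfl)
    (charBoundary A R L hn ≫ shiftKerMap R ((redFunctor A R).map v)) ?_
  rintro ⟨x, y⟩
  refine Eq.trans ?_ (hd_apply_zero g hg _).symm
  refine (redIncl_naturality hn hL hL' v.toLin ((redFunctor A R).map v) (fun _ => rfl) _).trans ?_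
  refine (congrArg v.toLin (redIncl_theta hn hL _)).trans ?_
  change ((resA A R).map v).toLin ((ofKer L).toLin (-x)) = ((resA A R).obj L').d
    (((resA A R).map v).toLin y) - ((resA A R).map v).toLin ((ofKer L).toLin x
    + ((resA A R).obj L).d y)
  rw [map_neg, map_neg, map_add, ((resA A R).map v).map_d]
  abel

end Connecting

/-! Lifting morphisms along the reduction. -/

section Lifting

variable {S : CDGAlg k} {A : DGAlgebra S} {R : AugCDGAlgebra S} (hn : SquareZero R)
  {L L' : DGModule (tAlg A R).toDGAlg}

/-- A linear map with values in `L' n` sends `l x` to an element of `L' n²`. -/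
theorem eq_zero_of_toRed (hn : SquareZero R)
    (ψ : L.carrier →ₗ[(tAlg A R).toDGAlg.carrierᵐᵒᵖ] L'.carrier)
    (hψ : ∀ l, (toRed L').toLin (ψ l) = 0) {l : L} (hl : (toRed L).toLin l = 0) : ψ l = 0 := by
  obtain ⟨t, rfl⟩ := exists_ofKer_eq L hl
  refine tensor_induction (E := tAlg A R) (M := L) (N := kerModule R)
    (p := fun t => ψ (kerInclAux (tAlg A R) L t) = 0) ?_ ?_ t
  · intro i j l x _ _
    exact (map_smul ψ (op ((tAlg A R).unit (kerVal R x))) l).trans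
      (smul_eq_zero_of_redOne hn (hψ l) (kerVal_mem R x))
  · intro t t' h h'
    rw [map_add, map_add, h, h', add_zero]

/-- Linear maps between reductions lift. -/
theorem exists_lift_red (hL : L.IsGradedFree)
    (φ : ((redFunctor A R).obj L).carrier →ₗ[A.toDGAlg.carrierᵐᵒᵖ]
      ((redFunctor A R).obj L').carrier) {q : ℤ} (hφ : LinDeg φ q) :
    ∃ w : L.carrier →ₗ[(tAlg A R).toDGAlg.carrierᵐᵒᵖ] L'.carrier, LinDeg w q ∧
      ∀ l, (toRed L').toLin (w l) = φ ((toRed L).toLin l) := by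
  -- The composite with the projection is linear over `A ⊗_S R`, since the action on both reductions
  -- factors through `A`. Freeness of `L` then gives the lift.
  let φ' : L.carrier →ₗ[(tAlg A R).toDGAlg.carrierᵐᵒᵖ]
      (tensorObj (tAlg A R) L' (augModule R)).carrier :=
    { toFun := fun l => φ ((toRed L).toLin l)
      map_add' := fun l l' => (congrArg φ (map_add (toRed L).toLin l l')).trans (map_add φ _ _)
      map_smul' := fun b l => by
        induction b using MulOpposite.rec' with | _ b => ?_
        refine (congrArg φ (toRed_smul L l b)).trans ((map_smul φ _ _).trans ?_)
        obtain ⟨l', hl'⟩ := toRed_surjective L' (φ ((toRed L).toLin l))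
        rw [← hl']
        refine (redOne_act (tAlg A R) L' l' _).trans ?_
        exact (redOne_tAug L' l' b).symm.trans (redOne_act (tAlg A R) L' l' b).symm }
  exact exists_lift hL (redProj (tAlg A R) L') (redOne_surjective (tAlg A R) L') φ'
    fun i l hl => hφ i _ ((toRed L).map_mem hl)

/-- A section of the projection to the reduction. -/
theorem exists_section (hL : L.IsGradedFree) :
    ∃ σ : ((redFunctor A R).obj L).carrier →ₗ[A.toDGAlg.carrierᵐᵒᵖ] ((resA A R).obj L).carrier,
      LinDeg σ 0 ∧ ∀ z, (toRed L).toLin (σ z) = z :=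
  exists_lift (isGradedFree_red L hL) (toRed L) (toRed_surjective L) LinearMap.id
    (fun i m hm => by rw [add_zero]; exact hm)

/-- Linear maps with values in `L n` which factor through the reduction are linear over
`A ⊗_S R`. -/
theorem exists_linear_redIncl
    (hL' : ((DGModule.res (tAlg A R).unit).obj L').IsGradedFree)
    (h : ((redFunctor A R).obj L).carrier →ₗ[A.toDGAlg.carrierᵐᵒᵖ]
      (tensorObj A ((redFunctor A R).obj L') (kerModuleS R)).carrier) :
    ∃ ψ : L.carrier →ₗ[(tAlg A R).toDGAlg.carrierᵐᵒᵖ] L'.carrier,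
      ∀ l, ψ l = (redIncl hn hL').toLin (h ((toRed L).toLin l)) := by
  refine ⟨⟨⟨fun l => (redIncl hn hL').toLin (h ((toRed L).toLin l)), fun l l' => ?_⟩,
    fun b l => ?_⟩, fun _ => rfl⟩
  · exact (congrArg (fun t => (redIncl hn hL').toLin (h t)) (map_add (toRed L).toLin l l')).trans
      ((congrArg (redIncl hn hL').toLin (map_add h _ _)).trans (map_add (redIncl hn hL').toLin _ _))
  · induction b using MulOpposite.rec' with | _ b => ?_
    refine (congrArg (fun t => (redIncl hn hL').toLin (h t)) (toRed_smul L l b)).trans ?_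
    refine (congrArg (redIncl hn hL').toLin (map_smul h _ _)).trans ?_
    refine (map_smul (redIncl hn hL').toLin _ _).trans ?_
    exact (smul_tAug_of_redOne hn (toRed_redIncl hn hL' _) b).symm

variable (hL : ((DGModule.res (tAlg A R).unit).obj L).IsGradedFree)
  (hL' : ((DGModule.res (tAlg A R).unit).obj L').IsGradedFree)

/-- A morphism between reductions which is compatible with the connecting morphisms lifts. -/
theorem exists_lift_of_connecting (hP : IsRelProj (tAlg A R) L) (hF : L.IsGradedFree)
    (φ : (redFunctor A R).obj L ⟶ (redFunctor A R).obj L')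
    (hφ : (relQ A).map φ ≫ connecting hn hL'
      = connecting hn hL ≫ (relQ A).map (shiftKerMap R φ)) :
    ∃ v : L ⟶ L', (redFunctor A R).map v = φ := by
  -- The commutator of this graded lift with the differentials is the obstruction; it takes values
  -- in `L' n`.
  obtain ⟨w, hw, hwφ⟩ := exists_lift_red (L' := L') hF φ.toLin φ.linDeg
  obtain ⟨σ, hσ, hσ'⟩ := exists_section hF
  let wA : ((resA A R).obj L).carrier →ₗ[A.toDGAlg.carrierᵐᵒᵖ] ((resA A R).obj L').carrier :=
    { toFun := w
      map_add' := w.map_add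
      map_smul' := fun a l => w.map_smul (op (inA A R a.unop)) l }
  -- The connecting morphism of `L` is computed with the section `σ`, and that of `L'` after `φ`
  -- with the lift `w σ`. Compatibility of `φ` makes the two cocycles equal in the derived category,
  -- hence homotopic.
  obtain ⟨f, hf, ef⟩ := exists_map_connecting hn hL (𝟙 _) σ hσ hσ'
  obtain ⟨f', hf', ef'⟩ := exists_map_connecting hn hL' φ (wA ∘ₗ σ)
    (LinDeg.comp (M := (redFunctor A R).obj L) (N := (resA A R).obj L) (P := (resA A R).obj L')
      (g := wA) hw hσ (add_zero 0))
    (fun z => (hwφ (σ z)).trans (congrArg φ.toLin (hσ' z)))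
  have e : (relQ A).map f' = (relQ A).map (f ≫ shiftKerMap R φ) := by
    rw [Functor.map_comp, ← ef, ← ef', hφ]
    refine congrArg (fun t => t ≫ _) ?_
    exact ((congrArg (fun t => t ≫ connecting hn hL) ((relQ A).map_id _)).trans
      (Category.id_comp _)).symm
  obtain ⟨h, hh, H⟩ := (isRelProj_red hP).homotopic_of_eq e
  let h' : ((redFunctor A R).obj L).carrier →ₗ[A.toDGAlg.carrierᵐᵒᵖ]
    (tensorObj A ((redFunctor A R).obj L') (kerModuleS R)).carrier := h
  -- The correction of `w` is the homotopy, precomposed with the projection of `L` and included in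
  -- `L'`.
  obtain ⟨ψ, hψ⟩ := exists_linear_redIncl (L := L) hn hL' h'
  have hψ0 : LinDeg ψ 0 := fun i l hl => by
    rw [hψ, add_zero]
    refine (redIncl hn hL').map_mem ?_
    have := hh i _ ((toRed L).map_mem hl)
    change h' _ ∈ tensorGr _ _ _ (i - 1 + 1) at this
    rwa [sub_add_cancel] at this
  have hdw : ∀ l, (toRed L').toLin (hd w hw l) = 0 := fun l => by
    rw [hd_apply_zero]
    refine (map_sub (toRed L').toLin _ _).trans (sub_eq_zero.2 ?_)
    refine ((toRed L').map_d _).trans ?_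
    refine (congrArg _ (hwφ l)).trans ((φ.map_d _).symm.trans ?_)
    exact (congrArg φ.toLin ((toRed L).map_d l)).symm.trans (hwφ _).symm
  let f₁ : ((redFunctor A R).obj L).carrier →ₗ[A.toDGAlg.carrierᵐᵒᵖ]
    (tensorObj A ((redFunctor A R).obj L) (kerModuleS R)).carrier := f.toLin
  let f₂ : ((redFunctor A R).obj L).carrier →ₗ[A.toDGAlg.carrierᵐᵒᵖ]
    (tensorObj A ((redFunctor A R).obj L') (kerModuleS R)).carrier := f'.toLin
  -- The terms containing `w σ d` cancel, so the difference of the cocycles is the commutator of `w`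
  -- evaluated on `σ z`.
  have h1 : ∀ z, (redIncl hn hL').toLin (f₂ z) - (redIncl hn hL').toLin
      ((tensorHom A (kerModuleS R) φ).toLin (f₁ z)) = hd w hw (σ z) := fun z => by
    rw [redIncl_naturality hn hL hL' w φ hwφ]
    let x : L.carrier := σ z
    let y : L.carrier := σ (((redFunctor A R).obj L).d z)
    have key : L'.d (w x) - w y - w (L.d x - y) = hd w hw x := by
      rw [hd_apply_zero, map_sub w, sub_sub_sub_cancel_right]
    exact (congrArg₂ (fun (s : L'.carrier) (t : L.carrier) => s - w t)
      ((hf' z).trans (hd_apply_zero _ _ z)) ((hf z).trans (hd_apply_zero _ _ z))).trans key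
  -- The commutator is linear with values in `L' n`, so it vanishes on `L n`, and `l` may be
  -- replaced by the section of its reduction.
  have h2 : ∀ l, hd w hw (σ ((toRed L).toLin l)) = hd w hw l := fun l => by
    refine sub_eq_zero.1 ((map_sub (hd w hw) _ _).symm.trans (eq_zero_of_toRed hn (hd w hw) hdw ?_))
    exact (map_sub (toRed L).toLin _ _).trans (sub_eq_zero.2 (hσ' _))
  have h3 : ∀ l, L'.d (ψ l) - ψ (L.d l) = -hd w hw l := fun l => by
    have e1 : f₂ ((toRed L).toLin l) - (tensorHom A (kerModuleS R) φ).toLin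
      (f₁ ((toRed L).toLin l)) = -(tensorObj A ((redFunctor A R).obj L') (kerModuleS R)).d
        (h' ((toRed L).toLin l)) + h' (((redFunctor A R).obj L).d ((toRed L).toLin l)) :=
      H ((toRed L).toLin l)
    have e2 := ((congrArg (redIncl hn hL').toLin e1).symm.trans
      (map_sub (redIncl hn hL').toLin _ _)).trans ((h1 _).trans (h2 l))
    have e3 : (redIncl hn hL').toLin (-(tensorObj A ((redFunctor A R).obj L') (kerModuleS R)).d
        (h' ((toRed L).toLin l)) + h' (((redFunctor A R).obj L).d ((toRed L).toLin l)))
        = -L'.d (ψ l) + ψ (L.d l) :=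
      (map_add (redIncl hn hL').toLin _ _).trans (congrArg₂ (fun s t : L'.carrier => s + t)
        ((map_neg (redIncl hn hL').toLin _).trans (congrArg (fun s : L'.carrier => -s)
          (((redIncl hn hL').map_d _).trans (congrArg L'.d (hψ l).symm))))
        ((congrArg (fun t => (redIncl hn hL').toLin (h' t)) ((toRed L).map_d l).symm).trans
          (hψ _).symm))
    rw [← e3.symm.trans e2]
    abel
  refine ⟨homOf (w + ψ) (hw.add hψ0) fun l => ?_, ?_⟩
  · have := h3 l
    rw [hd_apply_zero, neg_sub] at this
    rw [LinearMap.add_apply, LinearMap.add_apply, map_add, eq_add_of_sub_eq this]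
    abel
  · ext y
    obtain ⟨l, rfl⟩ := toRed_surjective L y
    refine (map_add (toRed L').toLin (w l) (ψ l)).trans ?_
    refine (congrArg₂ (fun s t => s + t) (hwφ l)
      ((congrArg (toRed L').toLin (hψ l)).trans (toRed_redIncl hn hL' _))).trans ?_
    exact add_zero _

/-- An endomorphism whose reduction is the identity of the relative derived category is
invertible. -/
theorem isIso_of_red_eq_id (hn : SquareZero R) (hP : IsRelProj (tAlg A R) L)
    (hF : L.IsGradedFree) (e : L ⟶ L)
    (he : (relQ A).map ((redFunctor A R).map e) = (relQ A).map (𝟙 ((redFunctor A R).obj L))) :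
    IsIso ((relQ (tAlg A R)).map e) := by
  obtain ⟨h, hh, H⟩ := (isRelProj_red hP).homotopic_of_eq he
  -- The homotopy from the identity to the reduction of `e` is lifted as a graded map.
  obtain ⟨w, hw, hwh⟩ := exists_lift_red (L' := L) hF h (q := -1) hh
  have hdd : ∀ l, hd w hw (L.d l) = L.d (hd w hw l) := fun l => by
    rw [hd_apply_neg_one, hd_apply_neg_one, map_add, L.d_d, L.d_d, map_zero, add_zero, zero_add]
  have hdw0 : LinDeg (hd w hw) 0 := linDeg_hd w hw rfl
  have hH : ∀ l, (toRed L).toLin (e.toLin l - l) = (toRed L).toLin (hd w hw l) := fun l => by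
    rw [hd_apply_neg_one]
    refine (map_sub (toRed L).toLin _ _).trans ((H ((toRed L).toLin l)).trans ?_)
    refine Eq.trans ?_ (map_add (toRed L).toLin _ _).symm
    refine congrArg₂ _ ?_ ?_
    · exact (congrArg _ (hwh l).symm).trans ((toRed L).map_d _).symm
    · exact (congrArg h ((toRed L).map_d l).symm).trans (hwh _).symm
  -- After the boundary of `w` is subtracted, `e - 1` has values in `L n`, so `ν² = 0`. Thus `e` is
  -- homotopic to `1 + ν`, with inverse `1 - ν`.
  let ν : L.carrier →ₗ[(tAlg A R).toDGAlg.carrierᵐᵒᵖ] L.carrier :=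
    e.toLin - LinearMap.id - hd w hw
  have hν : ∀ l, (toRed L).toLin (ν l) = 0 := fun l =>
    (map_sub (toRed L).toLin _ _).trans (sub_eq_zero.2 (hH l))
  have hνd : ∀ l, ν (L.d l) = L.d (ν l) := fun l => by
    change e.toLin (L.d l) - L.d l - hd w hw (L.d l) = L.d (e.toLin l - l - hd w hw l)
    rw [map_sub, map_sub, hdd, e.map_d]
  have hν0 : LinDeg ν 0 := (e.linDeg.sub fun i l hl => by rw [add_zero]; exact hl).sub hdw0
  have hνν : ∀ l, ν (ν l) = 0 := fun l => eq_zero_of_toRed hn ν hν (hν l)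
  have hid : LinDeg (M := L) LinearMap.id 0 := fun i l hl => by rw [add_zero]; exact hl
  let a : L ⟶ L := homOf (LinearMap.id + ν) (hid.add hν0) fun l => by
    change L.d l + ν (L.d l) = L.d (l + ν l)
    rw [map_add, hνd]
  let b : L ⟶ L := homOf (LinearMap.id - ν) (hid.sub hν0) fun l => by
    change L.d l - ν (L.d l) = L.d (l - ν l)
    rw [map_sub, hνd]
  have hab : a ≫ b = 𝟙 L := by
    ext l
    change l + ν l - ν (l + ν l) = l
    rw [map_add, hνν, add_zero, add_sub_cancel_right]
  have hba : b ≫ a = 𝟙 L := by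
    ext l
    change l - ν l + ν (l - ν l) = l
    rw [map_sub, hνν, sub_zero, sub_add_cancel]
  have hea : (relQ (tAlg A R)).map e = (relQ (tAlg A R)).map a := by
    refine relQ_map_eq_of_homotopic _ ⟨w, hw, fun l => ?_⟩
    rw [← hd_apply_neg_one w hw]
    change e.toLin l - (l + (e.toLin l - l - hd w hw l)) = hd w hw l
    abel
  rw [hea]
  have : IsIso a := ⟨b, hab, hba⟩
  infer_instance

end Lifting

/-! Extension of scalars from `A` to `A ⊗_S R`. -/

section ExtendScalars

variable {S : CDGAlg k} (A : DGAlgebra S) (R : AugCDGAlgebra S) (P : DGModule A.toDGAlg)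

/-- The vector space underlying `P ⊗_S R`. -/
abbrev Ext : Type u := TensorCarrier A P R.asModule

/-- The class of `p ⊗ r` in `P ⊗_S R`. -/
abbrev extMk : P →ₗ[k] R.toDGAlg →ₗ[k] Ext A R P := tmk A P R.asModule

theorem extMk_balanced {i j : ℤ} {s : S.toDGAlg} {r : R.toDGAlg} (hs : s ∈ S.gr i)
    (hr : r ∈ R.gr j) (p : P) :
    extMk A R P (op (A.unit s) • p) r = (-1 : k) ^ (i * j) • extMk A R P p (r * R.unit s) :=
  tmk_balanced A P R.asModule hs hr p

/-- The right multiplication `(p ⊗ r) r' = p ⊗ r r'` of `R` on `P ⊗_S R`. -/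
noncomputable def extRight : Ext A R P →ₗ[k] R.toDGAlg →ₗ[k] Ext A R P :=
  tlift (E := A) (M := P) (N := R.asModule)
    (LinearMap.mk₂ k (M := P) (Nₗ := R.toDGAlg)
      (fun p r => (extMk A R P p) ∘ₗ LinearMap.mulLeft k r)
      (fun a a' r => by ext x; simp) (fun c a r => by ext x; simp)
      (fun a r r' => by
        ext x
        change extMk A R P a ((r + r') * x) = _
        rw [add_mul, map_add]
        rfl)
      (fun c a r => by
        ext x
        change extMk A R P a (c • r * x) = _
        rw [smul_mul_assoc, map_smul]
        rfl)) <| by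
    intro i j _ s (r : R.toDGAlg) p hs hr _
    refine graded_ext R.isInternal fun q x hx => ?_
    have hr' : r ∈ R.gr j := hr
    change extMk A R P (op (A.unit s) • p) (r * x)
      = (-1 : k) ^ (i * j) • extMk A R P p (r * R.unit s * x)
    rw [extMk_balanced A R P hs (R.mul_mem hr' hx), mul_assoc, mul_assoc,
      R.comm (R.unit.map_mem hs) hx, mul_smul_comm, map_smul, smul_smul, sign_mul]
    congr 2
    ring

theorem extRight_mk (p : P) (r x : R.toDGAlg) :
    extRight A R P (extMk A R P p r) x = extMk A R P p (r * x) := rfl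

/-- The right multiplication `(p ⊗ r) a = (-1)^{|r||a|} p a ⊗ r` of `A` on `P ⊗_S R`. -/
noncomputable abbrev extAct : Ext A R P →ₗ[k] A.toDGAlg →ₗ[k] Ext A R P :=
  tensorAct A P R.asModule

theorem extAct_mk {i j : ℤ} {a : A.toDGAlg} (ha : a ∈ A.gr i) {r : R.toDGAlg}
    (hr : r ∈ R.gr j) (p : P) :
    extAct A R P (extMk A R P p r) a = (-1 : k) ^ (i * j) • extMk A R P (op a • p) r :=
  tensorAct_tmk A P R.asModule ha hr p

theorem extAct_act (x : Ext A R P) (a b : A.toDGAlg) :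
    extAct A R P x (a * b) = extAct A R P (extAct A R P x a) b :=
  mul_smul (op b) (op a) (show (tensorObj A P R.asModule).carrier from x)

variable {A R P} in
theorem ext_induction {p : Ext A R P → Prop}
    (hom : ∀ (i j : ℤ) (a : P) (r : R.toDGAlg), a ∈ P.gr i → r ∈ R.gr j → p (extMk A R P a r))
    (add : ∀ x y, p x → p y → p (x + y)) (x : Ext A R P) : p x :=
  tensor_induction hom add x

theorem extAct_unit {i : ℤ} {s : S.toDGAlg} (hs : s ∈ S.gr i) (x : Ext A R P) :
    extAct A R P x (A.unit s) = extRight A R P x (R.unit s) := by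
  refine ext_induction (p := fun x => extAct A R P x (A.unit s) = extRight A R P x (R.unit s))
    ?_ ?_ x
  · intro p q a r ha hr
    rw [extAct_mk A R P (A.unit.map_mem hs) hr, extRight_mk, extMk_balanced A R P hs hr, smul_smul,
      sign_mul, (Even.add_self _).neg_one_zpow, one_smul]
  · intro x y hx hy
    simp only [map_add, LinearMap.add_apply, hx, hy]

theorem extRight_right (x : Ext A R P) (r r' : R.toDGAlg) :
    extRight A R P (extRight A R P x r) r' = extRight A R P x (r * r') := by
  refine ext_induction
    (p := fun x => extRight A R P (extRight A R P x r) r' = extRight A R P x (r * r')) ?_ ?_ x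
  · intro p q a s ha hs
    rw [extRight_mk, extRight_mk, extRight_mk, mul_assoc]
  · intro x y hx hy
    simp only [map_add, LinearMap.add_apply, hx, hy]

theorem extAct_right {i j : ℤ} {a : A.toDGAlg} {r : R.toDGAlg} (ha : a ∈ A.gr i)
    (hr : r ∈ R.gr j) (x : Ext A R P) :
    extAct A R P (extRight A R P x r) a
      = (-1 : k) ^ (i * j) • extRight A R P (extAct A R P x a) r := by
  refine ext_induction (p := fun x => extAct A R P (extRight A R P x r) a
      = (-1 : k) ^ (i * j) • extRight A R P (extAct A R P x a) r) ?_ ?_ x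
  · intro p q b s hb hs
    rw [extRight_mk, extAct_mk A R P ha (R.mul_mem hs hr), extAct_mk A R P ha hs, map_smul (extRight A R P),
      LinearMap.smul_apply, extRight_mk, smul_smul, sign_mul]
    congr 2
    ring
  · intro x y hx hy
    simp only [map_add, LinearMap.add_apply, hx, hy, smul_add]

/-- The action `x (a ⊗ r) = (x a) r` of `A ⊗_S R` on `P ⊗_S R`. -/
noncomputable def extMul : TAlg A R →ₗ[k] Ext A R P →ₗ[k] Ext A R P :=
  talgLift
    (LinearMap.mk₂ k (M := A.toDGAlg) (Nₗ := R.toDGAlg)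
      (fun a r => ((extRight A R P).flip r) ∘ₗ ((extAct A R P).flip a))
      (fun a a' r => by ext x; simp) (fun c a r => by ext x; simp)
      (fun a r r' => by ext x; simp) (fun c a r => by ext x; simp)) <| by
    intro i j s r a hs hr
    refine LinearMap.ext fun x => ?_
    change extRight A R P (extAct A R P x (a * A.unit s)) r
      = (-1 : k) ^ (i * j) • extRight A R P (extAct A R P x a) (r * R.unit s)
    rw [extAct_act, extAct_unit A R P hs, extRight_right, R.comm (R.unit.map_mem hs) hr, map_smul]

theorem extMul_tm (x : Ext A R P) (a : A.toDGAlg) (r : R.toDGAlg) :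
    extMul A R P (tm A R a r) x = extRight A R P (extAct A R P x a) r := rfl

theorem extMul_tm_mk {i j : ℤ} {a : A.toDGAlg} (ha : a ∈ A.gr i) {r : R.toDGAlg}
    (hr : r ∈ R.gr j) (p : P) (r' : R.toDGAlg) :
    extMul A R P (tm A R a r') (extMk A R P p r)
      = (-1 : k) ^ (i * j) • extMk A R P (op a • p) (r * r') := by
  rw [extMul_tm, extAct_mk A R P ha hr, map_smul, LinearMap.smul_apply, extRight_mk]

/-- Associativity reduces to `extAct_right`, the exchange of the actions of `R` and `A`, whose sign
is that of the product in `A ⊗_S R`. -/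
theorem extMul_mul (x : Ext A R P) (y z : TAlg A R) :
    extMul A R P z (extMul A R P y x) = extMul A R P (y * z) x := by
  rw [tAlg_mul_def]
  refine talg_induction (p := fun z =>
    extMul A R P z (extMul A R P y x) = extMul A R P (tAlgMul A R z y) x) ?_ ?_ z
  · intro i j a r ha hr
    refine talg_induction (p := fun y =>
      extMul A R P (tm A R a r) (extMul A R P y x) = extMul A R P (tAlgMul A R (tm A R a r) y) x)
      ?_ ?_ y
    · intro i' j' a' r' ha' hr'
      rw [tAlgMul_tm_tm A R ha hr', map_smul, LinearMap.smul_apply, extMul_tm, extMul_tm,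
        extMul_tm, extAct_right A R P ha hr', map_smul, LinearMap.smul_apply, extRight_right,
        extAct_act]
    · intro y y' h h'
      simp only [map_add, LinearMap.add_apply, h, h']
  · intro z z' h h'
    simp only [map_add, LinearMap.add_apply, h, h']

theorem extMul_one (x : Ext A R P) : extMul A R P 1 x = x := by
  rw [tAlg_one_def]
  refine ext_induction (p := fun x => extMul A R P (tm A R 1 1) x = x) ?_ ?_ x
  · intro i j a r ha hr
    rw [extMul_tm_mk A R P A.one_mem hr]
    simp
  · intro x y hx hy
    simp only [map_add, hx, hy]

abbrev extGr : ℤ → Submodule k (Ext A R P) := tensorGr A P R.asModule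

noncomputable abbrev extD : Ext A R P →ₗ[k] Ext A R P := tensorD A P R.asModule

theorem extD_mk {i : ℤ} {p : P} (hp : p ∈ P.gr i) (r : R.toDGAlg) :
    extD A R P (extMk A R P p r) = extMk A R P (P.d p) r + (-1 : k) ^ i • extMk A R P p (R.d r) :=
  tensorD_tmk A P R.asModule hp r

variable {A R P} in
theorem extGr_map {Q : Type u} [AddCommGroup Q] [Module k Q]
    {f : Ext A R P →ₗ[k] Q} {n : ℤ} {V : Submodule k Q}
    (H : ∀ (i j : ℤ) (p : P) (r : R.toDGAlg), i + j = n → p ∈ P.gr i → r ∈ R.gr j →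
      f (extMk A R P p r) ∈ V) {x : Ext A R P} (hx : x ∈ extGr A R P n) : f x ∈ V :=
  tensorGr_map H hx

theorem extMk_mem {i j : ℤ} {p : P} {r : R.toDGAlg} (hp : p ∈ P.gr i) (hr : r ∈ R.gr j) :
    extMk A R P p r ∈ extGr A R P (i + j) :=
  tmk_mem (M := P) (N := R.asModule) hp hr

theorem extMul_mem {i j : ℤ} {x : Ext A R P} {y : TAlg A R} (hx : x ∈ extGr A R P i)
    (hy : y ∈ tAlgGr A R j) : extMul A R P y x ∈ extGr A R P (i + j) := by
  refine tAlgGr_map (f := (extMul A R P).flip x) ?_ hy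
  rintro p q a r rfl ha hr
  refine extGr_map (f := extMul A R P (tm A R a r)) ?_ hx
  rintro p' q' a' r' rfl ha' hr'
  rw [extMul_tm_mk A R P ha hr', show p' + q' + (p + q) = (p' + p) + (q' + q) by ring]
  exact Submodule.smul_mem _ _ (extMk_mem A R P (P.smul_mem ha' ha) (R.mul_mem hr' hr))

theorem extD_mul {i : ℤ} {x : Ext A R P} (hx : x ∈ extGr A R P i) (y : TAlg A R) :
    extD A R P (extMul A R P y x)
      = extMul A R P y (extD A R P x) + (-1 : k) ^ i • extMul A R P (tAlgD A R y) x := by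
  refine talg_induction (p := fun y => extD A R P (extMul A R P y x)
    = extMul A R P y (extD A R P x) + (-1 : k) ^ i • extMul A R P (tAlgD A R y) x) ?_ ?_ y
  · intro p q a r ha hr
    -- For fixed `y`, the identity says that a linear map kills the component of degree `i`, so it
    -- is enough to take `x` a pure tensor.
    have key := extGr_map (n := i) (V := (⊥ : Submodule k (Ext A R P)))
      (f := extD A R P ∘ₗ extMul A R P (tm A R a r) - extMul A R P (tm A R a r) ∘ₗ extD A R P
        - (-1 : k) ^ i • extMul A R P (tAlgD A R (tm A R a r))) ?_ hx
    · rw [Submodule.mem_bot] at key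
      simp only [LinearMap.sub_apply, LinearMap.comp_apply, LinearMap.smul_apply] at key
      rw [sub_sub, sub_eq_zero] at key
      exact key
    · rintro p' q' a' r' rfl ha1 hr1
      rw [Submodule.mem_bot]
      simp only [LinearMap.sub_apply, LinearMap.comp_apply, LinearMap.smul_apply]
      rw [sub_sub, sub_eq_zero]
      rw [extMul_tm_mk A R P ha hr1, map_smul (extD A R P), extD_mk A R P (P.smul_mem ha1 ha),
        extD_mk A R P ha1, tAlgD_tm A R ha, map_add, map_add, map_smul (extMul A R P (tm A R a r)),
        map_smul (extMul A R P), LinearMap.add_apply, LinearMap.smul_apply, extMul_tm_mk A R P ha hr1,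
        extMul_tm_mk A R P ha (R.d_mem hr1), extMul_tm_mk A R P (A.d_mem ha) hr1,
        extMul_tm_mk A R P ha hr1, P.d_smul ha1, R.d_mul hr1]
      simp only [map_add, map_smul, LinearMap.add_apply, LinearMap.smul_apply, smul_add, smul_smul,
        sign_mul]
      refine Eq.trans ?_ (add_add_add_comm _ _ _ _)
      refine congrArg₂ (· + ·) (congrArg₂ (· + ·) rfl ?_) (congrArg₂ (· + ·) ?_ ?_)
      all_goals
        congr 1
        apply sign_congr
        simp only [Int.even_add, Int.even_mul, Int.not_even_one]
        tauto
  · intro y y' h h'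
    simp only [map_add, LinearMap.add_apply, h, h', smul_add]
    abel

/-- The dg `A ⊗_S R`-module `P ⊗_S R`. -/
noncomputable def extendScalars : DGModule (tAlg A R).toDGAlg :=
  letI : Module (tAlg A R).toDGAlg.carrierᵐᵒᵖ (Ext A R P) :=
    { smul := fun e x => extMul A R P e.unop x
      one_smul := fun x => extMul_one A R P x
      mul_smul := fun x y z => (extMul_mul A R P z y.unop x.unop).symm
      smul_zero := fun x => map_zero (extMul A R P x.unop)
      smul_add := fun x => map_add (extMul A R P x.unop)
      add_smul := fun x y z => by
        change extMul A R P (x.unop + y.unop) z = extMul A R P x.unop z + extMul A R P y.unop z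
        exact congrArg (fun f => f z) (map_add (extMul A R P) x.unop y.unop)
      zero_smul := fun x => by
        change extMul A R P 0 x = 0
        rw [map_zero, LinearMap.zero_apply] }
  { carrier := Ext A R P
    isScalarTower := ⟨fun c e x => by
      change extMul A R P (c • e.unop) x = c • extMul A R P e.unop x
      exact congrArg (fun f => f x) (map_smul (extMul A R P) c e.unop)⟩
    gr := extGr A R P
    isInternal := tensor_isInternal A P R.asModule
    smul_mem := fun hx hy => extMul_mem A R P hx hy
    d := extD A R P
    d_mem := fun hx => tensorD_mem A P R.asModule hx
    d_d := tensorD_tensorD A P R.asModule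
    d_smul := fun hx y => extD_mul A R P hx y }

end ExtendScalars

/-! ### Universal property and freeness of extensions of scalars -/

section ExtendScalarsLift

variable {S : CDGAlg k} {A : DGAlgebra S} {R : AugCDGAlgebra S} {P : DGModule A.toDGAlg}

theorem extMk_unit (p : P) (s : S.toDGAlg) :
    extMk A R P (op (A.unit s) • p) 1 = extMk A R P p (R.unit s) := by
  refine graded_induction S.isInternal (p := fun s =>
    extMk A R P (op (A.unit s) • p) 1 = extMk A R P p (R.unit s)) ?_ ?_ s
  · intro i s hs
    rw [extMk_balanced A R P hs R.one_mem, mul_zero, zpow_zero, one_smul, one_mul]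
  · intro s s' h h'
    rw [map_add, map_add, MulOpposite.op_add, add_smul, map_add, map_add, LinearMap.add_apply, h,
      h']

theorem extAct_one (x : Ext A R P) : extAct A R P x 1 = x :=
  one_smul A.toDGAlg.carrierᵐᵒᵖ (show (tensorObj A P R.asModule).carrier from x)

theorem extMul_one_tm (x : Ext A R P) (r : R.toDGAlg) :
    extMul A R P (tm A R 1 r) x = extRight A R P x r := by
  rw [extMul_tm, extAct_one]

theorem extD_right {i : ℤ} {x : Ext A R P} (hx : x ∈ extGr A R P i) (r : R.toDGAlg) :
    extD A R P (extRight A R P x r)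
      = extRight A R P (extD A R P x) r + (-1 : k) ^ i • extRight A R P x (R.d r) := by
  have := extD_mul A R P hx (tm A R 1 r)
  rwa [tAlgD_tm A R A.one_mem, DGAlg.d_one, map_zero, LinearMap.zero_apply, zero_add, zpow_zero,
    one_smul, extMul_one_tm, extMul_one_tm, extMul_one_tm] at this

/-- The universal property of `P ⊗_S R`. -/
noncomputable def extLift {X : Type u} [AddCommGroup X] [Module k X]
    (ρ : X →ₗ[k] R.toDGAlg →ₗ[k] X) (hρ : ∀ x r r', ρ (ρ x r) r' = ρ x (r * r'))
    (g : P →ₗ[k] X) (hg : ∀ (s : S.toDGAlg) p, g (op (A.unit s) • p) = ρ (g p) (R.unit s)) :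
    Ext A R P →ₗ[k] X :=
  tlift (E := A) (M := P) (N := R.asModule) (ρ ∘ₗ g) <| by
    intro i j _ s (r : R.toDGAlg) p hs hr _
    change ρ (g _) r = (-1 : k) ^ (i * j) • ρ (g p) (r * R.unit s)
    rw [hg, hρ, R.comm (R.unit.map_mem hs) hr, map_smul]

/-- The conclusion ignores the differential, so no compatibility of `e` with differentials is
required. This allows both `A ⊗_S R` and the twisted module below as `X`. -/
theorem isGradedFree_of_ext (hP : ((DGModule.res A.unit).obj P).IsGradedFree)
    (X : DGModule R.toDGAlg) (e : Ext A R P ≃ₗ[k] X.carrier)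
    (he : ∀ p r, e (extMk A R P p r) = op r • e (extMk A R P p 1))
    (hmem : ∀ i p, p ∈ P.gr i → e (extMk A R P p 1) ∈ X.gr i) : X.IsGradedFree := by
  obtain ⟨ι, b, hb⟩ := hP
  let Y := ((DGModule.res A.unit).obj P).carrier
  let j : Y →ₗ[k] X.carrier := e.toLinearMap ∘ₗ ((extMk A R P).flip 1)
  obtain ⟨b', hb'⟩ := exists_basis_of_universal (k := k) (Y := Y) (AlgHom.op R.unit.toAlgHom) j
    (fun s p => by
      induction s using MulOpposite.rec' with | _ s => ?_
      exact (congrArg e (extMk_unit (P := P) p s)).trans (he p (R.unit s)))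
    (by
      refine eq_top_iff.2 fun x _ => ?_
      obtain ⟨t, rfl⟩ := e.surjective x
      refine ext_induction (p := fun t => e t ∈ Submodule.span R.toDGAlg.carrierᵐᵒᵖ (Set.range j))
        ?_ ?_ t
      · intro _ _ p r _ _
        rw [he]
        exact Submodule.smul_mem _ _ (Submodule.subset_span ⟨p, rfl⟩)
      · intro t t' h h'
        rw [map_add]
        exact add_mem h h') b
    (fun g hg => by
      let ρ : (ι →₀ R.toDGAlg.carrierᵐᵒᵖ) →ₗ[k] R.toDGAlg →ₗ[k] (ι →₀ R.toDGAlg.carrierᵐᵒᵖ) :=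
        LinearMap.mk₂ k (fun x r => op r • x) (fun x x' r => smul_add _ _ _)
          (fun c x r => smul_comm _ _ _)
          (fun x r r' => by rw [MulOpposite.op_add, add_smul])
          (fun c x r => by rw [MulOpposite.op_smul, smul_assoc])
      let G := extLift (A := A) (P := P) ρ (fun x r r' => (mul_smul (op r') (op r) x).symm) g
        (fun s p => hg (op s) p)
      have hG : ∀ (r : R.toDGAlg) t, G (e.symm (op r • e t)) = op r • G t := fun r t => by
        refine ext_induction (p := fun t => G (e.symm (op r • e t)) = op r • G t) ?_ ?_ t
        · intro _ _ p r' _ _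
          rw [he, ← mul_smul, ← op_mul, ← he, e.symm_apply_apply]
          exact mul_smul (op r) (op r') (g p)
        · intro t t' h h'
          rw [map_add, smul_add, map_add, map_add, h, h', map_add, smul_add]
      refine ⟨⟨⟨fun x => G (e.symm x), fun x y => by rw [map_add, map_add]⟩, fun r x => ?_⟩,
        fun p => ?_⟩
      · induction r using MulOpposite.rec' with | _ r => ?_
        obtain ⟨t, rfl⟩ := e.surjective x
        change G (e.symm (op r • e t)) = op r • G (e.symm (e t))
        rw [hG, e.symm_apply_apply]
      · change G (e.symm (e (extMk A R P p 1))) = g p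
        rw [e.symm_apply_apply]
        exact one_smul R.toDGAlg.carrierᵐᵒᵖ (g p))
  refine ⟨ι, b', fun i => ?_⟩
  obtain ⟨q, hq⟩ := hb i
  exact ⟨q, by rw [hb']; exact hmem q (b i) hq⟩

theorem isGradedFree_tAlg (hA : ((DGModule.res A.unit).obj (DGModule.regular A.toDGAlg)).IsGradedFree) :
    ((DGModule.res (tAlg A R).unit).obj
      (DGModule.regular (tAlg A R).toDGAlg)).IsGradedFree :=
  isGradedFree_of_ext hA _ (LinearEquiv.refl k (TAlg A R))
    (fun a r => tm_eq_mul A R a r)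
    (fun i a ha => by
      have := tm_mem A R ha R.one_mem
      rwa [add_zero] at this)

end ExtendScalarsLift

/-! Twisted extensions of scalars. -/

/-- The dg module obtained by adding a square zero endomorphism to the differential. -/
def DGModule.twist {E : DGAlg k} (M : DGModule E) (F : M.carrier →ₗ[E.carrierᵐᵒᵖ] M.carrier)
    (hF : LinDeg F 1) (hd : ∀ m, M.d (F m) + F (M.d m) = 0) (hF2 : ∀ m, F (F m) = 0) :
    DGModule E where
  carrier := M.carrier
  gr := M.gr
  isInternal := M.isInternal
  smul_mem := M.smul_mem
  d := M.d + F.restrictScalars k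
  d_mem := fun hm => add_mem (M.d_mem hm) (hF _ _ hm)
  d_d := fun m => by
    change M.d (M.d m + F m) + F (M.d m + F m) = 0
    rw [map_add, map_add, M.d_d, hF2, zero_add, add_zero, hd]
  d_smul := fun {i m} hm a => by
    change M.d (op a • m) + F (op a • m) = op a • (M.d m + F m) + (-1 : k) ^ i • (op (E.d a) • m)
    rw [M.d_smul hm, map_smul, smul_add]
    abel

section Twisted

variable {S : CDGAlg k} {A : DGAlgebra S} {R : AugCDGAlgebra S} {P : DGModule A.toDGAlg}

/-- The map `P ⊗_S n ⟶ P ⊗_S R`. -/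
noncomputable def extKer (A : DGAlgebra S) (R : AugCDGAlgebra S) (P : DGModule A.toDGAlg) :
    TensorCarrier A P (kerModuleS R) →ₗ[k] Ext A R P :=
  tlift (E := A) (M := P) (N := kerModuleS R)
    ((extMk A R P).compl₂ (augKer R).subtype)
    (fun _ _ _ _ _ p hs hx _ => extMk_balanced A R P hs hx p)

theorem extKer_act (t : TensorCarrier A P (kerModuleS R)) (a : A.toDGAlg) :
    extKer A R P (tensorAct A P (kerModuleS R) t a) = extAct A R P (extKer A R P t) a := by
  refine graded_induction A.isInternal (p := fun a =>
    extKer A R P (tensorAct A P (kerModuleS R) t a) = extAct A R P (extKer A R P t) a) ?_ ?_ a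
  · intro i a ha
    refine tensor_induction (p := fun t =>
      extKer A R P (tensorAct A P (kerModuleS R) t a) = extAct A R P (extKer A R P t) a) ?_ ?_ t
    · intro p q y x hy hx
      rw [tensorAct_tmk A P (kerModuleS R) ha hx, map_smul (extKer A R P)]
      exact (extAct_mk A R P ha hx y).symm
    · intro t t' h h'
      simp only [map_add, LinearMap.add_apply, h, h']
  · intro a b h h'
    simp only [map_add, h, h']

theorem extKer_d (t : TensorCarrier A P (kerModuleS R)) :
    extKer A R P (tensorD A P (kerModuleS R) t) = extD A R P (extKer A R P t) := by
  refine tensor_induction (p := fun t =>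
    extKer A R P (tensorD A P (kerModuleS R) t) = extD A R P (extKer A R P t)) ?_ ?_ t
  · intro p q y x hy hx
    rw [tensorD_tmk A P (kerModuleS R) hy, map_add, map_smul (extKer A R P)]
    exact (extD_mk A R P hy _).symm
  · intro t t' h h'
    simp only [map_add, h, h']

theorem extKer_mem {i : ℤ} {t : TensorCarrier A P (kerModuleS R)}
    (ht : t ∈ tensorGr A P (kerModuleS R) i) : extKer A R P t ∈ extGr A R P i := by
  refine tensorGr_map (f := extKer A R P) ?_ ht
  rintro p q y x rfl hy hx
  exact extMk_mem A R P hy hx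

variable (f : P ⟶ shiftKer R P)

/-- The map `P ⟶ P ⊗_S R` given by `f`. -/
noncomputable def twistGen : P →ₗ[k] Ext A R P :=
  extKer A R P ∘ₗ (f.toLin.restrictScalars k :
    P →ₗ[k] TensorCarrier A P (kerModuleS R))

theorem twistGen_smul (a : A.toDGAlg) (p : P) :
    twistGen f (op a • p) = extAct A R P (twistGen f p) a :=
  (congrArg (extKer A R P) (map_smul f.toLin (op a) p)).trans (extKer_act _ a)

/-- The sign is that of the differential of the shift. It makes the twisting map anticommute with
the differential. -/
theorem twistGen_d (p : P) : twistGen f (P.d p) = -extD A R P (twistGen f p) := by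
  refine (congrArg (extKer A R P) (f.map_d p)).trans ?_
  exact (map_neg (extKer A R P) _).trans (congrArg Neg.neg (extKer_d _))

theorem twistGen_mem {i : ℤ} {p : P} (hp : p ∈ P.gr i) : twistGen f p ∈ extGr A R P (i + 1) :=
  extKer_mem (f.map_mem hp)

/-- The endomorphism of `P ⊗_S R` given by `f`. -/
noncomputable def twistLin : Ext A R P →ₗ[k] Ext A R P :=
  extLift (extRight A R P) (fun x r r' => extRight_right A R P x r r') (twistGen f)
    (fun s p => by
      rw [twistGen_smul]
      refine graded_induction S.isInternal (p := fun s => extAct A R P (twistGen f p) (A.unit s)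
        = extRight A R P (twistGen f p) (R.unit s)) (fun i s hs => extAct_unit A R P hs _) ?_ s
      intro s s' h h'
      simp only [map_add, h, h'])

theorem twistLin_mk (p : P) (r : R.toDGAlg) :
    twistLin f (extMk A R P p r) = extRight A R P (twistGen f p) r := rfl

theorem twistLin_one (p : P) : twistLin f (extMk A R P p 1) = twistGen f p := by
  rw [twistLin_mk, ← extMul_one_tm, ← tAlg_one_def, extMul_one]

theorem twistLin_mul (y : TAlg A R) (x : Ext A R P) :
    twistLin f (extMul A R P y x) = extMul A R P y (twistLin f x) := by
  refine talg_induction (p := fun y =>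
    twistLin f (extMul A R P y x) = extMul A R P y (twistLin f x)) ?_ ?_ y
  · intro i j a r ha hr
    refine ext_induction (p := fun x => twistLin f (extMul A R P (tm A R a r) x)
      = extMul A R P (tm A R a r) (twistLin f x)) ?_ ?_ x
    · intro i' j' p r' hp hr'
      rw [extMul_tm_mk A R P ha hr', map_smul (twistLin f), twistLin_mk, twistLin_mk, twistGen_smul,
        extMul_tm, extAct_right A R P ha hr', map_smul (extRight A R P), LinearMap.smul_apply,
        extRight_right]
    · intro x x' h h'
      simp only [map_add, h, h']
  · intro y y' h h'
    simp only [map_add, LinearMap.add_apply, h, h']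

theorem twistLin_right (x : Ext A R P) (r : R.toDGAlg) :
    twistLin f (extRight A R P x r) = extRight A R P (twistLin f x) r := by
  rw [← extMul_one_tm, ← extMul_one_tm, twistLin_mul]

theorem twistLin_d (x : Ext A R P) :
    extD A R P (twistLin f x) + twistLin f (extD A R P x) = 0 := by
  refine ext_induction (p := fun x => extD A R P (twistLin f x) + twistLin f (extD A R P x) = 0)
    ?_ ?_ x
  · intro i j p r hp hr
    rw [twistLin_mk, extD_right (twistGen_mem f hp), extD_mk A R P hp, map_add,
      map_smul (twistLin f), twistLin_mk, twistLin_mk, twistGen_d, map_neg, LinearMap.neg_apply,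
      zpow_add₀ (neg_ne_zero.2 one_ne_zero), zpow_one, mul_neg_one, neg_smul]
    abel
  · intro x y hx hy
    rw [map_add, map_add, map_add, map_add, add_add_add_comm, hx, hy, add_zero]

/-- The map already takes `p ⊗ 1` into `P ⊗_S n`, and multiplication by a further element of `n`
gives zero. -/
theorem twistLin_extKer (hn : SquareZero R) (t : TensorCarrier A P (kerModuleS R)) :
    twistLin f (extKer A R P t) = 0 := by
  have key : ∀ (t : TensorCarrier A P (kerModuleS R)) (x : augKer R),
      extRight A R P (extKer A R P t) x.1 = 0 := fun t x => by
    refine tensor_induction (p := fun t => extRight A R P (extKer A R P t) x.1 = 0) ?_ ?_ t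
    · intro _ _ p y _ _
      refine (extRight_mk A R P p (kerVal R y) x.1).trans ?_
      rw [hn _ (kerVal_mem R y) _ x.2, map_zero]
    · intro t t' h h'
      simp only [map_add, LinearMap.add_apply, h, h', add_zero]
  refine tensor_induction (p := fun t => twistLin f (extKer A R P t) = 0) ?_ ?_ t
  · intro _ _ p x _ _
    exact key _ x
  · intro t t' h h'
    rw [map_add, map_add, h, h', add_zero]

theorem twistLin_twistLin (hn : SquareZero R) (x : Ext A R P) :
    twistLin f (twistLin f x) = 0 := by
  refine ext_induction (p := fun x => twistLin f (twistLin f x) = 0) ?_ ?_ x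
  · intro _ _ p r _ _
    rw [twistLin_mk, twistLin_right]
    refine (congrArg (fun y => extRight A R P y r) (twistLin_extKer f hn _)).trans ?_
    rw [map_zero, LinearMap.zero_apply]
  · intro x y hx hy
    rw [map_add, map_add, hx, hy, add_zero]

theorem twistLin_mem {i : ℤ} {x : Ext A R P} (hx : x ∈ extGr A R P i) :
    twistLin f x ∈ extGr A R P (i + 1) := by
  refine extGr_map (f := twistLin f) ?_ hx
  rintro p q y r rfl hy hr
  rw [twistLin_mk, ← extMul_one_tm, show p + q + 1 = p + 1 + (0 + q) by ring]
  exact extMul_mem A R P (twistGen_mem f hy) (tm_mem A R A.one_mem hr)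

/-- The deformation of `P` given by `f : P ⟶ (P ⊗_S n)[1]`: the graded module `P ⊗_S R` with the
differential of `P ⊗_S R` twisted by `f`. -/
noncomputable def twisted (hn : SquareZero R) (f : P ⟶ shiftKer R P) :
    DGModule (tAlg A R).toDGAlg :=
  (extendScalars A R P).twist
    { toFun := twistLin f
      map_add' := map_add (twistLin f)
      map_smul' := fun y x => twistLin_mul f y.unop x }
    (fun _ _ hx => twistLin_mem f hx) (twistLin_d f) (twistLin_twistLin f hn)

theorem isGradedFree_twisted (hn : SquareZero R) (hP : ((DGModule.res A.unit).obj P).IsGradedFree) :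
    ((DGModule.res (tAlg A R).unit).obj (twisted hn f)).IsGradedFree :=
  isGradedFree_of_ext hP _ (LinearEquiv.refl k (Ext A R P))
    (fun p r => by
      change _ = extMul A R P (tm A R 1 r) (extMk A R P p 1)
      rw [extMul_one_tm, extRight_mk, one_mul]
      rfl)
    (fun i p hp => by
      have := extMk_mem A R P hp R.one_mem
      rwa [add_zero] at this)

end Twisted

/-! The characteristic class of a twisted extension of scalars. -/

section TwistedClass

variable {S : CDGAlg k} {A : DGAlgebra S} {R : AugCDGAlgebra S} (hn : SquareZero R)
  {P : DGModule A.toDGAlg} (f : P ⟶ shiftKer R P)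

theorem twisted_smul_unit (x : Ext A R P) (r : R.toDGAlg) :
    (op ((tAlg A R).unit r) • (show (twisted hn f).carrier from x) : (twisted hn f).carrier)
      = extRight A R P x r :=
  extMul_one_tm x r

/-- The map `p ↦ p ⊗ 1`. -/
noncomputable def extOne :
    P.carrier →ₗ[A.toDGAlg.carrierᵐᵒᵖ] ((resA A R).obj (twisted hn f)).carrier where
  toFun p := extMk A R P p 1
  map_add' p p' := congrArg (fun g => g (1 : R.toDGAlg)) (map_add (extMk A R P) p p')
  map_smul' a p := by
    induction a using MulOpposite.rec' with | _ a => ?_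
    change extMk A R P (op a • p) 1 = extMul A R P (tm A R a 1) (extMk A R P p 1)
    refine graded_induction A.isInternal (p := fun a =>
      extMk A R P (op a • p) 1 = extMul A R P (tm A R a 1) (extMk A R P p 1)) ?_ ?_ a
    · intro i a ha
      rw [extMul_tm_mk A R P ha R.one_mem, mul_zero, zpow_zero, one_smul, mul_one]
    · intro a a' h h'
      simp only [MulOpposite.op_add, add_smul, map_add, LinearMap.add_apply, h, h']

theorem linDeg_extOne : LinDeg (M := P) (N := (resA A R).obj (twisted hn f)) (extOne hn f) 0 :=
  fun _ _ hp => extMk_mem A R P hp R.one_mem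

theorem extD_one (p : P) : extD A R P (extMk A R P p 1) = extMk A R P (P.d p) 1 := by
  refine graded_induction P.isInternal (p := fun p =>
    extD A R P (extMk A R P p 1) = extMk A R P (P.d p) 1) ?_ ?_ p
  · intro i p hp
    rw [extD_mk A R P hp, DGAlg.d_one, map_zero, smul_zero, add_zero]
  · intro p p' h h'
    simp only [map_add, LinearMap.add_apply, h, h']

/-- The commutator of `p ↦ p ⊗ 1` with the differentials is `f`; this is how `f` reappears as the
connecting morphism. -/
theorem twisted_d_one (p : P) :
    (twisted hn f).d (extMk A R P p 1) = extMk A R P (P.d p) 1 + twistGen f p :=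
  congrArg₂ (fun s t : Ext A R P => s + t) (extD_one p) (twistLin_one f p)

theorem toRed_extKer (t : TensorCarrier A P (kerModuleS R)) :
    (toRed (twisted hn f)).toLin (extKer A R P t) = 0 := by
  refine tensor_induction (p := fun t => (toRed (twisted hn f)).toLin (extKer A R P t) = 0) ?_ ?_ t
  · intro i j p x _ _
    have e : extKer A R P (tmk A P (kerModuleS R) p x)
        = (op ((tAlg A R).unit (kerVal R x)) • (show (twisted hn f).carrier from extMk A R P p 1) :
          (twisted hn f).carrier) := by
      refine Eq.trans ?_ (twisted_smul_unit hn f (extMk A R P p 1) (kerVal R x)).symm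
      rw [extRight_mk, one_mul]
      rfl
    refine (congrArg (toRed (twisted hn f)).toLin e).trans ?_
    refine (redOne_unit (tAlg A R) (twisted hn f) _ _).trans ?_
    exact (congrArg (tmk (tAlg A R) (twisted hn f) (augModule R) _) (kerVal_mem R x)).trans
      (map_zero _)
  · intro t t' h h'
    refine (congrArg (toRed (twisted hn f)).toLin (map_add (extKer A R P) t t')).trans ?_
    exact (map_add (toRed (twisted hn f)).toLin _ _).trans ((congrArg₂ _ h h').trans (add_zero _))

/-- The morphism from `P` to the reduction of its twisted extension of scalars. -/
noncomputable def twistedUnit : P ⟶ (redFunctor A R).obj (twisted hn f) where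
  toLin := (toRed (twisted hn f)).toLin ∘ₗ extOne hn f
  map_mem := fun {i p} hp => (toRed (twisted hn f)).map_mem (by
    have := linDeg_extOne hn f i p hp
    rwa [add_zero] at this)
  map_d := fun p => by
    have e := (toRed (twisted hn f)).map_d (extOne hn f p)
    refine Eq.trans ?_ e
    -- The twisting term lies in the image of `P ⊗_S n`, so it disappears in the reduction.
    refine Eq.symm ((congrArg (toRed (twisted hn f)).toLin (twisted_d_one hn f p)).trans ?_)
    refine (map_add (toRed (twisted hn f)).toLin _ _).trans ?_
    exact (congrArg₂ _ rfl (toRed_extKer hn f _)).trans (add_zero _)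

theorem twistedUnit_surjective : Function.Surjective (twistedUnit hn f).toLin := fun y => by
  obtain ⟨l, rfl⟩ := toRed_surjective _ y
  refine ext_induction (A := A) (R := R) (P := P)
    (p := fun l => ∃ p, (twistedUnit hn f).toLin p = (toRed (twisted hn f)).toLin l) ?_ ?_ l
  · intro i j p r _ _
    refine ⟨op (A.unit (R.aug r)) • p, ?_⟩
    have e : extMk A R P p r
        = (op ((tAlg A R).unit r) • (show (twisted hn f).carrier from extMk A R P p 1) :
          (twisted hn f).carrier) := by
      refine Eq.trans ?_ (twisted_smul_unit hn f (extMk A R P p 1) r).symm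
      rw [extRight_mk, one_mul]
    have e' : extMk A R P (op (A.unit (R.aug r)) • p) 1
        = (op ((tAlg A R).unit (R.unit (R.aug r))) •
          (show (twisted hn f).carrier from extMk A R P p 1) : (twisted hn f).carrier) := by
      refine Eq.trans ?_ (twisted_smul_unit hn f (extMk A R P p 1) _).symm
      rw [extRight_mk, one_mul, extMk_unit]
    refine (congrArg (redOne (tAlg A R) (twisted hn f)) e').trans ?_
    refine (redOne_aug (tAlg A R) (twisted hn f) _ r).symm.trans ?_
    exact (congrArg (redOne (tAlg A R) (twisted hn f)) e).symm
  · rintro x y ⟨p, hp⟩ ⟨q, hq⟩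
    refine ⟨p + q, (map_add (twistedUnit hn f).toLin p q).trans ?_⟩
    exact (congrArg₂ _ hp hq).trans (map_add (toRed (twisted hn f)).toLin x y).symm

/-- The map `p ⊗ r ↦ p ε(r)`, with `ε` the augmentation, kills multiples of elements of `n`, so it
descends to the reduction and gives a left inverse. -/
theorem twistedUnit_injective : Function.Injective (twistedUnit hn f).toLin := by
  let ρ : P →ₗ[k] R.toDGAlg →ₗ[k] P :=
    LinearMap.mk₂ k (fun p r => op (A.unit (R.aug r)) • p) (fun _ _ _ => smul_add _ _ _)
      (fun _ _ _ => smul_comm _ _ _)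
      (fun p r r' => by rw [map_add, map_add, MulOpposite.op_add, add_smul])
      (fun c p r => by rw [map_smul, map_smul, MulOpposite.op_smul, smul_assoc])
  have hρ : ∀ p r r', ρ (ρ p r) r' = ρ p (r * r') := fun p r r' => by
    change op (A.unit (R.aug r')) • op (A.unit (R.aug r)) • p = op (A.unit (R.aug (r * r'))) • p
    rw [← mul_smul, ← op_mul, ← map_mul, ← map_mul]
  let π : Ext A R P →ₗ[k] P := extLift ρ hρ LinearMap.id (fun s p => by
    change _ = op (A.unit (R.aug (R.unit s))) • p
    rw [R.aug_unit]
    rfl)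
  have hπ : ∀ x r, π (extRight A R P x r) = ρ (π x) r := fun x r => by
    refine ext_induction (p := fun x => π (extRight A R P x r) = ρ (π x) r) ?_ ?_ x
    · intro _ _ p r' _ _
      exact (hρ p r' r).symm
    · intro x y hx hy
      simp only [map_add, LinearMap.add_apply, hx, hy]
  obtain ⟨ψ, hψ⟩ := exists_redLift (E := tAlg A R) (L := twisted hn f) π (fun x hx l => by
    refine (congrArg π (twisted_smul_unit hn f l x)).trans ((hπ l x).trans ?_)
    change op (A.unit (R.aug x)) • π l = 0
    rw [(mem_augKer R).1 hx, map_zero, op_zero, zero_smul])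
  refine Function.LeftInverse.injective (g := fun y => ψ y) fun p => ?_
  refine (hψ (extMk A R P p 1)).trans ?_
  change op (A.unit (R.aug 1)) • p = p
  rw [map_one, map_one, op_one, one_smul]

theorem redIncl_twistedUnit (hL : ((DGModule.res (tAlg A R).unit).obj (twisted hn f)).IsGradedFree)
    (t : TensorCarrier A P (kerModuleS R)) :
    (redIncl hn hL).toLin ((tensorHom A (kerModuleS R) (twistedUnit hn f)).toLin t)
      = extKer A R P t := by
  refine tensor_induction (p := fun t => (redIncl hn hL).toLin
    ((tensorHom A (kerModuleS R) (twistedUnit hn f)).toLin t) = extKer A R P t) ?_ ?_ t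
  · intro i j p x _ _
    refine (redIncl_redTmk hn hL (extMk A R P p 1) x).trans ?_
    refine (twisted_smul_unit hn f (extMk A R P p 1) (kerVal R x)).trans ?_
    rw [extRight_mk, one_mul]
    rfl
  · intro t t' h h'
    refine ((congrArg _ (map_add _ t t')).trans (map_add (redIncl hn hL).toLin _ _)).trans ?_
    exact (congrArg₂ (fun s t : Ext A R P => s + t) h h').trans (map_add (extKer A R P) t t').symm

/-- This is `map_connecting` for the lift `p ↦ p ⊗ 1`, with `twisted_d_one` for its commutator. -/
theorem twistedUnit_connecting
    (hL : ((DGModule.res (tAlg A R).unit).obj (twisted hn f)).IsGradedFree) :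
    (relQ A).map (twistedUnit hn f) ≫ connecting hn hL
      = (relQ A).map (f ≫ shiftKerMap R (twistedUnit hn f)) := by
  refine map_connecting hn hL (twistedUnit hn f) (extOne hn f) (linDeg_extOne hn f) (fun _ => rfl)
    _ fun p => ?_
  refine (redIncl_twistedUnit hn f hL (f.toLin p)).trans ?_
  refine Eq.trans ?_ (hd_apply_zero (extOne hn f) (linDeg_extOne hn f) p).symm
  exact (sub_eq_of_eq_add' (twisted_d_one hn f p)).symm

end TwistedClass

/-! The classification of deformations. -/

section Classification

variable {S : CDGAlg k} {A : DGAlgebra S} {R : AugCDGAlgebra S} (hn : SquareZero R)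
  {L L' : DGModule (tAlg A R).toDGAlg}
  (hL : ((DGModule.res (tAlg A R).unit).obj L).IsGradedFree)
  (hL' : ((DGModule.res (tAlg A R).unit).obj L').IsGradedFree)

/-- The connecting morphism of `L`, as a morphism of the reduction of `L`. -/
noncomputable def conn (hn : SquareZero R)
    (hL : ((DGModule.res (tAlg A R).unit).obj L).IsGradedFree) :
    (reduction A R).obj ((relQ (tAlg A R)).obj L) ⟶
      (tensorShift A (kerModuleS R)).obj ((reduction A R).obj ((relQ (tAlg A R)).obj L)) :=
  connecting hn hL

theorem conn_naturality_map (v : L ⟶ L') :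
    (reduction A R).map ((relQ (tAlg A R)).map v) ≫ conn hn hL' = conn hn hL ≫
      (tensorShift A (kerModuleS R)).map ((reduction A R).map ((relQ (tAlg A R)).map v)) :=
  connecting_naturality hn hL hL' v

/-- A morphism of the derived category from `L` need not come from one of dg modules, but it does
after composition with a relatively projective resolution `s`. Naturality for `s` and for the
representative then implies it for `v`. -/
theorem conn_naturality
    (hA : ((DGModule.res A.unit).obj (DGModule.regular A.toDGAlg)).IsGradedFree)
    (v : (relQ (tAlg A R)).obj L ⟶ (relQ (tAlg A R)).obj L') :
    (reduction A R).map v ≫ conn hn hL'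
      = conn hn hL ≫ (tensorShift A (kerModuleS R)).map ((reduction A R).map v) := by
  obtain ⟨Λ, s, hP, -, hΛ, hs⟩ := exists_resolution (isGradedFree_tAlg (R := R) hA) hL
  have : IsIso ((relQ (tAlg A R)).map s) := (relQis (tAlg A R)).Q_inverts _ hs
  obtain ⟨g, hg⟩ := hP.exists_rep ((relQ (tAlg A R)).map s ≫ v)
  refine (cancel_epi ((reduction A R).map ((relQ (tAlg A R)).map s))).1 ?_
  rw [← Category.assoc, ← Functor.map_comp, hg, conn_naturality_map hn hΛ hL', ← Category.assoc,
    conn_naturality_map hn hΛ hL, Category.assoc, ← Functor.map_comp, ← Functor.map_comp, hg]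

/-- The lifts of `α` and of its inverse are not claimed to be mutually inverse. Both composites
reduce to identities, hence are isomorphisms, which makes the lift of `α` monic and split epic. -/
theorem exists_iso_of_isRelProj (hP : IsRelProj (tAlg A R) L) (hF : L.IsGradedFree)
    (hP' : IsRelProj (tAlg A R) L') (hF' : L'.IsGradedFree)
    (α : (reduction A R).obj ((relQ (tAlg A R)).obj L) ≅
      (reduction A R).obj ((relQ (tAlg A R)).obj L'))
    (hα : α.hom ≫ conn hn hL' = conn hn hL ≫ (tensorShift A (kerModuleS R)).map α.hom) :
    ∃ v : (relQ (tAlg A R)).obj L ≅ (relQ (tAlg A R)).obj L', (reduction A R).map v.hom = α.hom := by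
  obtain ⟨φ, hφ⟩ := (isRelProj_red hP).exists_rep (N := (redFunctor A R).obj L') α.hom
  obtain ⟨φ', hφ'⟩ := (isRelProj_red hP').exists_rep (N := (redFunctor A R).obj L) α.inv
  have hα' : α.inv ≫ conn hn hL = conn hn hL' ≫ (tensorShift A (kerModuleS R)).map α.inv := by
    rw [Iso.inv_comp_eq, ← Category.assoc, hα, Category.assoc, ← Functor.map_comp, α.hom_inv_id,
      CategoryTheory.Functor.map_id, Category.comp_id]
  obtain ⟨v, hv⟩ := exists_lift_of_connecting hn hL hL' hP hF φ (by
    rw [hφ] at hα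
    exact hα)
  obtain ⟨v', hv'⟩ := exists_lift_of_connecting hn hL' hL hP' hF' φ' (by
    rw [hφ'] at hα'
    exact hα')
  have e : (reduction A R).map ((relQ (tAlg A R)).map v) = α.hom :=
    (congrArg (relQ A).map hv).trans hφ.symm
  have e' : (reduction A R).map ((relQ (tAlg A R)).map v') = α.inv :=
    (congrArg (relQ A).map hv').trans hφ'.symm
  have h1 : IsIso ((relQ (tAlg A R)).map v ≫ (relQ (tAlg A R)).map v') := by
    rw [← Functor.map_comp]
    refine isIso_of_red_eq_id hn hP hF (v ≫ v') ?_
    change (reduction A R).map ((relQ (tAlg A R)).map (v ≫ v')) = _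
    rw [Functor.map_comp, Functor.map_comp, e, e', α.hom_inv_id]
    exact ((relQ A).map_id _).symm
  have h2 : IsIso ((relQ (tAlg A R)).map v' ≫ (relQ (tAlg A R)).map v) := by
    rw [← Functor.map_comp]
    refine isIso_of_red_eq_id hn hP' hF' (v' ≫ v) ?_
    change (reduction A R).map ((relQ (tAlg A R)).map (v' ≫ v)) = _
    rw [Functor.map_comp, Functor.map_comp, e, e', α.inv_hom_id]
    exact ((relQ A).map_id _).symm
  have : Mono ((relQ (tAlg A R)).map v) :=
    mono_of_mono _ ((relQ (tAlg A R)).map v')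
  have : IsSplitEpi ((relQ (tAlg A R)).map v) := IsSplitEpi.mk' ⟨inv ((relQ (tAlg A R)).map v' ≫
    (relQ (tAlg A R)).map v) ≫ (relQ (tAlg A R)).map v', by
      rw [Category.assoc, IsIso.inv_hom_id]⟩
  have := isIso_of_mono_of_isSplitEpi ((relQ (tAlg A R)).map v)
  exact ⟨asIso ((relQ (tAlg A R)).map v), e⟩

/-- Isomorphisms between reductions which are compatible with the connecting morphisms lift. -/
theorem exists_iso_of_conn
    (hA : ((DGModule.res A.unit).obj (DGModule.regular A.toDGAlg)).IsGradedFree)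
    (α : (reduction A R).obj ((relQ (tAlg A R)).obj L) ≅
      (reduction A R).obj ((relQ (tAlg A R)).obj L'))
    (hα : α.hom ≫ conn hn hL' = conn hn hL ≫ (tensorShift A (kerModuleS R)).map α.hom) :
    ∃ v : (relQ (tAlg A R)).obj L ≅ (relQ (tAlg A R)).obj L', (reduction A R).map v.hom = α.hom := by
  obtain ⟨Λ, s, hP, hF, hΛ, hs⟩ := exists_resolution (isGradedFree_tAlg (R := R) hA) hL
  obtain ⟨Λ', s', hP', hF', hΛ', hs'⟩ := exists_resolution (isGradedFree_tAlg (R := R) hA) hL'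
  have : IsIso ((relQ (tAlg A R)).map s) := (relQis (tAlg A R)).Q_inverts _ hs
  have : IsIso ((relQ (tAlg A R)).map s') := (relQis (tAlg A R)).Q_inverts _ hs'
  let σ := asIso ((relQ (tAlg A R)).map s)
  let σ' := asIso ((relQ (tAlg A R)).map s')
  -- `α` is transported to the resolutions; it stays compatible with the connecting morphisms by
  -- `conn_naturality`.
  let β := (reduction A R).mapIso σ ≪≫ α ≪≫ (reduction A R).mapIso σ'.symm
  obtain ⟨v, hv⟩ := exists_iso_of_isRelProj hn hΛ hΛ' hP hF hP' hF' β (by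
    change ((reduction A R).map σ.hom ≫ α.hom ≫ (reduction A R).map σ'.inv) ≫ conn hn hΛ'
      = conn hn hΛ ≫ (tensorShift A (kerModuleS R)).map
        ((reduction A R).map σ.hom ≫ α.hom ≫ (reduction A R).map σ'.inv)
    rw [Category.assoc, Category.assoc, conn_naturality hn hL' hΛ' hA, ← Category.assoc α.hom, hα,
      Functor.map_comp, Functor.map_comp, ← Category.assoc (conn hn hΛ),
      ← conn_naturality hn hΛ hL hA]
    simp only [Category.assoc])
  refine ⟨σ.symm ≪≫ v ≪≫ σ', ?_⟩
  change (reduction A R).map (σ.inv ≫ v.hom ≫ σ'.hom) = α.hom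
  rw [Functor.map_comp, Functor.map_comp, hv]
  change (reduction A R).map σ.inv ≫ ((reduction A R).map σ.hom ≫ α.hom ≫
    (reduction A R).map σ'.inv) ≫ (reduction A R).map σ'.hom = α.hom
  simp only [Category.assoc]
  rw [Iso.map_inv_hom_id_assoc, Iso.map_inv_hom_id, Category.comp_id]

variable {M : DGModule A.toDGAlg}

/-- The characteristic class of a deformation. -/
noncomputable def charClass (hn : SquareZero R) (D : Deformation A R M) :
    (relQ A).obj M ⟶ (tensorShift A (kerModuleS R)).obj ((relQ A).obj M) :=
  D.u.inv ≫ conn hn D.free ≫ (tensorShift A (kerModuleS R)).map D.u.hom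

theorem isCharClass_iff (D : Deformation A R M)
    (c : (relQ A).obj M ⟶ (tensorShift A (kerModuleS R)).obj ((relQ A).obj M)) :
    IsCharClass hn D c ↔ charClass hn D = c := by
  constructor
  · rintro ⟨ε, h, h'⟩
    have e : conn hn D.free = ε := (eq_connecting_iff hn D.free ε).1 h
    rw [charClass, e, Iso.inv_comp_eq, h']
  · rintro rfl
    refine ⟨conn hn D.free, charRed_connecting hn D.free, ?_⟩
    rw [charClass, Iso.hom_inv_id_assoc]

theorem hom_charClass (D : Deformation A R M) : D.u.hom ≫ charClass hn D
    = conn hn D.free ≫ (tensorShift A (kerModuleS R)).map D.u.hom := by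
  rw [charClass, Iso.hom_inv_id_assoc]

theorem charClass_eq_of_hom
    (hA : ((DGModule.res A.unit).obj (DGModule.regular A.toDGAlg)).IsGradedFree)
    {D D' : Deformation A R M} (v : D ⟶ D') : charClass hn D = charClass hn D' := by
  refine (cancel_epi D.u.hom).1 ?_
  rw [hom_charClass]
  have h : (reduction A R).map v.1 ≫ D'.u.hom = D.u.hom := v.2
  rw [← h, Functor.map_comp, ← Category.assoc, ← conn_naturality hn D.free D'.free hA,
    Category.assoc, Category.assoc, hom_charClass]

/-- Equality of the classes says exactly that `u'⁻¹ ∘ u` commutes with the connecting morphisms. A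
lift of it is then an isomorphism of deformations. -/
theorem nonempty_iso_of_charClass_eq
    (hA : ((DGModule.res A.unit).obj (DGModule.regular A.toDGAlg)).IsGradedFree)
    {D D' : Deformation A R M} (h : charClass hn D = charClass hn D') : Nonempty (D ≅ D') := by
  obtain ⟨v, hv⟩ := exists_iso_of_conn hn D.free D'.free hA (D.u ≪≫ D'.u.symm) (by
    change (D.u.hom ≫ D'.u.inv) ≫ conn hn D'.free
      = conn hn D.free ≫ (tensorShift A (kerModuleS R)).map (D.u.hom ≫ D'.u.inv)
    rw [Functor.map_comp, ← Category.assoc (conn hn D.free), ← hom_charClass, h, charClass]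
    simp only [Category.assoc]
    rw [← Functor.map_comp, D'.u.hom_inv_id, CategoryTheory.Functor.map_id, Category.comp_id])
  have hv1 : (reduction A R).map v.hom = D.u.hom ≫ D'.u.inv := hv
  have hv2 : (reduction A R).map v.hom ≫ D'.u.hom = D.u.hom := by
    rw [hv1, Category.assoc, Iso.inv_hom_id, Category.comp_id]
  have hv3 : (reduction A R).map v.inv ≫ D.u.hom = D'.u.hom := by
    rw [← hv2, ← Functor.map_comp_assoc, v.inv_hom_id, CategoryTheory.Functor.map_id, Category.id_comp]
  exact ⟨⟨⟨v.hom, hv2⟩, ⟨v.inv, hv3⟩, Subtype.ext v.hom_inv_id, Subtype.ext v.inv_hom_id⟩⟩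

/-- On a relatively projective resolution `P` of `M` the class is represented by a morphism `f` of
dg modules. The extension of scalars twisted by `f` reduces to `P`, and the resolution identifies
`P` with `M` in the derived category. -/
theorem exists_charClass_eq
    (hA : ((DGModule.res A.unit).obj (DGModule.regular A.toDGAlg)).IsGradedFree)
    (hM : ((DGModule.res A.unit).obj M).IsGradedFree)
    (c : (relQ A).obj M ⟶ (tensorShift A (kerModuleS R)).obj ((relQ A).obj M)) :
    ∃ D : Deformation A R M, charClass hn D = c := by
  obtain ⟨P, s, hP, -, hPS, hs⟩ := exists_resolution hA hM
  have : IsIso ((relQ A).map s) := (relQis A).Q_inverts _ hs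
  let σ := asIso ((relQ A).map s)
  obtain ⟨f, hf⟩ := hP.exists_rep (N := shiftKer R P)
    (σ.hom ≫ c ≫ (tensorShift A (kerModuleS R)).map σ.inv)
  have hL := isGradedFree_twisted f hn hPS
  obtain ⟨g, hg, hg'⟩ := exists_inverse (twistedUnit hn f)
    ⟨twistedUnit_injective hn f, twistedUnit_surjective hn f⟩
  let κ : (relQ A).obj P ≅ (reduction A R).obj ((relQ (tAlg A R)).obj (twisted hn f)) :=
    (relQ A).mapIso ⟨twistedUnit hn f, g, hg, hg'⟩
  have hκ : κ.hom ≫ conn hn hL = (σ.hom ≫ c ≫ (tensorShift A (kerModuleS R)).map σ.inv) ≫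
      (tensorShift A (kerModuleS R)).map κ.hom := by
    refine ((twistedUnit_connecting hn f hL).trans ((relQ A).map_comp _ _)).trans ?_
    exact congrArg (fun t => t ≫ (tensorShift A (kerModuleS R)).map κ.hom) hf.symm
  refine ⟨⟨twisted hn f, hL, κ.symm ≪≫ σ⟩, ?_⟩
  change (σ.inv ≫ κ.hom) ≫ conn hn hL ≫ (tensorShift A (kerModuleS R)).map (κ.inv ≫ σ.hom) = c
  rw [Category.assoc, ← Category.assoc κ.hom, hκ, Functor.map_comp]
  simp only [Category.assoc]
  rw [Iso.inv_hom_id_assoc, Iso.map_hom_inv_id_assoc, Iso.map_inv_hom_id, Category.comp_id]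

end Classification

end DG

/-! ### The bijection between deformations and classes -/

theorem mainTheorem2 {k : Type u} [Field k] (S : DG.CDGAlg k) (R : DG.AugCDGAlgebra S)
    (hn : DG.SquareZero R) (A : DG.DGAlgebra S)
    (hA : ((DG.DGModule.res A.unit).obj (DG.DGModule.regular A.toDGAlg)).IsGradedFree)
    (M : DG.DGModule A.toDGAlg) (hM : ((DG.DGModule.res A.unit).obj M).IsGradedFree) :
    ∃ Φ : DG.Defo A R M →
        ((DG.relQ A).obj M ⟶
          (DG.tensorShift A (DG.kerModuleS R)).obj ((DG.relQ A).obj M)),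
      (∀ (D : DG.Deformation A R M)
        (c : (DG.relQ A).obj M ⟶
          (DG.tensorShift A (DG.kerModuleS R)).obj ((DG.relQ A).obj M)),
        DG.IsCharClass hn D c ↔ Φ (Quotient.mk _ D) = c) ∧
      Function.Bijective Φ := by
  refine ⟨Quotient.lift (DG.charClass hn) fun D D' ⟨e⟩ => DG.charClass_eq_of_hom hn hA e.hom,
    fun D c => DG.isCharClass_iff hn D c, ?_, fun c => ?_⟩
  · rintro ⟨D⟩ ⟨D'⟩ h
    exact Quotient.sound (DG.nonempty_iso_of_charClass_eq hn hA h)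
  · obtain ⟨D, hD⟩ := DG.exists_charClass_eq hn hA hM c
    exact ⟨Quotient.mk _ D, hD⟩
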